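/- **Setting.** Let $\mu>0$, $\lambda+\mu>0$, $\rho>0$, $\omega>0$, and let $\widetilde\lambda,\widetilde\mu\in\mathbb R$ satisfy $\widetilde\lambda+\widetilde\mu=\lambda+\mu$ (for instance $\widetilde\mu=\frac{\mu(\lambda+\mu)}{\lambda+3\mu}$). Put $k_s=\omega/\sqrt{\mu/\rho}$, $k_p=\omega/\sqrt{(\lambda+2\mu)/\rho}$, $\gamma_k(x,y)=\frac i4H_0^{(1)}(k|x-y|)$, and $$E(x,y)=\frac1\mu\gamma_{k_s}(x,y)I+\frac1{\rho\omega^2}\nabla_x\nabla_x^\top\left[\gamma_{k_s}(x,y)-\gamma_{k_p}(x,y)\right].$$ For a direction $\nu=(\nu_1,\nu_2)^\top$ and a vector field $v$ in the plane let $\operatorname{curl}v=\partial_1v_2-\partial_2v_1$, $\nu\times\operatorname{curl}v=(\nu_2,-\nu_1)^\top\operatorname{curl}v$, and $$T(\partial,\nu)v=2\mu\,\partial_\nu v+\lambda\,\nu\operatorname{div}v+\mu\,\nu\times\operatorname{curl}v,\qquad \widetilde T(\partial,\nu)v=(\mu+\widetilde\mu)\,\partial_\nu v+\widetilde\lambda\,\nu\operatorname{div}v+\widetilde\mu\,\nu\times\operatorname{curl}v;$$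 on matrices these operators act column by column. Let $\Gamma\subset\mathbb R^2$ be a smooth open arc, parametrized by an injective $C^\infty$ map $x:[-1,1]\to\mathbb R^2$ with $x'(t)\neq0$. Let $s$ be the arclength in the direction of increasing $t$, $\tau=dx/ds$ the unit tangent, and $\nu=(\tau_2,-\tau_1)^\top$ the unit normal. Let $w$ be a weight on $\Gamma$ that is positive and infinitely differentiable in the interior of the arc and such that near each endpoint $w=\sqrt d\,g$, where $d$ is the distance to the set of the two endpoints and $g$ is positive and infinitely differentiable up to the endpoint (for instance $w(x(t))=\sqrt{1-t^2}$); in particular $w$ vanishes at the endpoints. Let $u:\Gamma\to\mathbb C^2$ be twice continuously differentiable up to the endpoints, as a function of $t$. For a density $\psi$ on $\Gamma$ and an interior point $x$ of $\Gamma$ (not an endpoint) let $$\widetilde N[\psi](x)=\widetilde T(\partial_x,\nu_x)\int_\Gamma\left(\widetilde T(\partial_y,\nu_y)E(x,y)\right)^\top\psi(y)\,ds_y,$$ understood as the limit as $\varepsilon\to0$, $\varepsilon\ne0$ (from both sides of $\Gamma$), of $\widetilde T(\partial_z,\nu_x)$ applied to the potential at the point $z=x+\varepsilon\nu_x$. Let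 $N$ be the same operator with $T$ in place of $\widetilde T$, and let $\widetilde N^w[u]=\widetilde N[wu]$, $N^w[u]=N[wu]$. **Statement.** For every interior point $x$ of $\Gamma$ the potential is given by an absolutely convergent integral and is differentiable at every point off $\Gamma$, the limit that defines $\widetilde N^w[u](x)$ exists, $wu$ is differentiable in the interior of $\Gamma$, all the integrals below converge absolutely, all the derivatives below exist, and $$\begin{aligned} \widetilde N^w[u](x)={}&-\int_\Gamma\left[\rho\omega^2\gamma_{k_s}(x,y)\left(\nu_x\nu_y^\top-\nu_x^\top\nu_yI\right)-\widetilde\mu k_s^2\gamma_{k_s}(x,y)J_{\nu_x,\nu_y}-\rho\omega^2\gamma_{k_p}(x,y)\nu_x\nu_y^\top\right]w(y)u(y)\,ds_y\\ &+(\mu+\widetilde\mu)^2\frac{d}{ds_x}\int_\Gamma AE(x,y)A\frac{d(w(y)u(y))}{ds_y}\,ds_y+2(\mu+\widetilde\mu)\frac{d}{ds_x}\int_\Gamma\gamma_{k_s}(x,y)\frac{d(w(y)u(y))}{ds_y}\,ds_y\\ &-(\mu+\widetilde\mu)\int_\Gamma\nu_x\nabla_x^\top\left[\gamma_{k_s}(x,y)-\gamma_{k_p}(x,y)\right]A\frac{d(w(y)u(y))}{ds_y}\,ds_y\\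 &-(\mu+\widetilde\mu)\frac{d}{ds_x}\int_\Gamma A\nabla_y\left[\gamma_{k_s}(x,y)-\gamma_{k_p}(x,y)\right]\nu_y^\top w(y)u(y)\,ds_y, \end{aligned}$$ where $A=\begin{pmatrix}0&-1\\1&0\end{pmatrix}$ and $J_{\nu_x,\nu_y}=\nu_y\nu_x^\top-\nu_x\nu_y^\top$. The same assertions, with $\widetilde\mu=\mu$ in the formula, hold for $N^w[u](x)$. -/

import Mathlib

open Set Filter Topology MeasureTheory
open scoped ContDiff Nat Matrix

noncomputable section

namespace ElasticArc

/-- The Euclidean plane. -/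
abbrev Plane : Type := EuclideanSpace ℝ (Fin 2)

/-- Complex vectors with two components. -/
abbrev CVec : Type := Fin 2 → ℂ

/-- Complex two by two matrices. -/
abbrev CMat : Type := Matrix (Fin 2) (Fin 2) ℂ

/-! ### The fundamental solution of the Helmholtz equation -/

/-- The Bessel function `J₀` of a real argument, by its power series. -/
def besselJ0 (r : ℝ) : ℝ :=
  ∑' n : ℕ, (-1 : ℝ) ^ n / ((n ! : ℝ) ^ 2) * (r / 2) ^ (2 * n)

/-- The Bessel function `Y₀` of a positive real argument, by its standard series
(`harmonic n = 1 + 1/2 + ⋯ + 1/n`). -/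
def besselY0 (r : ℝ) : ℝ :=
  2 / Real.pi * (Real.log (r / 2) + Real.eulerMascheroniConstant) * besselJ0 r
    - 2 / Real.pi *
      ∑' n : ℕ, (-1 : ℝ) ^ n * (harmonic n : ℝ) / ((n ! : ℝ) ^ 2) * (r / 2) ^ (2 * n)

/-- The Hankel function of the first kind of order zero, for positive arguments. -/
def hankel0 (r : ℝ) : ℂ := (besselJ0 r : ℂ) + Complex.I * (besselY0 r : ℂ)

/-- The fundamental solution `γ_k(x, y) = (i/4) H₀⁽¹⁾(k |x - y|)` of the Helmholtz equation. -/
def helmholtzFS (k : ℝ) (x y : Plane) : ℂ := Complex.I / 4 * hankel0 (k * ‖x - y‖)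

/-! ### The elastic medium and the fundamental displacement tensor -/

/-- Lamé constants, mass density and frequency. -/
structure ElasticMedium where
  lam : ℝ
  mu : ℝ
  rho : ℝ
  omega : ℝ
  mu_pos : 0 < mu
  lam_add_mu_pos : 0 < lam + mu
  rho_pos : 0 < rho
  omega_pos : 0 < omega

/-- The shear wave number. -/
def ElasticMedium.kS (m : ElasticMedium) : ℝ := m.omega / √(m.mu / m.rho)

/-- The compressional wave number. -/
def ElasticMedium.kP (m : ElasticMedium) : ℝ := m.omega / √((m.lam + 2 * m.mu) / m.rho)

/-- `ρ ω²`. -/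
def ElasticMedium.rhoOmegaSq (m : ElasticMedium) : ℝ := m.rho * m.omega ^ 2

/-- Partial derivative in the `i`-th coordinate direction. -/
def pd (i : Fin 2) (f : Plane → ℂ) (x : Plane) : ℂ :=
  fderiv ℝ f x (EuclideanSpace.single i 1)

/-- `γ_{k_s}(x, y)`. -/
def gammaS (m : ElasticMedium) (x y : Plane) : ℂ := helmholtzFS m.kS x y

/-- `γ_{k_p}(x, y)`. -/
def gammaP (m : ElasticMedium) (x y : Plane) : ℂ := helmholtzFS m.kP x y

/-- `γ_{k_s}(x, y) - γ_{k_p}(x, y)`. -/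
def gammaDiff (m : ElasticMedium) (x y : Plane) : ℂ := gammaS m x y - gammaP m x y

/-- `∇_x [γ_{k_s}(x, y) - γ_{k_p}(x, y)]`. -/
def gradXDiff (m : ElasticMedium) (x y : Plane) : CVec :=
  fun i => pd i (fun z => gammaDiff m z y) x

/-- `∇_y [γ_{k_s}(x, y) - γ_{k_p}(x, y)]`. -/
def gradYDiff (m : ElasticMedium) (x y : Plane) : CVec :=
  fun i => pd i (fun z => gammaDiff m x z) y

/-- The fundamental displacement tensor
`E(x, y) = μ⁻¹ γ_{k_s} I + (ρω²)⁻¹ ∇_x ∇_xᵀ [γ_{k_s} - γ_{k_p}]`. -/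
def tensorE (m : ElasticMedium) (x y : Plane) : CMat :=
  ((1 / m.mu : ℝ) * gammaS m x y) • (1 : CMat) +
    ((1 / m.rhoOmegaSq : ℝ) : ℂ) •
      Matrix.of fun i j => pd i (fun z => pd j (fun z' => gammaDiff m z' y) z) x

/-! ### Traction operators -/

/-- The type of operators `T(∂, ν)` which send a direction `ν`, a vector field and a point to
a vector. -/
abbrev TractionOp : Type := Plane → (Plane → CVec) → Plane → CVec

/-- `∂_ν v`. -/
def normalDeriv (ν : Plane) (v : Plane → CVec) (x : Plane) : CVec :=
  fun i => ∑ j, (ν j : ℂ) * pd j (fun y => v y i) x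

/-- `ν div v`. -/
def normalDiv (ν : Plane) (v : Plane → CVec) (x : Plane) : CVec :=
  fun i => (ν i : ℂ) * ∑ j, pd j (fun y => v y j) x

/-- The planar scalar `curl v = ∂₁ v₂ - ∂₂ v₁`. -/
def curl (v : Plane → CVec) (x : Plane) : ℂ :=
  pd 0 (fun y => v y 1) x - pd 1 (fun y => v y 0) x

/-- `ν × curl v`, the cross product of `(ν₁, ν₂, 0)` and `(0, 0, curl v)`. -/
def normalCurl (ν : Plane) (v : Plane → CVec) (x : Plane) : CVec :=
  ![(ν 1 : ℂ) * curl v x, -((ν 0 : ℂ) * curl v x)]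

/-- The traction operator `T v = 2μ ∂_ν v + λ ν div v + μ ν × curl v`. -/
def traction (m : ElasticMedium) : TractionOp := fun ν v x =>
  ((2 * m.mu : ℝ) : ℂ) • normalDeriv ν v x + (m.lam : ℂ) • normalDiv ν v x
    + (m.mu : ℂ) • normalCurl ν v x

/-- The modified traction operator
`T̃ v = (μ + μ̃) ∂_ν v + λ̃ ν div v + μ̃ ν × curl v`; here `lamT` is `λ̃` and `muT` is `μ̃`. -/
def modTraction (m : ElasticMedium) (lamT muT : ℝ) : TractionOp := fun ν v x =>
  ((m.mu + muT : ℝ) : ℂ) • normalDeriv ν v x + (lamT : ℂ) • normalDiv ν v x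
    + (muT : ℂ) • normalCurl ν v x

/-- A traction operator applied to each column of a matrix field. -/
def TractionOp.onColumns (T : TractionOp) (ν : Plane) (F : Plane → CMat) (x : Plane) : CMat :=
  Matrix.of fun i j => T ν (fun y k => F y k j) x i

/-! ### Open arcs -/

/-- A smooth open arc, given by a smooth regular injective parametrization of `[-1, 1]`. -/
structure OpenArc where
  param : ℝ → Plane
  smooth : ContDiffOn ℝ ∞ param (Icc (-1) 1)
  injective : InjOn param (Icc (-1) 1)
  regular : ∀ t ∈ Icc (-1 : ℝ) 1, derivWithin param (Icc (-1) 1) t ≠ 0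

/-- The arc as a set of points. -/
def OpenArc.carrier (Γ : OpenArc) : Set Plane := Γ.param '' Icc (-1) 1

/-- The velocity `x'(t)` (one-sided at the endpoints). -/
def OpenArc.velocity (Γ : OpenArc) (t : ℝ) : Plane := derivWithin Γ.param (Icc (-1) 1) t

/-- The speed `|x'(t)|`. -/
def OpenArc.speed (Γ : OpenArc) (t : ℝ) : ℝ := ‖Γ.velocity t‖

/-- The unit normal `ν = (τ₂, -τ₁)`, where `τ = x'/|x'|` is the unit tangent. -/
def OpenArc.normal (Γ : OpenArc) (t : ℝ) : Plane :=
  !₂[Γ.velocity t 1 / Γ.speed t, -(Γ.velocity t 0 / Γ.speed t)]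

/-- The unit normal as a complex vector. -/
def OpenArc.normalC (Γ : OpenArc) (t : ℝ) : CVec := fun i => (Γ.normal t i : ℂ)

/-- The integral `∫_Γ f ds` of a function of the parameter. -/
def OpenArc.integral (Γ : OpenArc) (f : ℝ → CVec) : CVec :=
  ∫ τ in (-1 : ℝ)..1, Γ.speed τ • f τ

/-- Integrability with respect to the arclength. -/
def OpenArc.IsIntegrable (Γ : OpenArc) (f : ℝ → CVec) : Prop :=
  IntervalIntegrable (fun τ => Γ.speed τ • f τ) volume (-1) 1

/-- The tangential derivative `df/ds = |x'(t)|⁻¹ df/dt`, at interior points of the arc. -/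
def OpenArc.tangentialDeriv (Γ : OpenArc) (f : ℝ → CVec) (t : ℝ) : CVec :=
  (Γ.speed t)⁻¹ • deriv f t

/-- The distance of the point with parameter `t` to the edge (the two endpoints). -/
def OpenArc.edgeDist (Γ : OpenArc) (t : ℝ) : ℝ :=
  Metric.infDist (Γ.param t) {Γ.param (-1), Γ.param 1}

/-- A weight `w > 0`, smooth in the interior of the arc, with `w ∼ √d` at the edge: near each
endpoint, `w/√d` is positive and infinitely differentiable up to the endpoint. -/
structure OpenArc.IsEdgeWeight (Γ : OpenArc) (w : ℝ → ℝ) : Prop where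
  pos : ∀ t ∈ Ioo (-1 : ℝ) 1, 0 < w t
  smooth : ContDiffOn ℝ ∞ w (Ioo (-1) 1)
  edge : ∀ e ∈ ({-1, 1} : Set ℝ), ∃ g : ℝ → ℝ, 0 < g e ∧
    ContDiffWithinAt ℝ ∞ g (Icc (-1) 1) e ∧
    ∀ᶠ t in 𝓝[Icc (-1) 1] e, w t = √(Γ.edgeDist t) * g t

/-! ### The hypersingular operators -/

/-- The kernel `(T(∂_y, ν_y) E(z, y))ᵀ` at `y = x(τ)`, applied to the density. -/
def doubleLayerIntegrand (m : ElasticMedium) (Γ : OpenArc) (T : TractionOp) (ψ : ℝ → CVec)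
    (z : Plane) (τ : ℝ) : CVec :=
  (T.onColumns (Γ.normal τ) (fun y => tensorE m z y) (Γ.param τ))ᵀ *ᵥ ψ τ

/-- The double-layer potential `∫_Γ (T(∂_y, ν_y) E(z, y))ᵀ ψ(y) ds_y`. -/
def doubleLayer (m : ElasticMedium) (Γ : OpenArc) (T : TractionOp) (ψ : ℝ → CVec)
    (z : Plane) : CVec :=
  Γ.integral (doubleLayerIntegrand m Γ T ψ z)

/-- `T(∂_z, ν_x)` applied to the double-layer potential at the point `z = x + ε ν_x`. -/
def offArcTraction (m : ElasticMedium) (Γ : OpenArc) (T : TractionOp) (ψ : ℝ → CVec)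
    (t ε : ℝ) : CVec :=
  T (Γ.normal t) (doubleLayer m Γ T ψ) (Γ.param t + ε • Γ.normal t)

/-- The hypersingular operator
`N[ψ](x) = T(∂_x, ν_x) ∫_Γ (T(∂_y, ν_y) E(x, y))ᵀ ψ(y) ds_y` at the point `x` with parameter `t`,
as the two-sided limit of the traction of the potential along the normal. -/
def hypersingular (m : ElasticMedium) (Γ : OpenArc) (T : TractionOp) (ψ : ℝ → CVec)
    (t : ℝ) : CVec :=
  limUnder (𝓝[≠] (0 : ℝ)) (offArcTraction m Γ T ψ t)

/-- `N[ψ]` is well defined at the point with parameter `t`: the potential is given by convergent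
integrals and is differentiable off the arc, and its traction has a limit. -/
def HypersingularExists (m : ElasticMedium) (Γ : OpenArc) (T : TractionOp) (ψ : ℝ → CVec)
    (t : ℝ) : Prop :=
  (∀ z ∉ Γ.carrier, Γ.IsIntegrable (doubleLayerIntegrand m Γ T ψ z) ∧
    DifferentiableAt ℝ (doubleLayer m Γ T ψ) z) ∧
  ∃ L : CVec, Tendsto (offArcTraction m Γ T ψ t) (𝓝[≠] 0) (𝓝 L)

/-- The product of the weight and the density. -/
def weighted (w : ℝ → ℝ) (u : ℝ → CVec) (t : ℝ) : CVec := (w t : ℂ) • u t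

/-- The weighted hypersingular operator `N^w[u] = N[wu]`. -/
def weightedHypersingular (m : ElasticMedium) (Γ : OpenArc) (T : TractionOp) (w : ℝ → ℝ)
    (u : ℝ → CVec) (t : ℝ) : CVec :=
  hypersingular m Γ T (weighted w u) t

/-! ### The regularized expression -/

/-- The matrix `A` of the rotation by a right angle. -/
def matA : CMat := !![0, -1; 1, 0]

/-- `[ρω² γ_{k_s} (ν_x ν_yᵀ - ν_xᵀ ν_y I) - μ̃ k_s² γ_{k_s} J - ρω² γ_{k_p} ν_x ν_yᵀ] ψ(y)` with
`J = ν_y ν_xᵀ - ν_x ν_yᵀ`. -/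
def integrand1 (m : ElasticMedium) (Γ : OpenArc) (muT : ℝ) (ψ : ℝ → CVec) (t τ : ℝ) : CVec :=
  let x := Γ.param t
  let y := Γ.param τ
  let νx := Γ.normalC t
  let νy := Γ.normalC τ
  (((m.rhoOmegaSq : ℂ) * gammaS m x y) •
      (Matrix.vecMulVec νx νy - (νx ⬝ᵥ νy) • (1 : CMat))
    - ((muT * m.kS ^ 2 : ℝ) * gammaS m x y) •
      (Matrix.vecMulVec νy νx - Matrix.vecMulVec νx νy)
    - ((m.rhoOmegaSq : ℂ) * gammaP m x y) • Matrix.vecMulVec νx νy) *ᵥ ψ τ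

/-- `A E(x, y) A dψ(y)/ds_y`. -/
def integrand2 (m : ElasticMedium) (Γ : OpenArc) (ψ : ℝ → CVec) (t τ : ℝ) : CVec :=
  (matA * tensorE m (Γ.param t) (Γ.param τ) * matA) *ᵥ Γ.tangentialDeriv ψ τ

/-- `γ_{k_s}(x, y) dψ(y)/ds_y`. -/
def integrand3 (m : ElasticMedium) (Γ : OpenArc) (ψ : ℝ → CVec) (t τ : ℝ) : CVec :=
  gammaS m (Γ.param t) (Γ.param τ) • Γ.tangentialDeriv ψ τ

/-- `ν_x ∇_xᵀ [γ_{k_s} - γ_{k_p}] A dψ(y)/ds_y`. -/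
def integrand4 (m : ElasticMedium) (Γ : OpenArc) (ψ : ℝ → CVec) (t τ : ℝ) : CVec :=
  (Matrix.vecMulVec (Γ.normalC t) (gradXDiff m (Γ.param t) (Γ.param τ)) * matA) *ᵥ
    Γ.tangentialDeriv ψ τ

/-- `A ∇_y [γ_{k_s} - γ_{k_p}] ν_yᵀ ψ(y)`. -/
def integrand5 (m : ElasticMedium) (Γ : OpenArc) (ψ : ℝ → CVec) (t τ : ℝ) : CVec :=
  (matA * Matrix.vecMulVec (gradYDiff m (Γ.param t) (Γ.param τ)) (Γ.normalC τ)) *ᵥ ψ τ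

/-- The combination of integral operators and tangential derivatives in the regularized
formulation. -/
def regularized (m : ElasticMedium) (Γ : OpenArc) (muT : ℝ) (ψ : ℝ → CVec) (t : ℝ) : CVec :=
  - Γ.integral (integrand1 m Γ muT ψ t)
  + ((m.mu + muT) ^ 2 : ℝ) •
      Γ.tangentialDeriv (fun s => Γ.integral (integrand2 m Γ ψ s)) t
  + (2 * (m.mu + muT) : ℝ) •
      Γ.tangentialDeriv (fun s => Γ.integral (integrand3 m Γ ψ s)) t
  - (m.mu + muT : ℝ) • Γ.integral (integrand4 m Γ ψ t)
  - (m.mu + muT : ℝ) •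
      Γ.tangentialDeriv (fun s => Γ.integral (integrand5 m Γ ψ s)) t

/-- All the integrals and the derivatives in the regularized expression exist: the density has
a tangential derivative, the integrals converge absolutely, and those which are differentiated
are differentiable. -/
def RegularizedExists (m : ElasticMedium) (Γ : OpenArc) (muT : ℝ) (ψ : ℝ → CVec)
    (t : ℝ) : Prop :=
  (∀ s ∈ Ioo (-1 : ℝ) 1, DifferentiableAt ℝ ψ s) ∧
  (∀ s ∈ Ioo (-1 : ℝ) 1,
    Γ.IsIntegrable (integrand1 m Γ muT ψ s) ∧
    Γ.IsIntegrable (integrand2 m Γ ψ s) ∧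
    Γ.IsIntegrable (integrand3 m Γ ψ s) ∧
    Γ.IsIntegrable (integrand4 m Γ ψ s) ∧
    Γ.IsIntegrable (integrand5 m Γ ψ s)) ∧
  DifferentiableAt ℝ (fun s => Γ.integral (integrand2 m Γ ψ s)) t ∧
  DifferentiableAt ℝ (fun s => Γ.integral (integrand3 m Γ ψ s)) t ∧
  DifferentiableAt ℝ (fun s => Γ.integral (integrand5 m Γ ψ s)) t

end ElasticArc

end

open ElasticArc

/-!
Every kernel involved has the form `K(x - y)` with `K` smooth off the origin, so both sides are
combinations of potentials `Γ.layer K θ z = ∫ K (z - x(τ)) θ(τ) dτ`. The proof has three layers.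

*Kernels.* The Hankel function is `a(r²) + b(r²) log r²` with smooth (power series) coefficients
`a`, `b`, and the Bessel equation gives `Δγ_k = -k² γ_k` off the origin
(`laplacian_helmholtzKernel`).
In `γ_{k_s} - γ_{k_p}` the coefficients of `log r²` agree at the origin, because
`J₀(0) = 1` for all wave numbers; hence the gradient of the difference is bounded and the second
derivatives, thus also `E`, are only logarithmically singular. All that is used below is that these
kernels are `O(r^(-1/2))` and that their gradients are `O(r^(-3/2))` (`WeaklySingular`).

*The identity off the arc* (`doubleLayer_integrable`, `traction_doubleLayer`). In two dimensions the
modified traction is a tangential derivative plus a multiple of the divergence and of the curl: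
`T̃ v = (μ + μ̃) A ∂_τ v + (λ + 2μ) ν div v - μ (ν₂, -ν₁) curl v`. The divergence and the curl of
the columns of `E` are `∇γ_{k_p} / (λ + 2μ)` and a rotated `∇γ_{k_s} / μ` (`div_tensorKernel`,
`curl_tensorKernel`). The tangential derivative with respect to `y` is moved to the density by an
integration by parts, without boundary terms since `wu` vanishes at the edge
(`layer_deriv_density`). Applying the outer traction and using the Helmholtz equations gives the
regularized expression at every `z ∉ Γ`, with `d/ds_x` replaced by the derivative in the fixed
direction `τ_x`.

*The limit* (`layer_tendsto`, `layer_deriv_tendsto`). On the segment `x ± ε ν_x` a potential with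
weakly singular kernel converges to its value at `x`, and its derivative in the direction `τ_x`
converges to the derivative along the arc of its trace on `Γ`; neither has a jump. Near `x` this
follows from the substitution `τ = s + σ`: the derivative of `K(x(s) + ε ν - x(s + σ)) θ(s + σ)` in
`s` falls on the density and on the difference `x(s) - x(s + σ)`, whose derivative is `O(σ)`, so
that the integrand stays `O(|σ|^(-1/2))` uniformly in `ε` (`near_limit`). The densities `wu` and
`d(wu)/ds` are admissible: the latter is `O(d^(-1/2))` at the edge, hence integrable, and is
continuously differentiable in the interior (`edgeDensity_weighted`).
-/

namespace ElasticArc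

/-! ### Entire power series and the Bessel equation -/

/-- The sum of the real power series with coefficients `c`. -/
noncomputable def powerSum (c : ℕ → ℝ) (s : ℝ) : ℝ := ∑' n, c n * s ^ n

/-- Coefficients dominated by a multiple of those of the exponential series. Unlike the mere
convergence of the power series, this bound is visibly stable under termwise differentiation. -/
def ExpBounded (c : ℕ → ℝ) : Prop := ∃ C : ℝ, ∀ n, |c n| ≤ C / (n ! : ℝ)

/-- The coefficients of the termwise derivative. -/
def derivCoeff (c : ℕ → ℝ) (n : ℕ) : ℝ := (n + 1) * c (n + 1)

lemma ExpBounded.derivCoeff {c : ℕ → ℝ} (hc : ExpBounded c) : ExpBounded (derivCoeff c) := by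
  obtain ⟨C, hC⟩ := hc
  refine ⟨C, fun n => ?_⟩
  have h := hC (n + 1)
  have hn : (0 : ℝ) < n + 1 := by positivity
  have hf : (0 : ℝ) < (n ! : ℝ) := by positivity
  rw [Nat.factorial_succ, Nat.cast_mul, Nat.cast_add, Nat.cast_one,
    le_div_iff₀ (by positivity)] at h
  rw [ElasticArc.derivCoeff, abs_mul, abs_of_pos hn, le_div_iff₀ hf]
  linarith

lemma ExpBounded.shift {c : ℕ → ℝ} (hc : ExpBounded c) : ExpBounded (fun n => c (n + 1)) := by
  obtain ⟨C, hC⟩ := hc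
  have hC0 : 0 ≤ C := by
    have := (abs_nonneg _).trans (hC 0)
    simpa using this
  refine ⟨C, fun n => (hC (n + 1)).trans ?_⟩
  gcongr
  exact Nat.le_succ n

lemma ExpBounded.summable {c : ℕ → ℝ} (hc : ExpBounded c) (s : ℝ) :
    Summable fun n => c n * s ^ n := by
  obtain ⟨C, hC⟩ := hc
  refine Summable.of_norm_bounded ((Real.summable_pow_div_factorial |s|).mul_left C) fun n => ?_
  rw [norm_mul, norm_pow, Real.norm_eq_abs, Real.norm_eq_abs]
  calc |c n| * |s| ^ n ≤ C / (n ! : ℝ) * |s| ^ n := by gcongr; exact hC n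
    _ = _ := by ring

lemma ExpBounded.hasDerivAt {c : ℕ → ℝ} (hc : ExpBounded c) (s : ℝ) :
    HasDerivAt (powerSum c) (powerSum (ElasticArc.derivCoeff c) s) s := by
  obtain ⟨C, hC⟩ := id hc
  set R := |s| + 1
  have hR : 0 ≤ R := by positivity
  have hC0 : 0 ≤ C := by
    have := (abs_nonneg _).trans (hC 0)
    simpa using this
  set g' : ℕ → ℝ → ℝ := fun n y => c n * (n * y ^ (n - 1))
  set v : ℕ → ℝ := fun n => C / (n ! : ℝ) * (n * R ^ (n - 1))
  have hv : Summable v := by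
    rw [← summable_nat_add_iff 1]
    refine ((Real.summable_pow_div_factorial R).mul_left C).congr fun n => ?_
    simp only [v, Nat.factorial_succ, Nat.add_sub_cancel]
    push_cast
    field_simp
  have hs : s ∈ Metric.ball (0 : ℝ) R := by simp [R]
  have key := hasDerivAt_tsum_of_isPreconnected (g := fun n y => c n * y ^ n) (g' := g') hv
    Metric.isOpen_ball (convex_ball (0 : ℝ) R).isPreconnected
    (fun n y _ => (hasDerivAt_pow n y).const_mul (c n))
    (fun n y hy => by
      have hy' : |y| ≤ R := by simpa using (Metric.mem_ball.1 hy).le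
      simp only [g', v, norm_mul, norm_pow, Real.norm_eq_abs, Nat.abs_cast]
      gcongr
      exact hC n) hs (hc.summable s) hs
  have hsum : Summable fun n => g' n s := by
    rw [← summable_nat_add_iff 1]
    refine (hc.derivCoeff.summable s).congr fun n => ?_
    simp [g', ElasticArc.derivCoeff]; ring
  have hval : ∑' n, g' n s = powerSum (ElasticArc.derivCoeff c) s := by
    rw [hsum.tsum_eq_zero_add]
    simp only [powerSum, g', ElasticArc.derivCoeff]
    simp only [Nat.cast_zero, zero_mul, mul_zero, zero_add, Nat.add_sub_cancel]
    refine tsum_congr fun n => ?_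
    push_cast; ring
  rwa [hval] at key

lemma ExpBounded.deriv_eq {c : ℕ → ℝ} (hc : ExpBounded c) :
    deriv (powerSum c) = powerSum (ElasticArc.derivCoeff c) :=
  funext fun s => (hc.hasDerivAt s).deriv

lemma ExpBounded.contDiff {c : ℕ → ℝ} (hc : ExpBounded c) : ContDiff ℝ ∞ (powerSum c) := by
  refine contDiff_infty.2 fun n => ?_
  induction n generalizing c with
  | zero =>
    exact contDiff_zero.2 (continuous_iff_continuousAt.2 fun s => (hc.hasDerivAt s).continuousAt)
  | succ n ih =>
    push_cast
    refine contDiff_succ_iff_deriv.2 ⟨fun s => (hc.hasDerivAt s).differentiableAt, by simp, ?_⟩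
    rw [hc.deriv_eq]
    exact ih hc.derivCoeff

lemma ExpBounded.mul_powerSum_derivCoeff_add {c : ℕ → ℝ} (hc : ExpBounded c) (s : ℝ) :
    s * powerSum (ElasticArc.derivCoeff (ElasticArc.derivCoeff c)) s
        + powerSum (ElasticArc.derivCoeff c) s
      = powerSum (fun n => ((n : ℝ) + 1) ^ 2 * c (n + 1)) s := by
  have h2 := hc.derivCoeff.derivCoeff.summable s
  have h1 := hc.derivCoeff.summable s
  have h3 : Summable fun n : ℕ => (n : ℝ) * (n + 1) * c (n + 1) * s ^ n := by
    rw [← summable_nat_add_iff 1]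
    refine (h2.mul_left s).congr fun n => ?_
    simp only [ElasticArc.derivCoeff]
    push_cast; ring
  have h4 : s * powerSum (ElasticArc.derivCoeff (ElasticArc.derivCoeff c)) s
      = ∑' n : ℕ, (n : ℝ) * (n + 1) * c (n + 1) * s ^ n := by
    rw [h3.tsum_eq_zero_add, powerSum, ← tsum_mul_left]
    simp only [CharP.cast_eq_zero, zero_mul, zero_add]
    refine tsum_congr fun n => ?_
    simp only [ElasticArc.derivCoeff]
    push_cast; ring
  rw [h4, powerSum, powerSum, ← h3.tsum_add h1]
  refine tsum_congr fun n => ?_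
  simp only [ElasticArc.derivCoeff]
  ring

/-- Coefficients of `J₀(2√s)` as a power series in `s`. -/
noncomputable def besselCoeff (n : ℕ) : ℝ := (-1 : ℝ) ^ n / ((n ! : ℝ) ^ 2)

/-- Coefficients, in powers of `s`, of the harmonic series which enters `Y₀(2√s)`. -/
noncomputable def harmonicCoeff (n : ℕ) : ℝ :=
  (-1 : ℝ) ^ n * (harmonic n : ℝ) / ((n ! : ℝ) ^ 2)

lemma expBounded_besselCoeff : ExpBounded besselCoeff := by
  refine ⟨1, fun n => ?_⟩
  have h1 : (1 : ℝ) ≤ (n ! : ℝ) := by exact_mod_cast Nat.factorial_pos n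
  rw [besselCoeff, abs_div, abs_pow, abs_neg, abs_one, one_pow, abs_of_pos (by positivity)]
  gcongr
  nlinarith

lemma harmonic_le_factorial (n : ℕ) : (harmonic n : ℝ) ≤ (n ! : ℝ) := by
  induction n with
  | zero => simp
  | succ n ih =>
    rcases Nat.eq_zero_or_pos n with rfl | hn
    · simp [harmonic_succ]
    rw [harmonic_succ, Nat.factorial_succ]
    push_cast
    have h1 : (1 : ℝ) ≤ (n ! : ℝ) := by exact_mod_cast Nat.factorial_pos n
    have h2 : ((n : ℝ) + 1)⁻¹ ≤ 1 := inv_le_one_of_one_le₀ (by linarith [n.cast_nonneg (α := ℝ)])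
    have h3 : (1 : ℝ) ≤ n := by exact_mod_cast hn
    nlinarith

lemma expBounded_harmonicCoeff : ExpBounded harmonicCoeff := by
  refine ⟨1, fun n => ?_⟩
  have h1 : (0 : ℝ) < (n ! : ℝ) := by positivity
  have h0 : (0 : ℝ) ≤ (harmonic n : ℝ) := by
    simp only [harmonic]
    push_cast
    positivity
  rw [harmonicCoeff, abs_div, abs_mul, abs_pow, abs_neg, abs_one, one_pow, one_mul,
    abs_of_pos (show (0 : ℝ) < (n ! : ℝ) ^ 2 by positivity), abs_of_nonneg h0,
    div_le_div_iff₀ (by positivity) h1]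
  nlinarith [harmonic_le_factorial n]

/-- The function `B(s) = J₀(2√s)`. -/
noncomputable def besselB (s : ℝ) : ℝ := powerSum besselCoeff s

/-- The regular part `C(s) = ∑ (-1)ⁿ Hₙ sⁿ / (n!)²` of `Y₀(2√s)`, up to a factor. -/
noncomputable def besselC (s : ℝ) : ℝ := powerSum harmonicCoeff s

lemma contDiff_besselB : ContDiff ℝ ∞ besselB := expBounded_besselCoeff.contDiff
lemma contDiff_besselC : ContDiff ℝ ∞ besselC := expBounded_harmonicCoeff.contDiff

/-- Bessel's equation for `J₀`. -/
lemma besselB_ode (s : ℝ) :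
    s * deriv (deriv besselB) s + deriv besselB s + besselB s = 0 := by
  have hc := expBounded_besselCoeff
  have e1 : deriv besselB = powerSum (derivCoeff besselCoeff) := hc.deriv_eq
  rw [e1, hc.derivCoeff.deriv_eq, hc.mul_powerSum_derivCoeff_add, besselB, powerSum, powerSum,
    ← Summable.tsum_add]
  · convert tsum_zero with n
    rw [besselCoeff, besselCoeff, Nat.factorial_succ]
    push_cast
    field_simp
    ring
  · refine (hc.summable s).neg.congr fun n => ?_
    rw [besselCoeff, besselCoeff, Nat.factorial_succ]
    push_cast
    field_simp
    ring
  · exact hc.summable s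

/-- The inhomogeneous Bessel equation for the regular part of `Y₀`; its right-hand side cancels
the terms produced by the logarithm. -/
lemma besselC_ode (s : ℝ) :
    s * deriv (deriv besselC) s + deriv besselC s + besselC s = deriv besselB s := by
  have hc := expBounded_harmonicCoeff
  have hb := expBounded_besselCoeff
  have e1 : deriv besselC = powerSum (derivCoeff harmonicCoeff) := hc.deriv_eq
  have e2 : deriv besselB = powerSum (derivCoeff besselCoeff) := hb.deriv_eq
  have key (n : ℕ) : ((n : ℝ) + 1) ^ 2 * harmonicCoeff (n + 1) * s ^ n
      = derivCoeff besselCoeff n * s ^ n - harmonicCoeff n * s ^ n := by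
    rw [derivCoeff, besselCoeff, harmonicCoeff, harmonicCoeff, Nat.factorial_succ, harmonic_succ]
    push_cast
    field_simp
    ring
  rw [e1, hc.derivCoeff.deriv_eq, hc.mul_powerSum_derivCoeff_add, e2, besselC, powerSum, powerSum,
    powerSum]
  simp_rw [key]
  rw [(hb.derivCoeff.summable s).tsum_sub (hc.summable s)]
  ring

/-- The divided difference `(B(s) - 1) / s`, which is again an entire function. -/
noncomputable def besselB1 (s : ℝ) : ℝ := powerSum (fun n => besselCoeff (n + 1)) s

lemma contDiff_besselB1 : ContDiff ℝ ∞ besselB1 := expBounded_besselCoeff.shift.contDiff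

lemma besselB_eq (s : ℝ) : besselB s = 1 + s * besselB1 s := by
  rw [besselB, besselB1, powerSum, powerSum, (expBounded_besselCoeff.summable s).tsum_eq_zero_add,
    ← tsum_mul_left]
  congr 1
  · simp [besselCoeff]
  · exact tsum_congr fun n => by ring

/-! ### Order of a kernel at the origin -/

/-- `K` is differentiable off the origin and, on bounded sets, `K = O(|v|^d)` and
`∇K = O(|v|^(d-1))`. -/
def KernelOrder {E : Type*} [NormedAddCommGroup E] [NormedSpace ℝ E] (d : ℝ) (K : E → ℂ) : Prop :=
  (∀ v ≠ 0, DifferentiableAt ℝ K v) ∧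
    ∀ R : ℝ, ∃ C : ℝ, 0 ≤ C ∧ ∀ v ≠ 0, ‖v‖ ≤ R →
      ‖K v‖ ≤ C * ‖v‖ ^ d ∧ ‖fderiv ℝ K v‖ ≤ C * ‖v‖ ^ (d - 1)

section KernelOrder

variable {E : Type*} [NormedAddCommGroup E] [NormedSpace ℝ E] {d e : ℝ} {K L : E → ℂ}

lemma KernelOrder.mul (hK : KernelOrder d K) (hL : KernelOrder e L) :
    KernelOrder (d + e) (fun v => K v * L v) := by
  refine ⟨fun v hv => (hK.1 v hv).mul (hL.1 v hv), fun R => ?_⟩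
  obtain ⟨C, hC, h⟩ := hK.2 R
  obtain ⟨D, hD, h'⟩ := hL.2 R
  refine ⟨2 * (C * D), by positivity, fun v hv hR => ?_⟩
  obtain ⟨h1, h2⟩ := h v hv hR
  obtain ⟨h3, h4⟩ := h' v hv hR
  have hv0 : 0 < ‖v‖ := norm_pos_iff.2 hv
  have e1 : ‖v‖ ^ (d + e) = ‖v‖ ^ d * ‖v‖ ^ e := Real.rpow_add hv0 _ _
  have e2 : ‖v‖ ^ (d + e - 1) = ‖v‖ ^ d * ‖v‖ ^ (e - 1) := by
    rw [← Real.rpow_add hv0]; congr 1; ring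
  have e3 : ‖v‖ ^ (d + e - 1) = ‖v‖ ^ (d - 1) * ‖v‖ ^ e := by
    rw [← Real.rpow_add hv0]; congr 1; ring
  have p1 : 0 ≤ C * D * ‖v‖ ^ (d + e) := by positivity
  constructor
  · rw [norm_mul]
    calc ‖K v‖ * ‖L v‖ ≤ (C * ‖v‖ ^ d) * (D * ‖v‖ ^ e) := by gcongr
      _ = C * D * ‖v‖ ^ (d + e) := by rw [e1]; ring
      _ ≤ _ := by linarith
  · rw [fderiv_fun_mul (hK.1 v hv) (hL.1 v hv)]
    refine (norm_add_le _ _).trans ?_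
    rw [norm_smul, norm_smul]
    calc ‖K v‖ * ‖fderiv ℝ L v‖ + ‖L v‖ * ‖fderiv ℝ K v‖
        ≤ (C * ‖v‖ ^ d) * (D * ‖v‖ ^ (e - 1)) + (D * ‖v‖ ^ e) * (C * ‖v‖ ^ (d - 1)) := by gcongr
      _ = C * D * (‖v‖ ^ d * ‖v‖ ^ (e - 1)) + C * D * (‖v‖ ^ (d - 1) * ‖v‖ ^ e) := by ring
      _ = _ := by rw [← e2, ← e3]; ring

lemma KernelOrder.add (hK : KernelOrder d K) (hL : KernelOrder d L) :
    KernelOrder d (fun v => K v + L v) := by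
  refine ⟨fun v hv => (hK.1 v hv).add (hL.1 v hv), fun R => ?_⟩
  obtain ⟨C, hC, h⟩ := hK.2 R
  obtain ⟨D, hD, h'⟩ := hL.2 R
  refine ⟨C + D, by positivity, fun v hv hR => ?_⟩
  obtain ⟨h1, h2⟩ := h v hv hR
  obtain ⟨h3, h4⟩ := h' v hv hR
  constructor
  · linarith [norm_add_le (K v) (L v)]
  · rw [fderiv_fun_add (hK.1 v hv) (hL.1 v hv)]
    linarith [norm_add_le (fderiv ℝ K v) (fderiv ℝ L v)]

lemma KernelOrder.const_mul (c : ℂ) (hK : KernelOrder d K) : KernelOrder d (fun v => c * K v) := by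
  refine ⟨fun v hv => (hK.1 v hv).const_mul c, fun R => ?_⟩
  obtain ⟨C, hC, h⟩ := hK.2 R
  refine ⟨‖c‖ * C, by positivity, fun v hv hR => ?_⟩
  obtain ⟨h1, h2⟩ := h v hv hR
  constructor
  · rw [norm_mul, mul_assoc]; gcongr
  · rw [fderiv_const_mul (hK.1 v hv), norm_smul, mul_assoc]; gcongr

lemma KernelOrder.mono (hK : KernelOrder e K) (hd : d ≤ e) : KernelOrder d K := by
  refine ⟨hK.1, fun R => ?_⟩
  obtain ⟨C, hC, h⟩ := hK.2 R
  set R' := max R 1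
  have hR' : 0 < R' := lt_of_lt_of_le one_pos (le_max_right _ _)
  refine ⟨C * R' ^ (e - d), by positivity, fun v hv hR => ?_⟩
  obtain ⟨h1, h2⟩ := h v hv hR
  have hv0 : 0 < ‖v‖ := norm_pos_iff.2 hv
  have key (a b : ℝ) (hab : b - a = e - d) : C * ‖v‖ ^ b ≤ C * R' ^ (e - d) * ‖v‖ ^ a := by
    have : ‖v‖ ^ b = ‖v‖ ^ (e - d) * ‖v‖ ^ a := by
      rw [← hab, ← Real.rpow_add hv0]; congr 1; ring
    have hr : ‖v‖ ^ (e - d) ≤ R' ^ (e - d) :=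
      Real.rpow_le_rpow hv0.le (hR.trans (le_max_left _ _)) (by linarith)
    rw [this, mul_assoc]
    gcongr
  exact ⟨h1.trans (key _ _ rfl), h2.trans (key _ _ (by ring))⟩

lemma KernelOrder.congr (hK : KernelOrder d K) (h : ∀ v ≠ 0, L v = K v) : KernelOrder d L := by
  have hev (v : E) (hv : v ≠ 0) : L =ᶠ[𝓝 v] K := by
    filter_upwards [isOpen_ne.mem_nhds hv] with w hw using h w hw
  refine ⟨fun v hv => (hK.1 v hv).congr_of_eventuallyEq (hev v hv), fun R => ?_⟩
  obtain ⟨C, hC, h'⟩ := hK.2 R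
  refine ⟨C, hC, fun v hv hR => ?_⟩
  rw [h v hv, (hev v hv).fderiv_eq]
  exact h' v hv hR

/-- A smooth function has order zero. -/
lemma kernelOrder_of_contDiff [ProperSpace E] (hK : ContDiff ℝ 1 K) : KernelOrder 0 K := by
  refine ⟨fun v _ => (hK.differentiable one_ne_zero) v, fun R => ?_⟩
  obtain ⟨C, hC⟩ := (isCompact_closedBall (0 : E) R).exists_bound_of_continuousOn
    hK.continuous.continuousOn
  obtain ⟨D, hD⟩ := (isCompact_closedBall (0 : E) R).exists_bound_of_continuousOn
    (hK.continuous_fderiv one_ne_zero).continuousOn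
  refine ⟨max 0 (max C (D * max R 0)), le_max_left _ _, fun v hv hR => ?_⟩
  have hv0 : 0 < ‖v‖ := norm_pos_iff.2 hv
  have hm : v ∈ Metric.closedBall (0 : E) R := by simpa using hR
  constructor
  · simpa using Or.inr (Or.inl (hC v hm))
  · rw [zero_sub, Real.rpow_neg_one, ← div_eq_mul_inv, le_div_iff₀ hv0]
    have hD0 : 0 ≤ D := (norm_nonneg _).trans (hD v hm)
    calc ‖fderiv ℝ K v‖ * ‖v‖ ≤ D * max R 0 := by
          gcongr
          · exact hD v hm
          · exact hR.trans (le_max_left _ _)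
      _ ≤ _ := (le_max_right _ _).trans (le_max_right _ _)

lemma kernelOrder_one_of_linear (l : E →L[ℝ] ℂ) : KernelOrder 1 l := by
  refine ⟨fun v _ => l.differentiableAt, fun R => ⟨‖l‖, norm_nonneg _, fun v _ _ => ?_⟩⟩
  simp only [Real.rpow_one, sub_self, Real.rpow_zero, mul_one, ContinuousLinearMap.fderiv, le_refl,
    and_true]
  exact l.le_opNorm v

end KernelOrder

lemma kernelOrder_inv : KernelOrder (-1) (fun q : ℝ => ((q⁻¹ : ℝ) : ℂ)) := by
  have hd (q : ℝ) (hq : q ≠ 0) :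
      HasDerivAt (fun q : ℝ => ((q⁻¹ : ℝ) : ℂ)) ((-(q ^ 2)⁻¹ : ℝ) : ℂ) q :=
    (hasDerivAt_inv hq).ofReal_comp
  refine ⟨fun q hq => (hd q hq).differentiableAt, fun R => ⟨1, zero_le_one, fun q hq _ => ?_⟩⟩
  have hq0 : 0 < |q| := abs_pos.2 hq
  rw [(hd q hq).hasFDerivAt.fderiv]
  simp only [ContinuousLinearMap.norm_toSpanSingleton, Complex.norm_real, Real.norm_eq_abs]
  rw [show (-1 : ℝ) - 1 = ((-2 : ℤ) : ℝ) by norm_num, Real.rpow_intCast, Real.rpow_neg_one,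
    abs_neg, abs_inv, abs_inv, abs_pow, one_mul, one_mul]
  exact ⟨le_rfl, by rw [zpow_neg]; norm_cast⟩

/-- The logarithm is `O(|q|^(-1/4))`; the exponent is chosen to give `|v|^(-1/2)` after the
substitution `q = |v|²`. -/
lemma kernelOrder_log : KernelOrder (-1 / 4) (fun q : ℝ => (Real.log q : ℂ)) := by
  have hd (q : ℝ) (hq : q ≠ 0) :
      HasDerivAt (fun q : ℝ => (Real.log q : ℂ)) ((q⁻¹ : ℝ) : ℂ) q :=
    (Real.hasDerivAt_log hq).ofReal_comp
  refine ⟨fun q hq => (hd q hq).differentiableAt, fun R => ?_⟩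
  set R' := max R 0
  have hR' : 0 ≤ R' := le_max_right _ _
  obtain ⟨C, hC⟩ :=
    (isCompact_Icc (a := (0 : ℝ)) (b := R' ^ (1 / 4 : ℝ))).exists_bound_of_continuousOn
    (Real.continuous_mul_log.continuousOn)
  refine ⟨max (4 * C) (R' ^ (1 / 4 : ℝ)), le_max_of_le_right (by positivity), fun q hq hqR => ?_⟩
  have hq0 : 0 < |q| := abs_pos.2 hq
  have hqR' : |q| ≤ R' := hqR.trans (le_max_left _ _)
  have hle : |q| ^ (1 / 4 : ℝ) ≤ R' ^ (1 / 4 : ℝ) := by gcongr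
  have hone : |q| ^ (1 / 4 : ℝ) * |q| ^ (-1 / 4 : ℝ) = 1 := by
    rw [← Real.rpow_add hq0]; norm_num
  rw [(hd q hq).hasFDerivAt.fderiv]
  simp only [ContinuousLinearMap.norm_toSpanSingleton, Complex.norm_real, Real.norm_eq_abs]
  constructor
  · have h := hC (|q| ^ (1 / 4 : ℝ)) ⟨by positivity, hle⟩
    rw [Real.log_rpow hq0, Real.log_abs, Real.norm_eq_abs, abs_mul, abs_mul,
      abs_of_pos (by positivity : 0 < |q| ^ (1 / 4 : ℝ)),
      abs_of_pos (by norm_num : (0 : ℝ) < 1 / 4)] at h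
    have h2 : |Real.log q| * |q| ^ (1 / 4 : ℝ) ≤ 4 * C := by linarith
    calc |Real.log q| = |Real.log q| * |q| ^ (1 / 4 : ℝ) * |q| ^ (-1 / 4 : ℝ) := by
          rw [mul_assoc, hone, mul_one]
      _ ≤ _ := by gcongr; exact h2.trans (le_max_left _ _)
  · have : |q|⁻¹ = |q| ^ (1 / 4 : ℝ) * |q| ^ (-1 / 4 - 1 : ℝ) := by
      rw [← Real.rpow_add hq0, ← Real.rpow_neg_one]; norm_num
    rw [abs_inv, this]
    gcongr
    exact hle.trans (le_max_right _ _)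

lemma hasFDerivAt_radial {h : ℝ → ℂ} {v : Plane} (hh : DifferentiableAt ℝ h (‖v‖ ^ 2)) :
    HasFDerivAt (fun v : Plane => h (‖v‖ ^ 2))
      ((2 • (innerSL ℝ v)).smulRight (deriv h (‖v‖ ^ 2))) v := by
  have h1 : HasFDerivAt (fun v : Plane => ‖v‖ ^ 2) (2 • (innerSL ℝ v)) v :=
    (hasStrictFDerivAt_norm_sq v).hasFDerivAt
  exact (hh.hasDerivAt.hasFDerivAt.comp v h1).congr_fderiv (by ext; simp [mul_assoc])

/-- A radial kernel has twice the order of its profile as a function of `|v|²`. -/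
lemma KernelOrder.radial {d : ℝ} {h : ℝ → ℂ} (hh : KernelOrder d h) :
    KernelOrder (2 * d) (fun v : Plane => h (‖v‖ ^ 2)) := by
  have hq (v : Plane) (hv : v ≠ 0) : ‖v‖ ^ 2 ≠ 0 := by simpa using hv
  refine ⟨fun v hv => (hasFDerivAt_radial (hh.1 _ (hq v hv))).differentiableAt, fun R => ?_⟩
  obtain ⟨C, hC, hb⟩ := hh.2 (R ^ 2)
  refine ⟨2 * C, by positivity, fun v hv hR => ?_⟩
  have hv0 : 0 < ‖v‖ := norm_pos_iff.2 hv
  obtain ⟨h1, h2⟩ := hb (‖v‖ ^ 2) (hq v hv) (by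
    rw [Real.norm_eq_abs, abs_of_nonneg (by positivity)]; gcongr)
  have e (a : ℝ) : ‖(‖v‖ ^ 2)‖ ^ a = ‖v‖ ^ (2 * a) := by
    rw [Real.norm_eq_abs, abs_of_nonneg (by positivity), Real.rpow_mul hv0.le]
    norm_cast
  rw [e] at h1 h2
  constructor
  · have : 0 ≤ C * ‖v‖ ^ (2 * d) := by positivity
    linarith
  · rw [(hasFDerivAt_radial (hh.1 _ (hq v hv))).fderiv, ContinuousLinearMap.norm_smulRight_apply]
    have e2 : ‖(2 • (innerSL ℝ v) : Plane →L[ℝ] ℝ)‖ ≤ 2 * ‖v‖ := by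
      refine (norm_nsmul_le).trans ?_
      rw [innerSL_apply_norm]; norm_num
    have e3 : ‖deriv h (‖v‖ ^ 2)‖ ≤ C * ‖v‖ ^ (2 * (d - 1)) := by
      rwa [← norm_deriv_eq_norm_fderiv] at h2
    calc _ ≤ (2 * ‖v‖) * (C * ‖v‖ ^ (2 * (d - 1))) := by gcongr
      _ = 2 * C * (‖v‖ ^ (1 : ℝ) * ‖v‖ ^ (2 * (d - 1))) := by rw [Real.rpow_one]; ring
      _ = _ := by rw [← Real.rpow_add hv0]; congr 2; ring

/-! ### The fundamental solution as a radial kernel -/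

/-- Functions of the form `a(q) + log q · b(q)`. -/
noncomputable def logFun (a b : ℝ → ℂ) (q : ℝ) : ℂ := a q + (Real.log q : ℂ) * b q

section logFun

variable {a b : ℝ → ℂ}

lemma contDiffOn_logFun (ha : ContDiff ℝ ∞ a) (hb : ContDiff ℝ ∞ b) :
    ContDiffOn ℝ ∞ (logFun a b) {0}ᶜ :=
  ha.contDiffOn.add
    ((Complex.ofRealCLM.contDiff.comp_contDiffOn Real.contDiffOn_log).mul hb.contDiffOn)

lemma hasDerivAt_logFun (ha : ContDiff ℝ ∞ a) (hb : ContDiff ℝ ∞ b) {q : ℝ} (hq : q ≠ 0) :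
    HasDerivAt (logFun a b) (logFun (deriv a) (deriv b) q + ((q⁻¹ : ℝ) : ℂ) * b q) q := by
  have h1 := ((ha.differentiable (by simp)) q).hasDerivAt
  have h2 := ((hb.differentiable (by simp)) q).hasDerivAt
  have h3 : HasDerivAt (fun q : ℝ => (Real.log q : ℂ)) ((q⁻¹ : ℝ) : ℂ) q :=
    (Real.hasDerivAt_log hq).ofReal_comp
  refine (h1.add (h3.mul h2)).congr_deriv ?_
  simp only [logFun]
  ring

lemma contDiff_deriv_infty {f : ℝ → ℂ} (hf : ContDiff ℝ ∞ f) : ContDiff ℝ ∞ (deriv f) :=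
  (contDiff_infty_iff_deriv.1 hf).2

lemma kernelOrder_logFun (ha : ContDiff ℝ ∞ a) (hb : ContDiff ℝ ∞ b) :
    KernelOrder (-1 / 4) (logFun a b) := by
  have h0 := (kernelOrder_of_contDiff (ha.of_le (by simp))).mono (d := -1 / 4) (by norm_num)
  have h1 := kernelOrder_log.mul (kernelOrder_of_contDiff (hb.of_le (by simp)))
  rw [add_zero] at h1
  exact h0.add h1

/-- Differentiation lowers the order of `a + b log` to `-1`. -/
lemma kernelOrder_deriv_logFun (ha : ContDiff ℝ ∞ a) (hb : ContDiff ℝ ∞ b) :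
    KernelOrder (-1) (deriv (logFun a b)) := by
  have h0 := (kernelOrder_logFun (contDiff_deriv_infty ha) (contDiff_deriv_infty hb)).mono
    (d := -1) (by norm_num)
  have h1 := kernelOrder_inv.mul (kernelOrder_of_contDiff (hb.of_le (by simp)))
  rw [add_zero] at h1
  exact (h0.add h1).congr fun q hq => (hasDerivAt_logFun ha hb hq).deriv

end logFun

/-- The part of the profile of `γ_k` that multiplies the logarithm, as a function of `|v|²`. -/
noncomputable def logPart (k q : ℝ) : ℂ := ((-1 / (4 * Real.pi) * besselB (k ^ 2 / 4 * q) : ℝ) : ℂ)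

/-- The constant with which `J₀` enters the regular part of the profile of `γ_k`. -/
noncomputable def regConst (k : ℝ) : ℂ :=
  Complex.I / 4 * (1 + Complex.I * ((2 / Real.pi *
    (Real.log (k / 2) + Real.eulerMascheroniConstant) : ℝ) : ℂ))

/-- The regular part of the profile of `γ_k`, as a function of `|v|²`. -/
noncomputable def regPart (k q : ℝ) : ℂ :=
  regConst k * (besselB (k ^ 2 / 4 * q) : ℂ)
    + ((1 / (2 * Real.pi) * besselC (k ^ 2 / 4 * q) : ℝ) : ℂ)

lemma contDiff_logPart (k : ℝ) : ContDiff ℝ ∞ (logPart k) := by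
  have h1 : ContDiff ℝ ∞ fun q : ℝ => -1 / (4 * Real.pi) * besselB (k ^ 2 / 4 * q) :=
    contDiff_const.mul (contDiff_besselB.comp (contDiff_const.mul contDiff_id))
  exact Complex.ofRealCLM.contDiff.comp h1

lemma contDiff_regPart (k : ℝ) : ContDiff ℝ ∞ (regPart k) := by
  have h1 : ContDiff ℝ ∞ fun q : ℝ => besselB (k ^ 2 / 4 * q) :=
    contDiff_besselB.comp (contDiff_const.mul contDiff_id)
  have h2 : ContDiff ℝ ∞ fun q : ℝ => 1 / (2 * Real.pi) * besselC (k ^ 2 / 4 * q) :=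
    contDiff_const.mul (contDiff_besselC.comp (contDiff_const.mul contDiff_id))
  exact (contDiff_const.mul (Complex.ofRealCLM.contDiff.comp h1)).add
    (Complex.ofRealCLM.contDiff.comp h2)

/-- The fundamental solution as a convolution kernel. -/
noncomputable def helmholtzKernel (k : ℝ) (v : Plane) : ℂ := helmholtzFS k v 0

lemma helmholtzFS_eq (k : ℝ) (x y : Plane) : helmholtzFS k x y = helmholtzKernel k (x - y) := by
  simp [helmholtzKernel, helmholtzFS]

lemma helmholtzKernel_eq {k : ℝ} (hk : 0 < k) {v : Plane} (hv : v ≠ 0) :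
    helmholtzKernel k v = logFun (regPart k) (logPart k) (‖v‖ ^ 2) := by
  have hv0 : 0 < ‖v‖ := norm_pos_iff.2 hv
  have hlog : Real.log (k * ‖v‖ / 2) = Real.log (k / 2) + Real.log (‖v‖ ^ 2) / 2 := by
    rw [show k * ‖v‖ / 2 = k / 2 * ‖v‖ by ring, Real.log_mul (by positivity) hv0.ne', Real.log_pow]
    push_cast; ring
  have hpow (n : ℕ) : (k * ‖v‖ / 2) ^ (2 * n) = (k ^ 2 / 4 * ‖v‖ ^ 2) ^ n := by
    rw [pow_mul]; congr 1; ring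
  have hB : besselJ0 (k * ‖v‖) = besselB (k ^ 2 / 4 * ‖v‖ ^ 2) := by
    simp only [besselJ0, besselB, powerSum, besselCoeff, hpow]
  have hC : (∑' n : ℕ, (-1 : ℝ) ^ n * (harmonic n : ℝ) / ((n ! : ℝ) ^ 2) * (k * ‖v‖ / 2) ^ (2 * n))
      = besselC (k ^ 2 / 4 * ‖v‖ ^ 2) := by
    simp only [besselC, powerSum, harmonicCoeff, hpow]
  have hpi : (Real.pi : ℂ) ≠ 0 := by exact_mod_cast Real.pi_ne_zero
  simp only [helmholtzKernel, helmholtzFS, sub_zero, hankel0, besselY0, hC, hB, hlog, logFun,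
    regPart, logPart, regConst]
  generalize besselB (k ^ 2 / 4 * ‖v‖ ^ 2) = b
  generalize besselC (k ^ 2 / 4 * ‖v‖ ^ 2) = c
  push_cast
  field_simp
  linear_combination 2 * ((Real.log (‖v‖ ^ 2) : ℂ) * b - 2 * c) * Complex.I_sq

/-- The radial form of the Helmholtz equation: `4 (q f'' + f') = -k² f` for the profile `f`
of `γ_k` as a function of `q = |v|²`. -/
lemma profile_ode (k : ℝ) {q : ℝ} (hq : q ≠ 0) :
    4 * (q * deriv (deriv (logFun (regPart k) (logPart k))) q
      + deriv (logFun (regPart k) (logPart k)) q)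
      = -(k : ℂ) ^ 2 * logFun (regPart k) (logPart k) q := by
  set κ : ℝ := k ^ 2 / 4 with hκ
  have dC (f : ℝ → ℝ) (hf : ContDiff ℝ ∞ f) (q : ℝ) :
      HasDerivAt (fun q : ℝ => (f (κ * q) : ℂ)) ((κ * deriv f (κ * q) : ℝ) : ℂ) q := by
    have h1 := ((hf.differentiable (by simp)) (κ * q)).hasDerivAt
    have h2 := (h1.comp q ((hasDerivAt_id q).const_mul κ)).ofReal_comp
    refine h2.congr_deriv ?_
    push_cast; ring
  have hdB : ContDiff ℝ ∞ (deriv besselB) := (contDiff_infty_iff_deriv.1 contDiff_besselB).2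
  have hdC : ContDiff ℝ ∞ (deriv besselC) := (contDiff_infty_iff_deriv.1 contDiff_besselC).2
  set c : ℂ := ((-1 / (4 * Real.pi) : ℝ) : ℂ) with hc
  have hc2 : ((1 / (2 * Real.pi) : ℝ) : ℂ) = -2 * c := by
    rw [hc]; push_cast
    have hpi : (Real.pi : ℂ) ≠ 0 := by exact_mod_cast Real.pi_ne_zero
    field_simp; norm_num
  have hf : logFun (regPart k) (logPart k) = fun q => regConst k * (besselB (κ * q) : ℂ)
      + (-2 * c) * (besselC (κ * q) : ℂ)
      + c * ((Real.log q : ℂ) * (besselB (κ * q) : ℂ)) := by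
    funext q
    simp only [logFun, regPart, logPart, Complex.ofReal_mul, hc2, ← hc, ← hκ]
    ring
  have hl (q : ℝ) (hq : q ≠ 0) : HasDerivAt (fun q : ℝ => (Real.log q : ℂ)) ((q⁻¹ : ℝ) : ℂ) q :=
    (Real.hasDerivAt_log hq).ofReal_comp
  have hi (q : ℝ) (hq : q ≠ 0) :
      HasDerivAt (fun q : ℝ => ((q⁻¹ : ℝ) : ℂ)) ((-(q ^ 2)⁻¹ : ℝ) : ℂ) q :=
    (hasDerivAt_inv hq).ofReal_comp
  set f1 : ℝ → ℂ := fun q => regConst k * ((κ * deriv besselB (κ * q) : ℝ) : ℂ)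
    + -2 * c * ((κ * deriv besselC (κ * q) : ℝ) : ℂ)
    + c * (((q⁻¹ : ℝ) : ℂ) * (besselB (κ * q) : ℂ)
      + (Real.log q : ℂ) * ((κ * deriv besselB (κ * q) : ℝ) : ℂ)) with hf1
  have d1 (q : ℝ) (hq : q ≠ 0) : HasDerivAt (logFun (regPart k) (logPart k)) (f1 q) q := by
    rw [hf]
    exact (((dC _ contDiff_besselB q).const_mul (regConst k)).add
      ((dC _ contDiff_besselC q).const_mul (-2 * c))).add
      (((hl q hq).mul (dC _ contDiff_besselB q)).const_mul c)
  have dB' (q : ℝ) : HasDerivAt (fun q : ℝ => ((κ * deriv besselB (κ * q) : ℝ) : ℂ))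
      (κ * ((κ * deriv (deriv besselB) (κ * q) : ℝ) : ℂ)) q := by
    simpa using (dC _ hdB q).const_mul (κ : ℂ)
  have dC' (q : ℝ) : HasDerivAt (fun q : ℝ => ((κ * deriv besselC (κ * q) : ℝ) : ℂ))
      (κ * ((κ * deriv (deriv besselC) (κ * q) : ℝ) : ℂ)) q := by
    simpa using (dC _ hdC q).const_mul (κ : ℂ)
  have d2 : HasDerivAt f1 _ q := (((dB' q).const_mul (regConst k)).add
    ((dC' q).const_mul (-2 * c))).add
    ((((hi q hq).mul (dC _ contDiff_besselB q)).add ((hl q hq).mul (dB' q))).const_mul c)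
  have e1 : deriv (logFun (regPart k) (logPart k)) q = f1 q := (d1 q hq).deriv
  have e2 : deriv (logFun (regPart k) (logPart k)) =ᶠ[𝓝 q] f1 := by
    filter_upwards [isOpen_ne.mem_nhds hq] with p hp using (d1 p hp).deriv
  rw [e1, e2.deriv_eq, d2.deriv, hf, hf1]
  have o1 : ((κ * q : ℝ) : ℂ) * ((deriv (deriv besselB) (κ * q) : ℝ) : ℂ)
      + ((deriv besselB (κ * q) : ℝ) : ℂ)
      + (besselB (κ * q) : ℂ) = 0 := by exact_mod_cast besselB_ode (κ * q)
  have o2 : ((κ * q : ℝ) : ℂ) * ((deriv (deriv besselC) (κ * q) : ℝ) : ℂ)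
      + ((deriv besselC (κ * q) : ℝ) : ℂ)
      + (besselC (κ * q) : ℂ) = ((deriv besselB (κ * q) : ℝ) : ℂ) := by
    exact_mod_cast besselC_ode (κ * q)
  have hk : (k : ℂ) ^ 2 = 4 * (κ : ℂ) := by rw [hκ]; push_cast; ring
  have hq' : (q : ℂ) ≠ 0 := by exact_mod_cast hq
  rw [hk]
  push_cast at o1 o2 ⊢
  field_simp
  linear_combination ((q : ℂ) * κ * (regConst k + c * Real.log q)) * o1 - (2 * c * q * κ) * o2

/-! ### Partial derivatives of kernels -/

/-- Kernels that are smooth off the origin. -/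
def SmoothOff (K : Plane → ℂ) : Prop := ContDiffOn ℝ ∞ K {0}ᶜ

section SmoothOff

variable {K L : Plane → ℂ} {v : Plane}

lemma eventuallyEq_of_eqOff (h : ∀ v ≠ 0, K v = L v) (hv : v ≠ 0) : K =ᶠ[𝓝 v] L := by
  filter_upwards [isOpen_ne.mem_nhds hv] with w hw using h w hw

lemma pd_congr_off (h : ∀ v ≠ 0, K v = L v) (hv : v ≠ 0) (i : Fin 2) : pd i K v = pd i L v := by
  rw [pd, pd, (eventuallyEq_of_eqOff h hv).fderiv_eq]

lemma SmoothOff.congr (hK : SmoothOff K) (h : ∀ v ≠ 0, L v = K v) : SmoothOff L :=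
  ContDiffOn.congr hK h

lemma SmoothOff.contDiffAt (hK : SmoothOff K) (hv : v ≠ 0) : ContDiffAt ℝ ∞ K v :=
  ContDiffOn.contDiffAt hK (isOpen_ne.mem_nhds hv)

lemma SmoothOff.differentiableAt (hK : SmoothOff K) (hv : v ≠ 0) : DifferentiableAt ℝ K v :=
  (hK.contDiffAt hv).differentiableAt (by simp)

lemma SmoothOff.contDiffOn_fderiv (hK : SmoothOff K) : ContDiffOn ℝ ∞ (fderiv ℝ K) {0}ᶜ :=
  ContDiffOn.fderiv_of_isOpen hK isOpen_ne (by simp)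

lemma SmoothOff.pd (hK : SmoothOff K) (i : Fin 2) : SmoothOff (pd i K) :=
  hK.contDiffOn_fderiv.clm_apply contDiffOn_const

lemma SmoothOff.add (hK : SmoothOff K) (hL : SmoothOff L) : SmoothOff fun v => K v + L v :=
  ContDiffOn.add hK hL

lemma SmoothOff.sub (hK : SmoothOff K) (hL : SmoothOff L) : SmoothOff fun v => K v - L v :=
  ContDiffOn.sub hK hL

lemma SmoothOff.const_mul (hK : SmoothOff K) (c : ℂ) : SmoothOff fun v => c * K v :=
  contDiffOn_const.mul hK

lemma pd_add {i : Fin 2} (hK : DifferentiableAt ℝ K v) (hL : DifferentiableAt ℝ L v) :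
    pd i (fun v => K v + L v) v = pd i K v + pd i L v := by
  simp [pd, fderiv_fun_add hK hL]

lemma pd_sub {i : Fin 2} (hK : DifferentiableAt ℝ K v) (hL : DifferentiableAt ℝ L v) :
    pd i (fun v => K v - L v) v = pd i K v - pd i L v := by
  simp [pd, fderiv_fun_sub hK hL]

lemma pd_const_mul {i : Fin 2} (c : ℂ) (hK : DifferentiableAt ℝ K v) :
    pd i (fun v => c * K v) v = c * pd i K v := by
  simp [pd, fderiv_const_mul hK]

lemma plane_eq_sum (w : Plane) :
    w = w 0 • EuclideanSpace.single (0 : Fin 2) (1 : ℝ) + w 1 • EuclideanSpace.single 1 1 := by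
  ext i
  fin_cases i <;> simp

lemma fderiv_apply_eq_pd (K : Plane → ℂ) (v w : Plane) :
    fderiv ℝ K v w = (w 0 : ℂ) * pd 0 K v + (w 1 : ℂ) * pd 1 K v := by
  conv_lhs => rw [plane_eq_sum w]
  simp [pd]

lemma SmoothOff.pd_comm (hK : SmoothOff K) (hv : v ≠ 0) (i j : Fin 2) :
    ElasticArc.pd i (ElasticArc.pd j K) v = ElasticArc.pd j (ElasticArc.pd i K) v := by
  have hd : DifferentiableAt ℝ (fderiv ℝ K) v :=
    (hK.contDiffOn_fderiv.contDiffAt (isOpen_ne.mem_nhds hv)).differentiableAt (by simp)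
  have hs : IsSymmSndFDerivAt ℝ K v := (hK.contDiffAt hv).isSymmSndFDerivAt
    (by rw [minSmoothness_of_isRCLikeNormedField]; exact WithTop.coe_le_coe.2 le_top)
  have key (a b : Fin 2) : ElasticArc.pd a (ElasticArc.pd b K) v
      = fderiv ℝ (fderiv ℝ K) v (EuclideanSpace.single a 1) (EuclideanSpace.single b 1) := by
    have : ElasticArc.pd b K = fun v => fderiv ℝ K v (EuclideanSpace.single b 1) := rfl
    rw [ElasticArc.pd, this, fderiv_clm_apply hd (differentiableAt_const _)]
    simp
  rw [key, key]
  exact hs _ _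

lemma pd_comp_sub (K : Plane → ℂ) (i : Fin 2) (x y : Plane) :
    pd i (fun z => K (z - y)) x = pd i K (x - y) := by
  rw [pd, pd, fderiv_comp_sub]

lemma pd_comp_const_sub (K : Plane → ℂ) (i : Fin 2) (x y : Plane) :
    pd i (fun z => K (x - z)) y = -pd i K (x - y) := by
  have h : (fun z => K (x - z)) = fun z => (fun w => K (-w)) (z - x) := by
    funext z; simp
  have h2 := fderiv_comp_smul (-1 : ℝ) (f := K) (x := y - x)
  simp only [neg_smul, one_smul, neg_sub] at h2
  rw [pd, pd, h, (fderiv_comp_sub (f := fun w => K (-w)) x : _), h2]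
  simp

end SmoothOff

/-! ### The Helmholtz kernels and the fundamental tensor -/

lemma ElasticMedium.lam_add_two_mu_pos (m : ElasticMedium) : 0 < m.lam + 2 * m.mu := by
  linarith [m.mu_pos, m.lam_add_mu_pos]

lemma ElasticMedium.kS_pos (m : ElasticMedium) : 0 < m.kS :=
  div_pos m.omega_pos (Real.sqrt_pos.2 (div_pos m.mu_pos m.rho_pos))

lemma ElasticMedium.kP_pos (m : ElasticMedium) : 0 < m.kP :=
  div_pos m.omega_pos (Real.sqrt_pos.2 (div_pos m.lam_add_two_mu_pos m.rho_pos))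

lemma ElasticMedium.rhoOmegaSq_pos (m : ElasticMedium) : 0 < m.rhoOmegaSq :=
  mul_pos m.rho_pos (pow_pos m.omega_pos 2)

lemma ElasticMedium.mu_mul_kS_sq (m : ElasticMedium) : m.mu * m.kS ^ 2 = m.rhoOmegaSq := by
  have h1 := m.mu_pos
  have h2 := m.rho_pos
  rw [kS, rhoOmegaSq, div_pow, Real.sq_sqrt (by positivity)]
  field_simp

lemma ElasticMedium.mul_kP_sq (m : ElasticMedium) :
    (m.lam + 2 * m.mu) * m.kP ^ 2 = m.rhoOmegaSq := by
  have h1 := m.lam_add_two_mu_pos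
  have h2 := m.rho_pos
  rw [kP, rhoOmegaSq, div_pow, Real.sq_sqrt (by positivity)]
  field_simp

lemma contDiff_normSq : ContDiff ℝ ∞ fun v : Plane => ‖v‖ ^ 2 := contDiff_norm_sq ℝ

lemma smoothOff_radial {h : ℝ → ℂ} (hh : ContDiffOn ℝ ∞ h {0}ᶜ) :
    SmoothOff fun v => h (‖v‖ ^ 2) :=
  hh.comp contDiff_normSq.contDiffOn fun v hv => by simpa using hv

lemma normSq_ne_zero {v : Plane} (hv : v ≠ 0) : ‖v‖ ^ 2 ≠ 0 := by simpa using hv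

lemma pd_radial {h : ℝ → ℂ} {v : Plane} (hh : DifferentiableAt ℝ h (‖v‖ ^ 2)) (i : Fin 2) :
    pd i (fun v : Plane => h (‖v‖ ^ 2)) v = 2 * (v i : ℂ) * deriv h (‖v‖ ^ 2) := by
  rw [pd, (hasFDerivAt_radial hh).fderiv]
  simp [mul_assoc, EuclideanSpace.inner_single_right]

lemma pd_coord (i j : Fin 2) (v : Plane) :
    pd i (fun v : Plane => (v j : ℂ)) v = if i = j then 1 else 0 := by
  have h : HasFDerivAt (fun v : Plane => (v j : ℂ))
      (Complex.ofRealCLM ∘L (EuclideanSpace.proj j : Plane →L[ℝ] ℝ)) v :=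
    (Complex.ofRealCLM ∘L (EuclideanSpace.proj j : Plane →L[ℝ] ℝ)).hasFDerivAt
  rw [pd, h.fderiv]
  fin_cases i <;> fin_cases j <;> simp

lemma contDiff_coord (j : Fin 2) : ContDiff ℝ ∞ fun v : Plane => (v j : ℂ) :=
  (Complex.ofRealCLM ∘L (EuclideanSpace.proj j : Plane →L[ℝ] ℝ)).contDiff

lemma kernelOrder_coord (j : Fin 2) : KernelOrder 1 fun v : Plane => (v j : ℂ) :=
  kernelOrder_one_of_linear (Complex.ofRealCLM ∘L (EuclideanSpace.proj j : Plane →L[ℝ] ℝ))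

lemma pd_mul {i : Fin 2} {K L : Plane → ℂ} {v : Plane} (hK : DifferentiableAt ℝ K v)
    (hL : DifferentiableAt ℝ L v) :
    pd i (fun v => K v * L v) v = pd i K v * L v + K v * pd i L v := by
  simp [pd, fderiv_fun_mul hK hL]; ring

/-- The second derivatives of a radial kernel, in terms of the profile. -/
lemma pd_pd_radial {h : ℝ → ℂ} (hh : ContDiffOn ℝ ∞ h {0}ᶜ) {v : Plane} (hv : v ≠ 0)
    (i j : Fin 2) :
    pd i (pd j fun v : Plane => h (‖v‖ ^ 2)) v
      = 2 * (if i = j then 1 else 0) * deriv h (‖v‖ ^ 2)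
        + 4 * ((v i : ℂ) * (v j : ℂ)) * deriv (deriv h) (‖v‖ ^ 2) := by
  have hd (q : ℝ) (hq : q ≠ 0) : DifferentiableAt ℝ h q :=
    (hh.contDiffAt (isOpen_ne.mem_nhds hq)).differentiableAt (by simp)
  have hh' : ContDiffOn ℝ ∞ (deriv h) {0}ᶜ := hh.deriv_of_isOpen isOpen_ne (by simp)
  have hd' : DifferentiableAt ℝ (deriv h) (‖v‖ ^ 2) :=
    (hh'.contDiffAt (isOpen_ne.mem_nhds (normSq_ne_zero hv))).differentiableAt (by simp)
  rw [pd_congr_off (fun v hv => pd_radial (hd _ (normSq_ne_zero hv)) j) hv,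
    pd_mul (((contDiff_coord j).differentiable (by simp) v).const_mul 2)
      ((smoothOff_radial hh').differentiableAt hv),
    pd_const_mul _ ((contDiff_coord j).differentiable (by simp) v), pd_coord, pd_radial hd']
  ring

lemma contDiffOn_profile (k : ℝ) : ContDiffOn ℝ ∞ (logFun (regPart k) (logPart k)) {0}ᶜ :=
  contDiffOn_logFun (contDiff_regPart k) (contDiff_logPart k)

lemma smoothOff_helmholtzKernel {k : ℝ} (hk : 0 < k) : SmoothOff (helmholtzKernel k) :=
  (smoothOff_radial (contDiffOn_profile k)).congr fun _ hv => helmholtzKernel_eq hk hv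

lemma kernelOrder_helmholtzKernel {k : ℝ} (hk : 0 < k) :
    KernelOrder (-1 / 2) (helmholtzKernel k) := by
  have := (kernelOrder_logFun (contDiff_regPart k) (contDiff_logPart k)).radial
  rw [show (2 : ℝ) * (-1 / 4) = -1 / 2 by norm_num] at this
  exact this.congr fun _ hv => helmholtzKernel_eq hk hv

/-- The Helmholtz equation off the origin. -/
lemma laplacian_helmholtzKernel {k : ℝ} (hk : 0 < k) {v : Plane} (hv : v ≠ 0) :
    pd 0 (pd 0 (helmholtzKernel k)) v + pd 1 (pd 1 (helmholtzKernel k)) v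
      = -(k : ℂ) ^ 2 * helmholtzKernel k v := by
  have h (i : Fin 2) : pd i (pd i (helmholtzKernel k)) v = _ :=
    (pd_congr_off (fun w hw => pd_congr_off (fun z hz => helmholtzKernel_eq hk hz) hw i) hv i).trans
      (pd_pd_radial (contDiffOn_profile k) hv i i)
  have hq : ((‖v‖ ^ 2 : ℝ) : ℂ) = (v 0 : ℂ) * v 0 + (v 1 : ℂ) * v 1 := by
    rw [EuclideanSpace.norm_sq_eq]
    simp [Fin.sum_univ_two]; ring
  have o := profile_ode k (normSq_ne_zero hv)
  rw [h, h, helmholtzKernel_eq hk hv, ← o, hq]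
  simp only [if_true]
  ring

/-- `γ_{k_s} - γ_{k_p}` as a convolution kernel. -/
noncomputable def diffKernel (m : ElasticMedium) (v : Plane) : ℂ :=
  helmholtzKernel m.kS v - helmholtzKernel m.kP v

lemma smoothOff_diffKernel (m : ElasticMedium) : SmoothOff (diffKernel m) :=
  (smoothOff_helmholtzKernel m.kS_pos).sub (smoothOff_helmholtzKernel m.kP_pos)

/-- The profile of `diffKernel` is `a + log q · q b₁` with smooth `a` and `b₁`: the logarithms of
the two fundamental solutions cancel to first order. -/
lemma diffKernel_profile (m : ElasticMedium) : ∃ a b b₁ : ℝ → ℂ, ContDiff ℝ ∞ a ∧ ContDiff ℝ ∞ b ∧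
    ContDiff ℝ ∞ b₁ ∧ (∀ q, b q = q * b₁ q) ∧
    ∀ v ≠ 0, diffKernel m v = logFun a b (‖v‖ ^ 2) := by
  refine ⟨fun q => regPart m.kS q - regPart m.kP q, fun q => logPart m.kS q - logPart m.kP q,
    fun q => ((-1 / (4 * Real.pi) * (m.kS ^ 2 / 4 * besselB1 (m.kS ^ 2 / 4 * q)
      - m.kP ^ 2 / 4 * besselB1 (m.kP ^ 2 / 4 * q)) : ℝ) : ℂ),
    (contDiff_regPart _).sub (contDiff_regPart _), (contDiff_logPart _).sub (contDiff_logPart _),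
    ?_, fun q => ?_, fun v hv => ?_⟩
  · have h (κ : ℝ) : ContDiff ℝ ∞ fun q : ℝ => κ * besselB1 (κ * q) :=
      contDiff_const.mul (contDiff_besselB1.comp (contDiff_const.mul contDiff_id))
    exact Complex.ofRealCLM.contDiff.comp (contDiff_const.mul ((h _).sub (h _)))
  · simp only [logPart, besselB_eq]
    push_cast; ring
  · rw [diffKernel, helmholtzKernel_eq m.kS_pos hv, helmholtzKernel_eq m.kP_pos hv]
    simp only [logFun]; ring

/-- The gradient of `diffKernel` is `2 v h(|v|²)` with a profile `h` which is again of the form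
`a + b log`. -/
lemma exists_profile_pd_diffKernel (m : ElasticMedium) : ∃ a b : ℝ → ℂ, ContDiff ℝ ∞ a ∧
    ContDiff ℝ ∞ b ∧ ∀ i, ∀ v ≠ 0,
      pd i (diffKernel m) v = 2 * ((v i : ℂ) * logFun a b (‖v‖ ^ 2)) := by
  obtain ⟨a, b, b₁, ha, hb, hb₁, hbb, hG⟩ := diffKernel_profile m
  refine ⟨fun q => deriv a q + b₁ q, deriv b, (contDiff_deriv_infty ha).add hb₁,
    contDiff_deriv_infty hb, fun i v hv => ?_⟩
  have hq := normSq_ne_zero hv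
  have hd := hasDerivAt_logFun ha hb hq
  rw [pd_congr_off hG hv, pd_radial hd.differentiableAt, hd.deriv, hbb]
  have hqc : ((‖v‖ ^ 2 : ℝ) : ℂ) ≠ 0 := by exact_mod_cast hq
  simp only [logFun, Complex.ofReal_inv]
  rw [inv_mul_cancel_left₀ hqc]
  ring

lemma kernelOrder_pd_diffKernel (m : ElasticMedium) (i : Fin 2) :
    KernelOrder (-1 / 2) (pd i (diffKernel m)) := by
  obtain ⟨a, b, ha, hb, h⟩ := exists_profile_pd_diffKernel m
  have h1 := (((kernelOrder_coord i).mul (kernelOrder_logFun ha hb).radial).mono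
    (d := -1 / 2) (by norm_num)).const_mul 2
  exact h1.congr (h i)

lemma kernelOrder_pd_pd_diffKernel (m : ElasticMedium) (i j : Fin 2) :
    KernelOrder (-1 / 2) (pd i (pd j (diffKernel m))) := by
  obtain ⟨a, b, ha, hb, h⟩ := exists_profile_pd_diffKernel m
  have h1 := ((kernelOrder_logFun ha hb).radial.mono (d := -1 / 2) (by norm_num)).const_mul
    (2 * if i = j then 1 else 0)
  have h2 := ((((kernelOrder_coord i).mul (kernelOrder_coord j)).mul
    (kernelOrder_deriv_logFun ha hb).radial).mono (d := -1 / 2) (by norm_num)).const_mul 4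
  refine (h1.add h2).congr fun v hv => ?_
  have hs := smoothOff_radial (contDiffOn_logFun ha hb)
  have hd : DifferentiableAt ℝ (logFun a b) (‖v‖ ^ 2) :=
    (hasDerivAt_logFun ha hb (normSq_ne_zero hv)).differentiableAt
  have hcd := (contDiff_coord j).differentiable (by simp) v
  rw [pd_congr_off (h j) hv, pd_const_mul _ (hcd.fun_mul (hs.differentiableAt hv)),
    pd_mul hcd (hs.differentiableAt hv), pd_coord, pd_radial hd]
  ring

/-- The entries of the fundamental tensor as convolution kernels. -/
noncomputable def tensorKernel (m : ElasticMedium) (i j : Fin 2) (v : Plane) : ℂ :=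
  ((1 / m.mu : ℝ) : ℂ) * (if i = j then 1 else 0) * helmholtzKernel m.kS v
    + ((1 / m.rhoOmegaSq : ℝ) : ℂ) * pd i (pd j (diffKernel m)) v

lemma gammaS_eq (m : ElasticMedium) (x y : Plane) :
    gammaS m x y = helmholtzKernel m.kS (x - y) := helmholtzFS_eq _ _ _

lemma gammaP_eq (m : ElasticMedium) (x y : Plane) :
    gammaP m x y = helmholtzKernel m.kP (x - y) := helmholtzFS_eq _ _ _

lemma gammaDiff_eq (m : ElasticMedium) (x y : Plane) :
    gammaDiff m x y = diffKernel m (x - y) := by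
  rw [gammaDiff, gammaS_eq, gammaP_eq, diffKernel]

lemma gradXDiff_eq (m : ElasticMedium) (x y : Plane) (i : Fin 2) :
    gradXDiff m x y i = pd i (diffKernel m) (x - y) := by
  simp only [gradXDiff, gammaDiff_eq, pd_comp_sub]

lemma gradYDiff_eq (m : ElasticMedium) (x y : Plane) (i : Fin 2) :
    gradYDiff m x y i = -pd i (diffKernel m) (x - y) := by
  simp only [gradYDiff, gammaDiff_eq, pd_comp_const_sub]

lemma tensorE_eq (m : ElasticMedium) (x y : Plane) (i j : Fin 2) :
    tensorE m x y i j = tensorKernel m i j (x - y) := by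
  have h (z : Plane) : pd j (fun z' => gammaDiff m z' y) z = pd j (diffKernel m) (z - y) := by
    simp only [gammaDiff_eq, pd_comp_sub]
  simp only [tensorE, tensorKernel, Matrix.add_apply, Matrix.smul_apply, Matrix.of_apply, h,
    pd_comp_sub, gammaS_eq, Matrix.one_apply, smul_eq_mul]
  ring

lemma smoothOff_tensorKernel (m : ElasticMedium) (i j : Fin 2) : SmoothOff (tensorKernel m i j) :=
  ((smoothOff_helmholtzKernel m.kS_pos).const_mul _).add
    ((((smoothOff_diffKernel m).pd j).pd i).const_mul _)

lemma kernelOrder_tensorKernel (m : ElasticMedium) (i j : Fin 2) :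
    KernelOrder (-1 / 2) (tensorKernel m i j) :=
  ((kernelOrder_helmholtzKernel m.kS_pos).const_mul _).add
    ((kernelOrder_pd_pd_diffKernel m i j).const_mul _)

/-! ### Layer potentials off the arc -/

section Arc

variable (Γ : OpenArc)

lemma OpenArc.continuousOn_param : ContinuousOn Γ.param (Icc (-1) 1) := Γ.smooth.continuousOn

lemma OpenArc.contDiffOn_velocity : ContDiffOn ℝ ∞ Γ.velocity (Icc (-1) 1) :=
  Γ.smooth.derivWithin (uniqueDiffOn_Icc (by norm_num)) (by simp)

lemma OpenArc.continuousOn_velocity : ContinuousOn Γ.velocity (Icc (-1) 1) :=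
  Γ.contDiffOn_velocity.continuousOn

lemma OpenArc.hasDerivAt_param {t : ℝ} (ht : t ∈ Ioo (-1 : ℝ) 1) :
    HasDerivAt Γ.param (Γ.velocity t) t :=
  ((Γ.smooth.differentiableOn (by simp)) t (Ioo_subset_Icc_self ht)).hasDerivWithinAt.hasDerivAt
    (Icc_mem_nhds ht.1 ht.2)

lemma OpenArc.speed_pos {t : ℝ} (ht : t ∈ Icc (-1 : ℝ) 1) : 0 < Γ.speed t :=
  norm_pos_iff.2 (Γ.regular t ht)

lemma OpenArc.isCompact_carrier : IsCompact Γ.carrier :=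
  isCompact_Icc.image_of_continuousOn Γ.continuousOn_param

/-- The point `z` has positive distance from the part of the arc that carries the density `θ`. -/
def OpenArc.AwayFrom (θ : ℝ → ℂ) (z : Plane) : Prop :=
  ∃ r > 0, ∀ τ ∈ Icc (-1 : ℝ) 1, θ τ ≠ 0 → r ≤ ‖z - Γ.param τ‖

variable {Γ}

lemma OpenArc.exists_pos_le_norm_sub {S : Set ℝ} (hS : IsClosed S) {z : Plane}
    (hz : ∀ τ ∈ Icc (-1 : ℝ) 1, τ ∈ S → z ≠ Γ.param τ) :
    ∃ r > 0, ∀ τ ∈ Icc (-1 : ℝ) 1, τ ∈ S → r ≤ ‖z - Γ.param τ‖ := by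
  have hc : IsCompact (Γ.param '' (Icc (-1) 1 ∩ S)) :=
    (isCompact_Icc.inter_right hS).image_of_continuousOn
      (Γ.continuousOn_param.mono inter_subset_left)
  have hz' : z ∈ (Γ.param '' (Icc (-1) 1 ∩ S))ᶜ := by
    rintro ⟨τ, hτ, rfl⟩
    exact hz τ hτ.1 hτ.2 rfl
  obtain ⟨r, hr, h⟩ := Metric.isOpen_iff.1 hc.isClosed.isOpen_compl z hz'
  refine ⟨r, hr, fun τ hτ hS => ?_⟩
  by_contra! hlt
  exact h (a := Γ.param τ) (by rwa [Metric.mem_ball, dist_comm, dist_eq_norm]) ⟨τ, ⟨hτ, hS⟩, rfl⟩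

lemma OpenArc.awayFrom_of_notMem {z : Plane} (hz : z ∉ Γ.carrier) (θ : ℝ → ℂ) :
    Γ.AwayFrom θ z := by
  obtain ⟨r, hr, h⟩ := OpenArc.exists_pos_le_norm_sub (Γ := Γ) isClosed_univ (z := z)
    fun τ hτ _ heq => hz ⟨τ, hτ, heq.symm⟩
  exact ⟨r, hr, fun τ hτ _ => h τ hτ (mem_univ τ)⟩

variable (Γ)

lemma OpenArc.exists_bound_norm_sub (z : Plane) :
    ∃ R : ℝ, ∀ τ ∈ Icc (-1 : ℝ) 1, ‖z - Γ.param τ‖ ≤ R :=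
  isCompact_Icc.exists_bound_of_continuousOn (continuousOn_const.sub Γ.continuousOn_param)

/-- The potential `∫ K(z - x(τ)) θ(τ) dτ` of a convolution kernel, as an integral over the
parameter interval (the line element is part of `θ`). -/
noncomputable def OpenArc.layer (K : Plane → ℂ) (θ : ℝ → ℂ) (z : Plane) : ℂ :=
  ∫ τ in (-1 : ℝ)..1, K (z - Γ.param τ) * θ τ

/-- Absolute convergence of the potential. -/
def OpenArc.LayerIntegrable (K : Plane → ℂ) (θ : ℝ → ℂ) (z : Plane) : Prop :=
  IntervalIntegrable (fun τ => K (z - Γ.param τ) * θ τ) volume (-1) 1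

end Arc

lemma uIoc_neg_one_one : uIoc (-1 : ℝ) 1 = Ioc (-1) 1 := uIoc_of_le (by norm_num)

section Layer

variable {Γ : OpenArc} {K L : Plane → ℂ} {θ χ : ℝ → ℂ} {z : Plane}

lemma SmoothOff.measurable (hK : SmoothOff K) : Measurable K :=
  measurable_of_continuousOn_compl_singleton 0 (ContDiffOn.continuousOn hK)

lemma SmoothOff.aestronglyMeasurable_comp {f : ℝ → Plane} {s : Set ℝ} (hK : SmoothOff K)
    (hf : ContinuousOn f s) (hs : MeasurableSet s) :
    AEStronglyMeasurable (fun τ => K (f τ)) (volume.restrict s) :=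
  (hK.measurable.comp_aemeasurable (hf.aemeasurable hs)).aestronglyMeasurable

lemma exists_bound_of_smoothOff {F : Type*} [NormedAddCommGroup F] {f : Plane → F}
    (hf : ContinuousOn f {0}ᶜ) {r : ℝ} (hr : 0 < r) (R : ℝ) :
    ∃ C, 0 ≤ C ∧ ∀ v, r ≤ ‖v‖ → ‖v‖ ≤ R → ‖f v‖ ≤ C := by
  have hc : IsCompact (Metric.closedBall (0 : Plane) R ∩ {v | r ≤ ‖v‖}) :=
    (isCompact_closedBall _ _).inter_right (isClosed_le continuous_const continuous_norm)
  obtain ⟨C, hC⟩ := hc.exists_bound_of_continuousOn (hf.mono fun v hv => by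
    have : r ≤ ‖v‖ := hv.2
    simp only [mem_compl_iff, mem_singleton_iff]
    rintro rfl
    simp at this; linarith)
  exact ⟨max C 0, le_max_right _ _, fun v h1 h2 =>
    (hC v ⟨by simpa using h2, h1⟩).trans (le_max_left _ _)⟩

lemma aestronglyMeasurable_density (hθ : IntervalIntegrable θ volume (-1) 1) :
    AEStronglyMeasurable θ (volume.restrict (uIoc (-1) 1)) := by
  rw [uIoc_neg_one_one]; exact hθ.1.aestronglyMeasurable

lemma aestronglyMeasurable_kernel (hK : SmoothOff K) (z : Plane) :
    AEStronglyMeasurable (fun τ => K (z - Γ.param τ)) (volume.restrict (uIoc (-1) 1)) := by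
  rw [uIoc_neg_one_one]
  exact hK.aestronglyMeasurable_comp
    (continuousOn_const.sub (Γ.continuousOn_param.mono Ioc_subset_Icc_self)) measurableSet_Ioc

lemma layerIntegrable_of_awayFrom (hK : SmoothOff K) (hθ : IntervalIntegrable θ volume (-1) 1)
    (hz : Γ.AwayFrom θ z) : Γ.LayerIntegrable K θ z := by
  obtain ⟨r, hr, h⟩ := hz
  obtain ⟨R, hR⟩ := Γ.exists_bound_norm_sub z
  obtain ⟨C, hC0, hC⟩ := exists_bound_of_smoothOff (ContDiffOn.continuousOn hK) hr R
  refine (hθ.norm.const_mul C).mono_fun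
    ((aestronglyMeasurable_kernel hK z).mul (aestronglyMeasurable_density hθ)) ?_
  rw [uIoc_neg_one_one]
  refine (ae_restrict_iff' measurableSet_Ioc).2 (ae_of_all _ fun τ hτ => ?_)
  have hτ' := Ioc_subset_Icc_self hτ
  beta_reduce
  rw [norm_mul, norm_mul, norm_norm, Real.norm_of_nonneg hC0]
  by_cases h0 : θ τ = 0
  · simp [h0]
  · gcongr
    exact hC _ (h τ hτ' h0) (hR τ hτ')

/-- Differentiation of a potential under the integral sign, away from the density. -/
lemma layer_hasFDerivAt (hK : SmoothOff K) (hθ : IntervalIntegrable θ volume (-1) 1)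
    (hz : Γ.AwayFrom θ z) :
    DifferentiableAt ℝ (Γ.layer K θ) z ∧ ∀ i, pd i (Γ.layer K θ) z = Γ.layer (pd i K) θ z := by
  obtain ⟨r, hr, h⟩ := id hz
  obtain ⟨R, hR⟩ := Γ.exists_bound_norm_sub z
  obtain ⟨C, hC0, hC⟩ := exists_bound_of_smoothOff (hK.contDiffOn_fderiv.continuousOn)
    (half_pos hr) (R + r / 2)
  set F' : Plane → ℝ → Plane →L[ℝ] ℂ := fun w τ => θ τ • fderiv ℝ K (w - Γ.param τ) with hF'
  have hlow (w : Plane) (hw : w ∈ Metric.ball z (r / 2)) (τ : ℝ) (hτ : τ ∈ Icc (-1 : ℝ) 1)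
      (h0 : θ τ ≠ 0) : r / 2 ≤ ‖w - Γ.param τ‖ ∧ ‖w - Γ.param τ‖ ≤ R + r / 2 := by
    have h1 := h τ hτ h0
    have h2 := hR τ hτ
    have h3 : ‖z - w‖ < r / 2 := by rwa [Metric.mem_ball, dist_comm, dist_eq_norm] at hw
    have h3' : ‖w - z‖ < r / 2 := by rwa [Metric.mem_ball, dist_eq_norm] at hw
    have h4 : ‖z - Γ.param τ‖ ≤ ‖z - w‖ + ‖w - Γ.param τ‖ := norm_sub_le_norm_sub_add_norm_sub _ _ _
    have h5 : ‖w - Γ.param τ‖ ≤ ‖w - z‖ + ‖z - Γ.param τ‖ := norm_sub_le_norm_sub_add_norm_sub _ _ _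
    constructor <;> linarith
  have hzero (w : Plane) (τ : ℝ) (h0 : θ τ = 0) : F' w τ = 0 := by
    ext; simp [hF', h0]
  have hbound (w : Plane) (hw : w ∈ Metric.ball z (r / 2)) (τ : ℝ) (hτ : τ ∈ Icc (-1 : ℝ) 1) :
      ‖F' w τ‖ ≤ C * ‖θ τ‖ := by
    by_cases h0 : θ τ = 0
    · simp [hzero w τ h0, h0]
    · rw [hF', norm_smul, mul_comm]
      gcongr
      exact hC _ (hlow w hw τ hτ h0).1 (hlow w hw τ hτ h0).2
  have hball : Metric.ball z (r / 2) ∈ 𝓝 z := Metric.ball_mem_nhds z (half_pos hr)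
  have hmF : AEStronglyMeasurable (F' z) (volume.restrict (uIoc (-1) 1)) := by
    have h1 : Measurable (fderiv ℝ K) := measurable_fderiv ℝ K
    refine (aestronglyMeasurable_density hθ).smul ?_
    have h2 : AEMeasurable (fun τ => z - Γ.param τ) (volume.restrict (uIoc (-1 : ℝ) 1)) := by
      rw [uIoc_neg_one_one]
      exact (continuousOn_const.sub (Γ.continuousOn_param.mono Ioc_subset_Icc_self)).aemeasurable
        measurableSet_Ioc
    exact (h1.comp_aemeasurable h2).aestronglyMeasurable
  have key := intervalIntegral.hasFDerivAt_integral_of_dominated_of_fderiv_le (𝕜 := ℝ)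
    (μ := volume) (a := -1) (b := 1) (F := fun w τ => K (w - Γ.param τ) * θ τ) (F' := F')
    (bound := fun τ => C * ‖θ τ‖) (x₀ := z) hball
    (Eventually.of_forall fun w =>
      (aestronglyMeasurable_kernel hK w).mul (aestronglyMeasurable_density hθ))
    (layerIntegrable_of_awayFrom hK hθ hz) hmF
    (ae_of_all _ fun τ hτ w hw => hbound w hw τ
      (Ioc_subset_Icc_self (by rwa [uIoc_neg_one_one] at hτ)))
    (hθ.norm.const_mul C)
    (ae_of_all _ fun τ hτ w hw => by
      have hτ' : τ ∈ Icc (-1 : ℝ) 1 := Ioc_subset_Icc_self (by rwa [uIoc_neg_one_one] at hτ)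
      by_cases h0 : θ τ = 0
      · rw [hzero w τ h0]
        simp only [h0, mul_zero]
        exact hasFDerivAt_const _ _
      · have hne : w - Γ.param τ ≠ 0 := by
          rw [← norm_pos_iff]; linarith [(hlow w hw τ hτ' h0).1]
        exact ((hK.differentiableAt hne).hasFDerivAt.comp w
          ((hasFDerivAt_id w).sub_const (Γ.param τ))).mul_const (θ τ))
  refine ⟨key.differentiableAt, fun i => ?_⟩
  have hFi : IntervalIntegrable (F' z) volume (-1) 1 :=
    (hθ.norm.const_mul C).mono_fun hmF (by
      rw [uIoc_neg_one_one]
      refine (ae_restrict_iff' measurableSet_Ioc).2 (ae_of_all _ fun τ hτ => ?_)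
      beta_reduce
      rw [norm_mul, norm_norm, Real.norm_of_nonneg hC0]
      exact hbound z (Metric.mem_ball_self (half_pos hr)) τ (Ioc_subset_Icc_self hτ))
  rw [pd, show fderiv ℝ (Γ.layer K θ) z = _ from key.fderiv,
    ContinuousLinearMap.intervalIntegral_apply hFi]
  refine intervalIntegral.integral_congr fun τ _ => ?_
  simp [hF', pd, mul_comm]

lemma layer_add_kernel (hK : Γ.LayerIntegrable K θ z) (hL : Γ.LayerIntegrable L θ z) :
    Γ.layer (fun v => K v + L v) θ z = Γ.layer K θ z + Γ.layer L θ z := by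
  rw [OpenArc.layer, OpenArc.layer, OpenArc.layer, ← intervalIntegral.integral_add hK hL]
  exact intervalIntegral.integral_congr fun τ _ => add_mul _ _ _

lemma layer_const_mul_kernel (c : ℂ) :
    Γ.layer (fun v => c * K v) θ z = c * Γ.layer K θ z := by
  rw [OpenArc.layer, OpenArc.layer, ← intervalIntegral.integral_const_mul]
  exact intervalIntegral.integral_congr fun τ _ => mul_assoc _ _ _

lemma layer_add_density (hθ : Γ.LayerIntegrable K θ z) (hχ : Γ.LayerIntegrable K χ z) :
    Γ.layer K (fun τ => θ τ + χ τ) z = Γ.layer K θ z + Γ.layer K χ z := by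
  rw [OpenArc.layer, OpenArc.layer, OpenArc.layer, ← intervalIntegral.integral_add hθ hχ]
  exact intervalIntegral.integral_congr fun τ _ => mul_add _ _ _

lemma layer_congr_kernel (h : ∀ v ≠ 0, K v = L v) (hz : z ∉ Γ.carrier) :
    Γ.layer K θ z = Γ.layer L θ z := by
  refine intervalIntegral.integral_congr fun τ hτ => ?_
  rw [uIcc_of_le (by norm_num)] at hτ
  have hne : z - Γ.param τ ≠ 0 := by
    rw [sub_ne_zero]
    rintro rfl
    exact hz ⟨τ, hτ, rfl⟩
  simp only [h _ hne]

/-- Integration by parts along the arc, for a density that vanishes at both endpoints. -/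
lemma layer_deriv_density (hK : SmoothOff K) (hz : z ∉ Γ.carrier)
    (hc : ContinuousOn θ (Icc (-1) 1)) (hd : ∀ τ ∈ Ioo (-1 : ℝ) 1, DifferentiableAt ℝ θ τ)
    (hi : IntervalIntegrable (deriv θ) volume (-1) 1) (h1 : θ (-1) = 0) (h2 : θ 1 = 0) :
    Γ.layer K (deriv θ) z = Γ.layer (pd 0 K) (fun τ => (Γ.velocity τ 0 : ℂ) * θ τ) z
      + Γ.layer (pd 1 K) (fun τ => (Γ.velocity τ 1 : ℂ) * θ τ) z := by
  have hne (τ : ℝ) (hτ : τ ∈ Icc (-1 : ℝ) 1) : z - Γ.param τ ≠ 0 := by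
    rw [sub_ne_zero]
    rintro rfl
    exact hz ⟨τ, hτ, rfl⟩
  have hcv (j : Fin 2) : ContinuousOn (fun τ => (Γ.velocity τ j : ℂ) * θ τ) (Icc (-1) 1) :=
    ((contDiff_coord j).continuous.comp_continuousOn Γ.continuousOn_velocity).mul hc
  have hiv (j : Fin 2) : IntervalIntegrable (fun τ => (Γ.velocity τ j : ℂ) * θ τ) volume (-1) 1 :=
    ContinuousOn.intervalIntegrable (by rw [uIcc_of_le (by norm_num)]; exact hcv j)
  have i0 := layerIntegrable_of_awayFrom hK hi (OpenArc.awayFrom_of_notMem hz _)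
  have i1 (j : Fin 2) := layerIntegrable_of_awayFrom (hK.pd j) (hiv j)
    (OpenArc.awayFrom_of_notMem hz _)
  have key := intervalIntegral.integral_eq_sub_of_hasDerivAt_of_le (a := -1) (b := 1)
    (by norm_num) (f := fun τ => K (z - Γ.param τ) * θ τ)
    (f' := fun τ => K (z - Γ.param τ) * deriv θ τ
      - (pd 0 K (z - Γ.param τ) * ((Γ.velocity τ 0 : ℂ) * θ τ)
        + pd 1 K (z - Γ.param τ) * ((Γ.velocity τ 1 : ℂ) * θ τ)))
    (((ContDiffOn.continuousOn hK).comp (continuousOn_const.sub Γ.continuousOn_param)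
      fun τ hτ => hne τ hτ).mul hc)
    (fun τ hτ => by
      have e1 : HasDerivAt (fun τ => z - Γ.param τ) (-Γ.velocity τ) τ :=
        (Γ.hasDerivAt_param hτ).const_sub z
      have e2 := (hK.differentiableAt (hne τ (Ioo_subset_Icc_self hτ))).hasFDerivAt.comp_hasDerivAt
        τ e1
      refine (e2.mul (hd τ hτ).hasDerivAt).congr_deriv ?_
      rw [map_neg, fderiv_apply_eq_pd]
      simp only [Function.comp_apply]
      ring)
    (i0.sub ((i1 0).add (i1 1)))
  rw [h1, h2, mul_zero, mul_zero, sub_zero, intervalIntegral.integral_sub i0 ((i1 0).add (i1 1)),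
    intervalIntegral.integral_add (i1 0) (i1 1), sub_eq_zero] at key
  exact key

end Layer

/-! ### The limit of a weakly singular potential at the arc -/

section Near

variable (Γ : OpenArc)

lemma OpenArc.inner_normal_velocity (t : ℝ) : inner ℝ (Γ.normal t) (Γ.velocity t) = 0 := by
  simp [OpenArc.normal, PiLp.inner_apply, Fin.sum_univ_two]
  ring

lemma OpenArc.norm_normal {t : ℝ} (ht : t ∈ Icc (-1 : ℝ) 1) : ‖Γ.normal t‖ = 1 := by
  have hs := Γ.speed_pos ht
  have h1 : Γ.speed t ^ 2 = Γ.velocity t 0 ^ 2 + Γ.velocity t 1 ^ 2 := by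
    rw [OpenArc.speed, EuclideanSpace.norm_sq_eq]
    simp [Fin.sum_univ_two]
  have h2 : ‖Γ.normal t‖ ^ 2 = 1 := by
    rw [EuclideanSpace.norm_sq_eq]
    simp only [OpenArc.normal, Fin.sum_univ_two, Real.norm_eq_abs, sq_abs]
    simp
    field_simp
    linarith
  exact (pow_eq_one_iff_of_nonneg (norm_nonneg _) two_ne_zero).1 h2

lemma OpenArc.exists_lipschitz_velocity : ∃ L : ℝ, 0 ≤ L ∧ ∀ s ∈ Icc (-1 : ℝ) 1,
    ∀ τ ∈ Icc (-1 : ℝ) 1, ‖Γ.velocity s - Γ.velocity τ‖ ≤ L * |s - τ| := by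
  have hu : UniqueDiffOn ℝ (Icc (-1 : ℝ) 1) := uniqueDiffOn_Icc (by norm_num)
  obtain ⟨L, hL⟩ := isCompact_Icc.exists_bound_of_continuousOn
    ((Γ.contDiffOn_velocity.derivWithin hu (m := 0) (by simp)).continuousOn)
  refine ⟨max L 0, le_max_right _ _, fun s hs τ hτ => ?_⟩
  exact (convex_Icc (-1 : ℝ) 1).norm_image_sub_le_of_norm_derivWithin_le
    (Γ.contDiffOn_velocity.differentiableOn (by simp))
    (fun x hx => (hL x hx).trans (le_max_left _ _)) hτ hs

/-- Near an interior point the distance from a point of the arc to a point of the arc shifted in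
the direction of the fixed normal is bounded below by the parameter distance: compare the
components along the tangent at that point. -/
lemma OpenArc.exists_local_bound {t : ℝ} (ht : t ∈ Ioo (-1 : ℝ) 1) :
    ∃ r > 0, ∃ c > 0, Ioo (t - 3 * r) (t + 3 * r) ⊆ Ioo (-1 : ℝ) 1 ∧
      ∀ s ∈ Ioo (t - 3 * r) (t + 3 * r), ∀ τ ∈ Ioo (t - 3 * r) (t + 3 * r), ∀ ε : ℝ,
        c * |s - τ| ≤ ‖Γ.param s - Γ.param τ + ε • Γ.normal t‖ := by
  set e := Γ.velocity t with he
  have he0 : 0 < ‖e‖ := Γ.speed_pos (Ioo_subset_Icc_self ht)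
  have hcont : ContinuousAt Γ.velocity t :=
    Γ.continuousOn_velocity.continuousAt (Icc_mem_nhds ht.1 ht.2)
  have hev : ∀ᶠ s in 𝓝 t, ‖Γ.velocity s - e‖ < ‖e‖ / 2 ∧ s ∈ Ioo (-1 : ℝ) 1 := by
    refine Filter.Eventually.and ?_ (Ioo_mem_nhds ht.1 ht.2)
    have := Metric.tendsto_nhds.1 hcont (‖e‖ / 2) (half_pos he0)
    simpa only [dist_eq_norm] using this
  obtain ⟨ρ, hρ, hball⟩ := Metric.eventually_nhds_iff_ball.1 hev
  rw [Real.ball_eq_Ioo] at hball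
  refine ⟨ρ / 3, by positivity, ‖e‖ / 2, half_pos he0, ?_⟩
  rw [show 3 * (ρ / 3) = ρ by ring]
  refine ⟨fun s hs => (hball s hs).2, fun s hs τ hτ ε => ?_⟩
  have hmvt : ‖(Γ.param s - s • e) - (Γ.param τ - τ • e)‖ ≤ ‖e‖ / 2 * ‖s - τ‖ := by
    refine (convex_Ioo (t - ρ) (t + ρ)).norm_image_sub_le_of_norm_hasDerivWithin_le
      (f := fun s => Γ.param s - s • e) (f' := fun s => Γ.velocity s - e)
      (fun x hx => ?_) (fun x hx => (hball x hx).1.le) hτ hs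
    have h1 := (Γ.hasDerivAt_param (hball x hx).2).sub ((hasDerivAt_id x).smul_const e)
    rw [one_smul] at h1
    exact h1.hasDerivWithinAt
  set v := Γ.param s - Γ.param τ + ε • Γ.normal t with hv
  set w := (Γ.param s - s • e) - (Γ.param τ - τ • e) with hw
  have hinner : inner ℝ v e = (s - τ) * ‖e‖ ^ 2 + inner ℝ w e := by
    have h0 : inner ℝ (Γ.normal t) e = 0 := Γ.inner_normal_velocity t
    have hvw : v = (s - τ) • e + w + ε • Γ.normal t := by rw [hv, hw]; module
    rw [hvw, inner_add_left, inner_add_left, real_inner_smul_left, real_inner_smul_left, h0,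
      real_inner_self_eq_norm_sq]
    ring
  have h1 : |(s - τ) * ‖e‖ ^ 2| ≤ ‖v‖ * ‖e‖ + ‖w‖ * ‖e‖ := by
    have : (s - τ) * ‖e‖ ^ 2 = inner ℝ v e - inner ℝ w e := by rw [hinner]; ring
    rw [this]
    exact (abs_sub _ _).trans (add_le_add (abs_real_inner_le_norm _ _) (abs_real_inner_le_norm _ _))
  rw [abs_mul, abs_of_pos (pow_pos he0 2)] at h1
  rw [Real.norm_eq_abs] at hmvt
  have h2 : |s - τ| * ‖e‖ ≤ ‖v‖ + ‖w‖ := by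
    have : (|s - τ| * ‖e‖) * ‖e‖ ≤ (‖v‖ + ‖w‖) * ‖e‖ := by nlinarith
    exact le_of_mul_le_mul_right this he0
  linarith

lemma intervalIntegrable_abs_rpow (r : ℝ) :
    IntervalIntegrable (fun σ : ℝ => |σ| ^ (-1 / 2 : ℝ)) volume (-r) r := by
  wlog hr : 0 ≤ r generalizing r
  · have := (this (-r) (by linarith)).symm
    simpa using this
  have h1 : IntervalIntegrable (fun σ : ℝ => |σ| ^ (-1 / 2 : ℝ)) volume 0 r := by
    refine (intervalIntegral.intervalIntegrable_rpow' (a := 0) (b := r) (r := -1 / 2)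
      (by norm_num)).congr fun σ hσ => ?_
    rw [uIoc_of_le hr] at hσ
    simp only [abs_of_pos hσ.1]
  have h2 : IntervalIntegrable (fun σ : ℝ => |σ| ^ (-1 / 2 : ℝ)) volume (-r) 0 := by
    have := h1.comp_mul_left (c := -1)
    simpa [div_neg] using this.symm
  exact h2.trans h1

/-- A kernel that is `O(r^(-1/2))` with gradient `O(r^(-3/2))` at the origin. Any exponent in
`(-1, 0)` would serve: it has to dominate a logarithm and to be integrable on a line. -/
structure WeaklySingular (K : Plane → ℂ) : Prop where
  smooth : SmoothOff K
  order : KernelOrder (-1 / 2) K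

variable {Γ} {K : Plane → ℂ}

lemma WeaklySingular.exists_bound (hK : WeaklySingular K) (R : ℝ) : ∃ C : ℝ, 0 ≤ C ∧
    ∀ v ≠ 0, ‖v‖ ≤ R → ‖K v‖ ≤ C * ‖v‖ ^ (-1 / 2 : ℝ) ∧
      ∀ w, ‖fderiv ℝ K v w‖ ≤ C * ‖v‖ ^ (-3 / 2 : ℝ) * ‖w‖ := by
  obtain ⟨C, hC, h⟩ := hK.order.2 R
  refine ⟨C, hC, fun v hv hR => ⟨(h v hv hR).1, fun w => ?_⟩⟩
  refine ((fderiv ℝ K v).le_opNorm w).trans ?_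
  have := (h v hv hR).2
  rw [show (-1 / 2 - 1 : ℝ) = -3 / 2 by norm_num] at this
  gcongr

/-- Near an interior point, with a compactly supported density of class `C¹`. The substitution
`τ = s + σ` moves the derivative in `s` partly to the density and partly to the difference
`x(s) - x(s + σ)`, whose derivative is `O(σ)`; this compensates one order of the singularity. -/
lemma near_limit (hK : WeaklySingular K) {t : ℝ} {r c : ℝ} (hr : 0 < r) (hc : 0 < c)
    (hsub : Ioo (t - 3 * r) (t + 3 * r) ⊆ Ioo (-1 : ℝ) 1)
    (hlow : ∀ s ∈ Ioo (t - 3 * r) (t + 3 * r), ∀ τ ∈ Ioo (t - 3 * r) (t + 3 * r), ∀ ε : ℝ,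
        c * |s - τ| ≤ ‖Γ.param s - Γ.param τ + ε • Γ.normal t‖)
    {θ : ℝ → ℂ} (hθ : ContDiff ℝ 1 θ) (hsupp : ∀ τ, r ≤ |τ - t| → θ τ = 0) :
    (∀ ε : ℝ, |ε| ≤ 1 → Γ.LayerIntegrable K θ (Γ.param t + ε • Γ.normal t)) ∧
    Tendsto (fun ε : ℝ => Γ.layer K θ (Γ.param t + ε • Γ.normal t)) (𝓝 0)
      (𝓝 (Γ.layer K θ (Γ.param t))) ∧
    ∃ G : ℝ → ℂ, Tendsto G (𝓝 0) (𝓝 (G 0)) ∧ ∀ ε : ℝ, |ε| ≤ 1 →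
      HasDerivAt (fun s => Γ.layer K θ (Γ.param s + ε • Γ.normal t)) (G ε) t := by
  set ν := Γ.normal t with hν
  set I := Ioo (t - 3 * r) (t + 3 * r) with hI
  -- the window of the shifted variable
  have hwin (s : ℝ) (hs : s ∈ Metric.ball t r) (σ : ℝ) (hσ : σ ∈ Ioc (-(2 * r)) (2 * r)) :
      s ∈ I ∧ s + σ ∈ I := by
    rw [Real.ball_eq_Ioo] at hs
    rw [hI]
    exact ⟨⟨by linarith [hs.1], by linarith [hs.2]⟩,
      ⟨by linarith [hs.1, hσ.1], by linarith [hs.2, hσ.2]⟩⟩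
  have hcontI : ContinuousOn Γ.param I :=
    Γ.continuousOn_param.mono (hsub.trans Ioo_subset_Icc_self)
  have hcontVI : ContinuousOn Γ.velocity I :=
    Γ.continuousOn_velocity.mono (hsub.trans Ioo_subset_Icc_self)
  -- constants
  obtain ⟨R₀, hR₀⟩ := isCompact_Icc.exists_bound_of_continuousOn Γ.continuousOn_param
  obtain ⟨C, hC0, hC⟩ := hK.exists_bound (R₀ + R₀ + ‖ν‖)
  obtain ⟨L, hL0, hL⟩ := Γ.exists_lipschitz_velocity
  have hθcs : HasCompactSupport θ := by
    refine HasCompactSupport.intro (isCompact_closedBall t r) fun τ hτ => hsupp τ ?_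
    simp only [Metric.mem_closedBall, Real.dist_eq, not_le] at hτ
    exact hτ.le
  obtain ⟨M, hM⟩ := hθcs.exists_bound_of_continuous hθ.continuous
  have hθ'c : Continuous (deriv θ) := hθ.continuous_deriv le_rfl
  obtain ⟨M', hM'⟩ := hθcs.deriv.exists_bound_of_continuous hθ'c
  have hM0 : 0 ≤ M := (norm_nonneg _).trans (hM 0)
  have hM'0 : 0 ≤ M' := (norm_nonneg _).trans (hM' 0)
  set V : ℝ → ℝ → ℝ → Plane := fun ε s σ => Γ.param s - Γ.param (s + σ) + ε • ν with hV
  have hVlow (ε : ℝ) (s : ℝ) (hs : s ∈ Metric.ball t r) (σ : ℝ)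
      (hσ : σ ∈ Ioc (-(2 * r)) (2 * r)) : c * |σ| ≤ ‖V ε s σ‖ := by
    have h := hlow s (hwin s hs σ hσ).1 (s + σ) (hwin s hs σ hσ).2 ε
    simpa using h
  have hVhigh (ε : ℝ) (hε : |ε| ≤ 1) (s : ℝ) (hs : s ∈ Metric.ball t r) (σ : ℝ)
      (hσ : σ ∈ Ioc (-(2 * r)) (2 * r)) : ‖V ε s σ‖ ≤ R₀ + R₀ + ‖ν‖ := by
    have h1 := hR₀ s (Ioo_subset_Icc_self (hsub (hwin s hs σ hσ).1))
    have h2 := hR₀ (s + σ) (Ioo_subset_Icc_self (hsub (hwin s hs σ hσ).2))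
    have h3 : ‖ε • ν‖ ≤ ‖ν‖ := by
      rw [norm_smul, Real.norm_eq_abs]
      exact mul_le_of_le_one_left (norm_nonneg _) hε
    calc ‖V ε s σ‖ ≤ ‖Γ.param s - Γ.param (s + σ)‖ + ‖ε • ν‖ := norm_add_le _ _
      _ ≤ _ := by linarith [norm_sub_le (Γ.param s) (Γ.param (s + σ))]
  have hVne (ε : ℝ) (s : ℝ) (hs : s ∈ Metric.ball t r) (σ : ℝ)
      (hσ : σ ∈ Ioc (-(2 * r)) (2 * r)) (h0 : σ ≠ 0) : V ε s σ ≠ 0 := by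
    rw [← norm_pos_iff]
    exact lt_of_lt_of_le (mul_pos hc (abs_pos.2 h0)) (hVlow ε s hs σ hσ)
  -- the integrand and its derivative
  set F : ℝ → ℝ → ℝ → ℂ := fun ε s σ => K (V ε s σ) * θ (s + σ) with hF
  set W : ℝ → ℝ → Plane := fun s σ => Γ.velocity s - Γ.velocity (s + σ) with hW
  set F' : ℝ → ℝ → ℝ → ℂ := fun ε s σ =>
    ((W s σ 0 : ℂ) * pd 0 K (V ε s σ) + (W s σ 1 : ℂ) * pd 1 K (V ε s σ)) * θ (s + σ)
      + K (V ε s σ) * deriv θ (s + σ) with hF'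
  have hFbound (ε : ℝ) (hε : |ε| ≤ 1) (s : ℝ) (hs : s ∈ Metric.ball t r) (σ : ℝ)
      (hσ : σ ∈ Ioc (-(2 * r)) (2 * r)) (h0 : σ ≠ 0) :
      ‖K (V ε s σ)‖ ≤ C * c ^ (-1 / 2 : ℝ) * |σ| ^ (-1 / 2 : ℝ) := by
    have hσ0 : 0 < |σ| := abs_pos.2 h0
    refine ((hC _ (hVne ε s hs σ hσ h0) (hVhigh ε hε s hs σ hσ)).1).trans ?_
    rw [mul_assoc, ← Real.mul_rpow hc.le hσ0.le]
    exact mul_le_mul_of_nonneg_left (Real.rpow_le_rpow_of_nonpos (by positivity)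
      (hVlow ε s hs σ hσ) (by norm_num)) hC0
  have hDbound (ε : ℝ) (hε : |ε| ≤ 1) (s : ℝ) (hs : s ∈ Metric.ball t r) (σ : ℝ)
      (hσ : σ ∈ Ioc (-(2 * r)) (2 * r)) (h0 : σ ≠ 0) :
      ‖fderiv ℝ K (V ε s σ) (W s σ)‖ ≤ C * c ^ (-3 / 2 : ℝ) * L * |σ| ^ (-1 / 2 : ℝ) := by
    have hσ0 : 0 < |σ| := abs_pos.2 h0
    refine ((hC _ (hVne ε s hs σ hσ h0) (hVhigh ε hε s hs σ hσ)).2 _).trans ?_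
    have h1 : ‖V ε s σ‖ ^ (-3 / 2 : ℝ) ≤ (c * |σ|) ^ (-3 / 2 : ℝ) :=
      Real.rpow_le_rpow_of_nonpos (by positivity) (hVlow ε s hs σ hσ) (by norm_num)
    have h2 : ‖W s σ‖ ≤ L * |σ| := by
      have := hL s (Ioo_subset_Icc_self (hsub (hwin s hs σ hσ).1)) (s + σ)
        (Ioo_subset_Icc_self (hsub (hwin s hs σ hσ).2))
      simpa using this
    have h3 : |σ| ^ (-3 / 2 : ℝ) * |σ| = |σ| ^ (-1 / 2 : ℝ) := by
      rw [← Real.rpow_add_one hσ0.ne']; norm_num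
    calc C * ‖V ε s σ‖ ^ (-3 / 2 : ℝ) * ‖W s σ‖
        ≤ C * (c * |σ|) ^ (-3 / 2 : ℝ) * (L * |σ|) := by gcongr
      _ = C * c ^ (-3 / 2 : ℝ) * L * (|σ| ^ (-3 / 2 : ℝ) * |σ|) := by
          rw [Real.mul_rpow hc.le hσ0.le]; ring
      _ = _ := by rw [h3]
  set B : ℝ → ℝ := fun σ => (C * c ^ (-3 / 2 : ℝ) * L * M + C * c ^ (-1 / 2 : ℝ) * M'
    + C * c ^ (-1 / 2 : ℝ) * M) * |σ| ^ (-1 / 2 : ℝ) with hB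
  have hBint : IntervalIntegrable B volume (-(2 * r)) (2 * r) :=
    (intervalIntegrable_abs_rpow _).const_mul _
  have hFB (ε : ℝ) (hε : |ε| ≤ 1) (s : ℝ) (hs : s ∈ Metric.ball t r) (σ : ℝ)
      (hσ : σ ∈ Ioc (-(2 * r)) (2 * r)) (h0 : σ ≠ 0) : ‖F ε s σ‖ ≤ B σ := by
    have p1 : 0 ≤ C * c ^ (-3 / 2 : ℝ) * L * M * |σ| ^ (-1 / 2 : ℝ) := by positivity
    have p2 : 0 ≤ C * c ^ (-1 / 2 : ℝ) * M' * |σ| ^ (-1 / 2 : ℝ) := by positivity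
    calc ‖F ε s σ‖ = ‖K (V ε s σ)‖ * ‖θ (s + σ)‖ := norm_mul _ _
      _ ≤ (C * c ^ (-1 / 2 : ℝ) * |σ| ^ (-1 / 2 : ℝ)) * M := by
          gcongr
          · exact hFbound ε hε s hs σ hσ h0
          · exact hM _
      _ ≤ B σ := by rw [hB]; linarith
  have hF'B (ε : ℝ) (hε : |ε| ≤ 1) (s : ℝ) (hs : s ∈ Metric.ball t r) (σ : ℝ)
      (hσ : σ ∈ Ioc (-(2 * r)) (2 * r)) (h0 : σ ≠ 0) : ‖F' ε s σ‖ ≤ B σ := by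
    have p2 : 0 ≤ C * c ^ (-1 / 2 : ℝ) * M * |σ| ^ (-1 / 2 : ℝ) := by positivity
    calc ‖F' ε s σ‖ ≤ ‖fderiv ℝ K (V ε s σ) (W s σ)‖ * ‖θ (s + σ)‖
          + ‖K (V ε s σ)‖ * ‖deriv θ (s + σ)‖ := by
          rw [hF', ← norm_mul, ← norm_mul, fderiv_apply_eq_pd]
          exact norm_add_le _ _
      _ ≤ (C * c ^ (-3 / 2 : ℝ) * L * |σ| ^ (-1 / 2 : ℝ)) * M
          + (C * c ^ (-1 / 2 : ℝ) * |σ| ^ (-1 / 2 : ℝ)) * M' := by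
          gcongr
          · exact hDbound ε hε s hs σ hσ h0
          · exact hM _
          · exact hFbound ε hε s hs σ hσ h0
          · exact hM' _
      _ ≤ B σ := by rw [hB]; linarith
  have hae : ∀ᵐ σ : ℝ, σ ≠ 0 := by
    simp [ae_iff]
  have huI : uIoc (-(2 * r)) (2 * r) = Ioc (-(2 * r)) (2 * r) := uIoc_of_le (by linarith)
  -- measurability
  have hcadd (s : ℝ) : ContinuousOn (fun σ => s + σ) (Ioc (-(2 * r)) (2 * r)) :=
    (continuous_const.add continuous_id).continuousOn
  have hmap (s : ℝ) (hs : s ∈ Metric.ball t r) :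
      MapsTo (fun σ => s + σ) (Ioc (-(2 * r)) (2 * r)) I := fun σ hσ => (hwin s hs σ hσ).2
  have hVc (ε s : ℝ) (hs : s ∈ Metric.ball t r) :
      ContinuousOn (V ε s) (Ioc (-(2 * r)) (2 * r)) :=
    (continuousOn_const.sub (hcontI.comp (hcadd s) (hmap s hs))).add continuousOn_const
  have hWc (s : ℝ) (hs : s ∈ Metric.ball t r) :
      ContinuousOn (W s) (Ioc (-(2 * r)) (2 * r)) :=
    continuousOn_const.sub (hcontVI.comp (hcadd s) (hmap s hs))
  have hmK (L : Plane → ℂ) (hL : SmoothOff L) (ε s : ℝ) (hs : s ∈ Metric.ball t r) :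
      AEStronglyMeasurable (fun σ => L (V ε s σ))
        (volume.restrict (uIoc (-(2 * r)) (2 * r))) := by
    rw [huI]
    exact hL.aestronglyMeasurable_comp (hVc ε s hs) measurableSet_Ioc
  have hmF (ε s : ℝ) (hs : s ∈ Metric.ball t r) : AEStronglyMeasurable (F ε s)
      (volume.restrict (uIoc (-(2 * r)) (2 * r))) :=
    (hmK K hK.smooth ε s hs).mul
      (hθ.continuous.comp (continuous_const.add continuous_id)).aestronglyMeasurable
  have hmW (s : ℝ) (hs : s ∈ Metric.ball t r) (j : Fin 2) :
      AEStronglyMeasurable (fun σ => (W s σ j : ℂ))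
        (volume.restrict (uIoc (-(2 * r)) (2 * r))) := by
    rw [huI]
    exact ((contDiff_coord j).continuous.comp_continuousOn (hWc s hs)).aestronglyMeasurable
      measurableSet_Ioc
  have hmF' (ε s : ℝ) (hs : s ∈ Metric.ball t r) : AEStronglyMeasurable (F' ε s)
      (volume.restrict (uIoc (-(2 * r)) (2 * r))) :=
    ((((hmW s hs 0).mul (hmK _ (hK.smooth.pd 0) ε s hs)).add
      ((hmW s hs 1).mul (hmK _ (hK.smooth.pd 1) ε s hs))).mul
      (hθ.continuous.comp (continuous_const.add continuous_id)).aestronglyMeasurable).add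
      ((hmK K hK.smooth ε s hs).mul
        (hθ'c.comp (continuous_const.add continuous_id)).aestronglyMeasurable)
  have htb : t ∈ Metric.ball t r := Metric.mem_ball_self hr
  have hFint (ε : ℝ) (hε : |ε| ≤ 1) :
      IntervalIntegrable (F ε t) volume (-(2 * r)) (2 * r) := by
    refine hBint.mono_fun (hmF ε t htb) ?_
    rw [huI]
    refine (ae_restrict_iff' measurableSet_Ioc).2 ?_
    filter_upwards [hae] with σ h0 hσ
    exact (hFB ε hε t htb σ hσ h0).trans (le_abs_self _)
  -- the substitution
  have hsuppF (ε s : ℝ) (hs : s ∈ Metric.ball t r) :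
      Function.support (F ε s) ⊆ Ioc (-(2 * r)) (2 * r) := by
    intro σ hσ
    have hne : θ (s + σ) ≠ 0 := right_ne_zero_of_mul hσ
    have h1 : |s + σ - t| < r := by
      by_contra! h
      exact hne (hsupp _ h)
    rw [Real.ball_eq_Ioo] at hs
    rw [abs_lt] at h1
    exact ⟨by linarith [hs.1, hs.2, h1.1, h1.2], by linarith [hs.1, hs.2, h1.1, h1.2]⟩
  have hsuppL (z : Plane) : Function.support (fun τ => K (z - Γ.param τ) * θ τ) ⊆ Ioc (-1) 1 := by
    intro τ hτ
    have hne : θ τ ≠ 0 := right_ne_zero_of_mul hτ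
    have h1 : |τ - t| < r := by
      by_contra! h
      exact hne (hsupp _ h)
    rw [abs_lt] at h1
    exact Ioo_subset_Ioc_self (hsub ⟨by linarith [h1.1], by linarith [h1.2]⟩)
  have hFeq (ε s : ℝ) : (fun σ => F ε s σ) =
      fun σ => (fun τ => K (Γ.param s + ε • ν - Γ.param τ) * θ τ) (s + σ) := by
    funext σ
    simp only [hF, hV]
    congr 2
    abel
  have hlayer (ε s : ℝ) (hs : s ∈ Metric.ball t r) :
      Γ.layer K θ (Γ.param s + ε • ν) = ∫ σ in (-(2 * r))..(2 * r), F ε s σ := by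
    rw [OpenArc.layer, intervalIntegral.integral_eq_integral_of_support_subset (hsuppL _),
      intervalIntegral.integral_eq_integral_of_support_subset (hsuppF ε s hs), hFeq,
      integral_add_left_eq_self (fun τ => K (Γ.param s + ε • ν - Γ.param τ) * θ τ) s]
  refine ⟨fun ε hε => ?_, ?_, fun ε => ∫ σ in (-(2 * r))..(2 * r), F' ε t σ, ?_, fun ε hε => ?_⟩
  · have h1 : Integrable (F ε t) := by
      rw [← integrableOn_iff_integrable_of_support_subset (hsuppF ε t htb)]
      exact (hFint ε hε).1
    have h2 : Integrable (fun τ => K (Γ.param t + ε • ν - Γ.param τ) * θ τ) := by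
      have := (measurePreserving_add_left volume t).integrable_comp_emb
        (measurableEmbedding_addLeft t)
        (g := fun τ => K (Γ.param t + ε • ν - Γ.param τ) * θ τ)
      refine this.1 ?_
      have h3 : F ε t = (fun τ => K (Γ.param t + ε • ν - Γ.param τ) * θ τ) ∘ fun σ => t + σ :=
        hFeq ε t
      rw [← h3]
      exact h1
    exact h2.intervalIntegrable
  · have h0 : Γ.layer K θ (Γ.param t) = ∫ σ in (-(2 * r))..(2 * r), F 0 t σ := by
      rw [← hlayer 0 t htb, zero_smul, add_zero]
    rw [h0]
    simp only [hlayer _ t htb]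
    refine intervalIntegral.tendsto_integral_filter_of_dominated_convergence B
      (Eventually.of_forall fun ε => hmF ε t htb) ?_ hBint ?_
    · filter_upwards [Metric.closedBall_mem_nhds (0 : ℝ) one_pos] with ε hε
      filter_upwards [hae] with σ hσ0 hσ
      rw [huI] at hσ
      exact hFB ε (by simpa using hε) t htb σ hσ hσ0
    · filter_upwards [hae] with σ hσ0 hσ
      rw [huI] at hσ
      have hcV : ContinuousAt (fun ε => V ε t σ) 0 := by
        simp only [hV]; fun_prop
      have hk : ContinuousAt K (V 0 t σ) :=
        (hK.smooth.differentiableAt (hVne 0 t htb σ hσ hσ0)).continuousAt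
      have := (ContinuousAt.comp (f := fun ε => V ε t σ) hk hcV).mul
        (continuousAt_const (y := θ (t + σ)))
      exact this.tendsto
  · refine intervalIntegral.tendsto_integral_filter_of_dominated_convergence B
      (Eventually.of_forall fun ε => hmF' ε t htb) ?_ hBint ?_
    · filter_upwards [Metric.closedBall_mem_nhds (0 : ℝ) one_pos] with ε hε
      filter_upwards [hae] with σ hσ0 hσ
      rw [huI] at hσ
      exact hF'B ε (by simpa using hε) t htb σ hσ hσ0
    · filter_upwards [hae] with σ hσ0 hσ
      rw [huI] at hσ
      have hcV : ContinuousAt (fun ε => V ε t σ) 0 := by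
        simp only [hV]; fun_prop
      have hk (L : Plane → ℂ) (hL : SmoothOff L) : ContinuousAt (fun ε => L (V ε t σ)) 0 :=
        ContinuousAt.comp (f := fun ε => V ε t σ)
          (hL.differentiableAt (hVne 0 t htb σ hσ hσ0)).continuousAt hcV
      have := (((continuousAt_const (y := (W t σ 0 : ℂ))).mul (hk _ (hK.smooth.pd 0))).add
        ((continuousAt_const (y := (W t σ 1 : ℂ))).mul (hk _ (hK.smooth.pd 1)))).mul
        (continuousAt_const (y := θ (t + σ))) |>.add
        ((hk K hK.smooth).mul (continuousAt_const (y := deriv θ (t + σ))))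
      exact this.tendsto
  · have hev : (fun s => Γ.layer K θ (Γ.param s + ε • ν)) =ᶠ[𝓝 t]
        fun s => ∫ σ in (-(2 * r))..(2 * r), F ε s σ := by
      filter_upwards [Metric.ball_mem_nhds t hr] with s hs using hlayer ε s hs
    refine HasDerivAt.congr_of_eventuallyEq ?_ hev
    refine (intervalIntegral.hasDerivAt_integral_of_dominated_loc_of_deriv_le (𝕜 := ℝ)
      (bound := B) (Metric.ball_mem_nhds t hr) ?_ (hFint ε hε) (hmF' ε t htb) ?_ hBint ?_).2
    · filter_upwards [Metric.ball_mem_nhds t hr] with s hs using hmF ε s hs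
    · filter_upwards [hae] with σ hσ0 hσ s hs
      rw [huI] at hσ
      exact hF'B ε hε s hs σ hσ hσ0
    · filter_upwards [hae] with σ hσ0 hσ s hs
      rw [huI] at hσ
      have d1 := Γ.hasDerivAt_param (hsub (hwin s hs σ hσ).1)
      have d2 := (Γ.hasDerivAt_param (hsub (hwin s hs σ hσ).2)).comp_add_const s σ
      have d3 : HasDerivAt (fun s => V ε s σ) (W s σ) s := (d1.sub d2).add_const _
      have d4 := (hK.smooth.differentiableAt (hVne ε s hs σ hσ hσ0)).hasFDerivAt.comp_hasDerivAt
        s d3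
      have d5 := ((hθ.differentiable one_ne_zero) (s + σ)).hasDerivAt.comp_add_const s σ
      refine (d4.mul d5).congr_deriv ?_
      rw [fderiv_apply_eq_pd]
      simp [hF']

end Near

section Limit

variable {Γ : OpenArc} {K : Plane → ℂ} {θ : ℝ → ℂ} {t : ℝ}

lemma OpenArc.AwayFrom.eventually {z : Plane} (h : Γ.AwayFrom θ z) :
    ∀ᶠ w in 𝓝 z, Γ.AwayFrom θ w := by
  obtain ⟨r, hr, h⟩ := h
  filter_upwards [Metric.ball_mem_nhds z (half_pos hr)] with w hw
  refine ⟨r / 2, half_pos hr, fun τ hτ h0 => ?_⟩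
  have h1 := h τ hτ h0
  have h3 : ‖z - w‖ < r / 2 := by rwa [Metric.mem_ball, dist_comm, dist_eq_norm] at hw
  linarith [norm_sub_le_norm_sub_add_norm_sub z w (Γ.param τ)]

lemma OpenArc.param_ne (Γ : OpenArc) {τ : ℝ} (ht : t ∈ Ioo (-1 : ℝ) 1)
    (hτ : τ ∈ Icc (-1 : ℝ) 1) (h : τ ≠ t) : Γ.param t ≠ Γ.param τ := fun heq =>
  h (Γ.injective (Ioo_subset_Icc_self ht) hτ heq).symm

lemma isClosed_far (t r : ℝ) : IsClosed {τ : ℝ | r ≤ |τ - t|} :=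
  isClosed_le continuous_const (continuous_abs.comp (continuous_id.sub continuous_const))

lemma OpenArc.exists_pos_le_far (Γ : OpenArc) (ht : t ∈ Ioo (-1 : ℝ) 1) {r : ℝ} (hr : 0 < r) :
    ∃ δ > 0, ∀ τ ∈ Icc (-1 : ℝ) 1, r ≤ |τ - t| → δ ≤ ‖Γ.param t - Γ.param τ‖ :=
  OpenArc.exists_pos_le_norm_sub (isClosed_far t r) fun τ hτ hS =>
    Γ.param_ne ht hτ (by rintro rfl; simp at hS; linarith)

/-- A short normal segment through an interior point meets the arc only at that point. -/
lemma OpenArc.eventually_notMem_carrier (Γ : OpenArc) (ht : t ∈ Ioo (-1 : ℝ) 1) :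
    ∀ᶠ ε in 𝓝[≠] (0 : ℝ), Γ.param t + ε • Γ.normal t ∉ Γ.carrier := by
  obtain ⟨r, hr, c, hc, -, hlow⟩ := Γ.exists_local_bound ht
  obtain ⟨δ, hδ, hfar⟩ := Γ.exists_pos_le_far ht hr
  have hn := Γ.norm_normal (Ioo_subset_Icc_self ht)
  filter_upwards [self_mem_nhdsWithin,
    mem_nhdsWithin_of_mem_nhds (Metric.ball_mem_nhds (0 : ℝ) hδ)] with ε hε hεδ
  rintro ⟨τ, hτ, heq⟩
  have hεδ' : |ε| < δ := by simpa using hεδ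
  rcases le_or_gt r |τ - t| with h | h
  · have h1 := hfar τ hτ h
    rw [heq, sub_add_cancel_left, norm_neg, norm_smul, hn, mul_one, Real.norm_eq_abs] at h1
    linarith
  · rw [abs_lt] at h
    have h1 := hlow t ⟨by linarith, by linarith⟩ τ ⟨by linarith, by linarith⟩ ε
    rw [heq, show Γ.param t - (Γ.param t + ε • Γ.normal t) + ε • Γ.normal t = 0 by abel,
      norm_zero] at h1
    have h2 : |t - τ| = 0 := by
      by_contra h0
      have := mul_pos hc (lt_of_le_of_ne (abs_nonneg _) (Ne.symm h0))
      linarith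
    have h3 : τ = t := by linarith [abs_eq_zero.1 h2]
    subst h3
    have h4 : ‖ε • Γ.normal τ‖ = 0 := by
      rw [norm_eq_zero]
      exact left_eq_add.1 heq
    rw [norm_smul, hn, mul_one, norm_eq_zero] at h4
    exact hε h4

/-- Splitting of a density into a part of class `C¹` supported near an interior point, and a part
that vanishes near this point. -/
lemma OpenArc.exists_split (Γ : OpenArc) (ht : t ∈ Ioo (-1 : ℝ) 1)
    (hi : IntervalIntegrable θ volume (-1) 1) (hθ : ContDiffOn ℝ 1 θ (Ioo (-1) 1)) {r : ℝ}
    (hr : 0 < r) (hsub : Ioo (t - 3 * r) (t + 3 * r) ⊆ Ioo (-1 : ℝ) 1) :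
    ∃ θ₁ θ₂ : ℝ → ℂ, ContDiff ℝ 1 θ₁ ∧ (∀ τ, r ≤ |τ - t| → θ₁ τ = 0) ∧
      IntervalIntegrable θ₂ volume (-1) 1 ∧ Γ.AwayFrom θ₂ (Γ.param t) ∧
      θ = fun τ => θ₁ τ + θ₂ τ := by
  let χ : ContDiffBump t := ⟨r / 2, r, half_pos hr, half_lt_self hr⟩
  have hz (τ : ℝ) (h : r ≤ |τ - t|) : χ τ = 0 := χ.zero_of_le_dist (by rwa [Real.dist_eq])
  have h1 : ContDiff ℝ 1 fun τ => (χ τ : ℂ) * θ τ := by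
    refine contDiff_iff_contDiffAt.2 fun τ => ?_
    by_cases hτ : τ ∈ Ioo (-1 : ℝ) 1
    · exact (Complex.ofRealCLM.contDiff.comp χ.contDiff).contDiffAt.mul
        (hθ.contDiffAt (isOpen_Ioo.mem_nhds hτ))
    · have hfar : r < |τ - t| := by
        by_contra! h
        rw [abs_le] at h
        exact hτ (hsub ⟨by linarith [h.1], by linarith [h.2]⟩)
      have hev : (fun τ => (χ τ : ℂ) * θ τ) =ᶠ[𝓝 τ] fun _ => 0 := by
        have ho : IsOpen {τ : ℝ | r < |τ - t|} :=
          isOpen_lt continuous_const (continuous_abs.comp (continuous_id.sub continuous_const))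
        filter_upwards [ho.mem_nhds hfar] with σ hσ
        rw [hz σ (le_of_lt hσ)]; simp
      exact contDiffAt_const.congr_of_eventuallyEq hev
  refine ⟨fun τ => (χ τ : ℂ) * θ τ, fun τ => θ τ - (χ τ : ℂ) * θ τ, h1,
    fun τ h => by simp [hz τ h], hi.sub (h1.continuous.intervalIntegrable _ _), ?_, ?_⟩
  · obtain ⟨δ, hδ, hfar⟩ := Γ.exists_pos_le_far ht (half_pos hr)
    refine ⟨δ, hδ, fun τ hτ h0 => hfar τ hτ ?_⟩
    by_contra! hlt
    refine h0 ?_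
    have h2 : χ τ = 1 := χ.one_of_mem_closedBall
      (by rw [Metric.mem_closedBall, Real.dist_eq]; exact hlt.le)
    simp [h2]
  · funext τ; ring

/-- The potential converges absolutely at interior points of the arc, and it is the limit of the
potential along the normal. -/
lemma layer_tendsto (hK : WeaklySingular K) (ht : t ∈ Ioo (-1 : ℝ) 1)
    (hi : IntervalIntegrable θ volume (-1) 1) (hθ : ContDiffOn ℝ 1 θ (Ioo (-1) 1)) :
    Γ.LayerIntegrable K θ (Γ.param t) ∧
      Tendsto (fun ε : ℝ => Γ.layer K θ (Γ.param t + ε • Γ.normal t)) (𝓝[≠] 0)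
        (𝓝 (Γ.layer K θ (Γ.param t))) := by
  obtain ⟨r, hr, c, hc, hsub, hlow⟩ := Γ.exists_local_bound ht
  obtain ⟨θ₁, θ₂, h1, hs, h2, ha, rfl⟩ := Γ.exists_split ht hi hθ hr hsub
  obtain ⟨n1, n2, -⟩ := near_limit hK hr hc hsub hlow h1 hs
  have i1 := n1 0 (by simp)
  rw [zero_smul, add_zero] at i1
  have i2 := layerIntegrable_of_awayFrom hK.smooth h2 ha
  have hz : Tendsto (fun ε : ℝ => Γ.param t + ε • Γ.normal t) (𝓝 0) (𝓝 (Γ.param t)) := by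
    have : Continuous fun ε : ℝ => Γ.param t + ε • Γ.normal t := by fun_prop
    simpa using this.tendsto 0
  refine ⟨(i1.add i2).congr fun τ _ => by simp only [mul_add], ?_⟩
  rw [layer_add_density i1 i2]
  have hlim := (n2.add
    (((layer_hasFDerivAt hK.smooth h2 ha).1.continuousAt.tendsto).comp hz)).mono_left
    (nhdsWithin_le_nhds (s := {0}ᶜ))
  refine hlim.congr' ?_
  filter_upwards [Γ.eventually_notMem_carrier ht] with ε hε
  rw [layer_add_density
    (layerIntegrable_of_awayFrom hK.smooth (h1.continuous.intervalIntegrable _ _)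
      (OpenArc.awayFrom_of_notMem hε _))
    (layerIntegrable_of_awayFrom hK.smooth h2 (OpenArc.awayFrom_of_notMem hε _))]
  rfl

/-- The derivative of a potential in the direction of the velocity, off the arc and away from the
density. -/
lemma layer_hasDerivAt_along (hK : SmoothOff K) (hi : IntervalIntegrable θ volume (-1) 1)
    (ht : t ∈ Ioo (-1 : ℝ) 1) (p : Plane) (hz : Γ.AwayFrom θ (Γ.param t + p)) :
    HasDerivAt (fun s => Γ.layer K θ (Γ.param s + p))
      ((Γ.velocity t 0 : ℂ) * Γ.layer (pd 0 K) θ (Γ.param t + p)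
        + (Γ.velocity t 1 : ℂ) * Γ.layer (pd 1 K) θ (Γ.param t + p)) t := by
  obtain ⟨h1, h2⟩ := layer_hasFDerivAt hK hi hz
  have h3 := h1.hasFDerivAt.comp_hasDerivAt t ((Γ.hasDerivAt_param ht).add_const p)
  refine h3.congr_deriv ?_
  rw [fderiv_apply_eq_pd, h2, h2]

/-- Absence of a jump for tangential derivatives: the on-arc potential of a weakly singular kernel
is differentiable along the arc, and its derivative is the limit from both sides of the derivative
of the potential in the direction of the velocity. -/
lemma layer_deriv_tendsto (hK : WeaklySingular K) (ht : t ∈ Ioo (-1 : ℝ) 1)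
    (hi : IntervalIntegrable θ volume (-1) 1) (hθ : ContDiffOn ℝ 1 θ (Ioo (-1) 1)) :
    DifferentiableAt ℝ (fun s => Γ.layer K θ (Γ.param s)) t ∧
      Tendsto (fun ε : ℝ =>
        (Γ.velocity t 0 : ℂ) * Γ.layer (pd 0 K) θ (Γ.param t + ε • Γ.normal t)
          + (Γ.velocity t 1 : ℂ) * Γ.layer (pd 1 K) θ (Γ.param t + ε • Γ.normal t)) (𝓝[≠] 0)
        (𝓝 (deriv (fun s => Γ.layer K θ (Γ.param s)) t)) := by
  have hint (s : ℝ) (hs : s ∈ Ioo (-1 : ℝ) 1) := (layer_tendsto (Γ := Γ) hK hs hi hθ).1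
  obtain ⟨r, hr, c, hc, hsub, hlow⟩ := Γ.exists_local_bound ht
  obtain ⟨θ₁, θ₂, h1, hs, h2, ha, rfl⟩ := Γ.exists_split ht hi hθ hr hsub
  obtain ⟨-, -, G, hG, hGd⟩ := near_limit hK hr hc hsub hlow h1 hs
  have hz : Tendsto (fun ε : ℝ => Γ.param t + ε • Γ.normal t) (𝓝 0) (𝓝 (Γ.param t)) := by
    have : Continuous fun ε : ℝ => Γ.param t + ε • Γ.normal t := by fun_prop
    simpa using this.tendsto 0
  have hi1 : IntervalIntegrable θ₁ volume (-1) 1 := h1.continuous.intervalIntegrable _ _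
  have d1 : HasDerivAt (fun s => Γ.layer K θ₁ (Γ.param s)) (G 0) t := by
    simpa using hGd 0 (by simp)
  have d2 := layer_hasDerivAt_along hK.smooth h2 ht 0 (by simpa using ha)
  simp only [add_zero] at d2
  have hev : (fun s => Γ.layer K (fun τ => θ₁ τ + θ₂ τ) (Γ.param s)) =ᶠ[𝓝 t]
      fun s => Γ.layer K θ₁ (Γ.param s) + Γ.layer K θ₂ (Γ.param s) := by
    filter_upwards [Ioo_mem_nhds ht.1 ht.2,
      (Γ.hasDerivAt_param ht).continuousAt.eventually ha.eventually] with s hs has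
    have i2 := layerIntegrable_of_awayFrom hK.smooth h2 has
    have i1 : Γ.LayerIntegrable K θ₁ (Γ.param s) :=
      ((hint s hs).sub i2).congr fun τ _ => by simp only [mul_add, add_sub_cancel_right]
    exact layer_add_density i1 i2
  have d3 := (d1.add d2).congr_of_eventuallyEq hev
  refine ⟨d3.differentiableAt, ?_⟩
  rw [d3.deriv]
  have hfar (j : Fin 2) : Tendsto (fun ε : ℝ => Γ.layer (pd j K) θ₂ (Γ.param t + ε • Γ.normal t))
      (𝓝[≠] 0) (𝓝 (Γ.layer (pd j K) θ₂ (Γ.param t))) :=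
    ((layer_hasFDerivAt (hK.smooth.pd j) h2 ha).1.continuousAt.tendsto.comp hz).mono_left
      nhdsWithin_le_nhds
  have hlim := (hG.mono_left (nhdsWithin_le_nhds (s := {0}ᶜ))).add
    (((hfar 0).const_mul (Γ.velocity t 0 : ℂ)).add ((hfar 1).const_mul (Γ.velocity t 1 : ℂ)))
  refine hlim.congr' ?_
  filter_upwards [Γ.eventually_notMem_carrier ht,
    mem_nhdsWithin_of_mem_nhds (Metric.closedBall_mem_nhds (0 : ℝ) one_pos)] with ε hε hε1
  have hadd (j : Fin 2) := layer_add_density (Γ := Γ)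
    (layerIntegrable_of_awayFrom (hK.smooth.pd j) hi1 (OpenArc.awayFrom_of_notMem hε _))
    (layerIntegrable_of_awayFrom (hK.smooth.pd j) h2 (OpenArc.awayFrom_of_notMem hε _))
  have hGe := (hGd ε (by simpa using hε1)).unique
    (layer_hasDerivAt_along hK.smooth hi1 ht (ε • Γ.normal t) (OpenArc.awayFrom_of_notMem hε _))
  rw [hadd 0, hadd 1, hGe]
  ring

end Limit

/-! ### Densities with an edge weight -/

section Weight

variable {Γ : OpenArc} {w : ℝ → ℝ} {e : ℝ}

lemma endpoint_mem (he : e ∈ ({-1, 1} : Set ℝ)) : e ∈ Icc (-1 : ℝ) 1 := by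
  rcases he with rfl | rfl <;> constructor <;> norm_num

lemma OpenArc.edgeDist_eventually (Γ : OpenArc) (he : e ∈ ({-1, 1} : Set ℝ)) :
    ∀ᶠ t in 𝓝[Icc (-1) 1] e, Γ.edgeDist t = ‖Γ.param t - Γ.param e‖ := by
  have hne : Γ.param (-1) ≠ Γ.param 1 := fun h => by
    have := Γ.injective (by constructor <;> norm_num) (by constructor <;> norm_num) h
    norm_num at this
  have hD : 0 < dist (Γ.param (-1)) (Γ.param 1) := dist_pos.2 hne
  have hc : Tendsto Γ.param (𝓝[Icc (-1) 1] e) (𝓝 (Γ.param e)) :=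
    Γ.continuousOn_param e (endpoint_mem he)
  filter_upwards [Metric.tendsto_nhds.1 hc _ (half_pos hD)] with t ht
  rw [← dist_eq_norm]
  refine le_antisymm ?_ ?_
  · refine Metric.infDist_le_dist_of_mem ?_
    rcases he with rfl | rfl <;> simp
  · refine (Metric.le_infDist ⟨_, mem_insert _ _⟩).2 ?_
    rcases he with rfl | rfl
    · rintro y (rfl | rfl)
      · exact le_rfl
      · linarith [dist_triangle (Γ.param (-1)) (Γ.param t) (Γ.param 1),
          dist_comm (Γ.param t) (Γ.param (-1))]
    · rintro y (rfl | rfl)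
      · linarith [dist_triangle (Γ.param (-1)) (Γ.param t) (Γ.param 1),
          dist_comm (Γ.param t) (Γ.param (-1))]
      · exact le_rfl

lemma OpenArc.IsEdgeWeight.apply_endpoint (hw : Γ.IsEdgeWeight w) (he : e ∈ ({-1, 1} : Set ℝ)) :
    w e = 0 := by
  obtain ⟨g, -, -, hwg⟩ := hw.edge e he
  rw [hwg.self_of_nhdsWithin (endpoint_mem he),
    (Γ.edgeDist_eventually he).self_of_nhdsWithin (endpoint_mem he)]
  simp

lemma OpenArc.IsEdgeWeight.continuousOn (hw : Γ.IsEdgeWeight w) :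
    ContinuousOn w (Icc (-1) 1) := by
  intro t ht
  by_cases hi : t ∈ Ioo (-1 : ℝ) 1
  · exact (hw.smooth.continuousOn.continuousAt (isOpen_Ioo.mem_nhds hi)).continuousWithinAt
  have he : t ∈ ({-1, 1} : Set ℝ) := by
    simp only [mem_Ioo, not_and_or, not_lt] at hi
    rcases hi with h | h
    · exact Or.inl (le_antisymm h ht.1)
    · exact Or.inr (le_antisymm ht.2 h)
  obtain ⟨g, -, hg, hwg⟩ := hw.edge t he
  have hc : ContinuousWithinAt (fun s => √(‖Γ.param s - Γ.param t‖) * g s) (Icc (-1) 1) t :=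
    (((Γ.continuousOn_param t ht).sub continuousWithinAt_const).norm.sqrt).mul
      hg.continuousWithinAt
  refine hc.congr_of_eventuallyEq ?_ ?_
  · filter_upwards [hwg, Γ.edgeDist_eventually he] with s h1 h2
    rw [h1, h2]
  · rw [hw.apply_endpoint he]; simp

/-- The derivative of an edge weight is `O(|t - e|^(-1/2))` at an endpoint `e`. -/
lemma OpenArc.IsEdgeWeight.deriv_bound (hw : Γ.IsEdgeWeight w) (he : e ∈ ({-1, 1} : Set ℝ)) :
    ∃ C : ℝ, 0 ≤ C ∧ ∀ᶠ t in 𝓝[Ioo (-1) 1] e, |deriv w t| ≤ C * |t - e| ^ (-1 / 2 : ℝ) := by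
  obtain ⟨g, -, hg, hwg⟩ := hw.edge e he
  have hem := endpoint_mem he
  have hins : insert e (Icc (-1 : ℝ) 1) = Icc (-1) 1 := insert_eq_of_mem hem
  have hud : UniqueDiffOn ℝ (Icc (-1 : ℝ) 1) := uniqueDiffOn_Icc (by norm_num)
  have hg1 : ContDiffWithinAt ℝ 1 g (Icc (-1) 1) e := hg.of_le (by simp)
  have hgd := hg1.eventually (by simp)
  rw [hins] at hgd
  have hgb := (hg1.fderivWithin_right hud (m := 0) (by simp) hem).continuousWithinAt.norm
  have hgb' := hgb.eventually_lt continuousWithinAt_const (lt_add_one _)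
  have hgc := hg1.continuousWithinAt.norm.eventually_lt continuousWithinAt_const (lt_add_one _)
  set v := Γ.velocity e with hv
  have hv0 : 0 < ‖v‖ := Γ.speed_pos hem
  have hder : HasDerivWithinAt Γ.param v (Icc (-1) 1) e :=
    ((Γ.smooth.differentiableOn (by simp)) e hem).hasDerivWithinAt
  have hlo := (hasDerivWithinAt_iff_isLittleO.1 hder).def (half_pos hv0)
  obtain ⟨V, hV⟩ := isCompact_Icc.exists_bound_of_continuousOn Γ.continuousOn_velocity
  have hV0 : 0 ≤ V := (norm_nonneg _).trans (hV e hem)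
  set G := ‖g e‖ + 1 with hG
  set G' := ‖fderivWithin ℝ g (Icc (-1) 1) e‖ + 1 with hG'
  have hG0 : 0 ≤ G := by positivity
  have hG'0 : 0 ≤ G' := by positivity
  obtain ⟨R, hR⟩ := isCompact_Icc.exists_bound_of_continuousOn
    (Γ.continuousOn_param.sub (continuousOn_const (c := Γ.param e)))
  have hR0 : 0 ≤ R := (norm_nonneg _).trans (hR e hem)
  refine ⟨V / 2 * (‖v‖ / 2) ^ (-1 / 2 : ℝ) * G + √R * G' * 2 ^ (1 / 2 : ℝ), by positivity, ?_⟩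
  have hall := ((((hwg.and (Γ.edgeDist_eventually he)).and hgd).and hgb').and hgc).and hlo
  -- the equality `w = √d g` is needed in a neighbourhood of each nearby interior point
  obtain ⟨δ, hδ, hball⟩ := Metric.mem_nhdsWithin_iff.1 hall
  have hIoo : Ioo (-1 : ℝ) 1 ∩ Metric.ball e δ ∈ 𝓝[Ioo (-1) 1] e :=
    inter_mem self_mem_nhdsWithin (mem_nhdsWithin_of_mem_nhds (Metric.ball_mem_nhds e hδ))
  filter_upwards [hIoo] with t ht
  obtain ⟨⟨⟨⟨⟨-, -⟩, hgdt⟩, hgbt⟩, hgct⟩, hlot⟩ := hball ⟨ht.2, Ioo_subset_Icc_self ht.1⟩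
  have hnhds : Icc (-1 : ℝ) 1 ∈ 𝓝 t := Icc_mem_nhds ht.1.1 ht.1.2
  have hev : w =ᶠ[𝓝 t] fun s => (‖Γ.param s - Γ.param e‖ ^ 2) ^ (1 / 4 : ℝ) * g s := by
    filter_upwards [(isOpen_Ioo.inter Metric.isOpen_ball).mem_nhds ht] with s hs
    obtain ⟨⟨⟨⟨⟨h1, h2⟩, -⟩, -⟩, -⟩, -⟩ := hball ⟨hs.2, Ioo_subset_Icc_self hs.1⟩
    rw [h1, h2, Real.sqrt_eq_rpow, ← Real.rpow_natCast, ← Real.rpow_mul (norm_nonneg _)]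
    norm_num
  set X := Γ.param t - Γ.param e with hX
  have hte : t ≠ e := by
    rintro rfl
    rcases he with h | h
    · exact absurd ht.1.1 (by rw [h]; simp)
    · rw [mem_singleton_iff] at h
      exact absurd ht.1.2 (by rw [h]; simp)
  have hte0 : 0 < |t - e| := abs_pos.2 (sub_ne_zero.2 hte)
  have hXlow : ‖v‖ / 2 * |t - e| ≤ ‖X‖ := by
    have h1 : ‖X - (t - e) • v‖ ≤ ‖v‖ / 2 * |t - e| := by simpa using hlot
    have h2 : ‖(t - e) • v‖ ≤ ‖X‖ + ‖X - (t - e) • v‖ := by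
      have := norm_sub_le X (X - (t - e) • v)
      rwa [sub_sub_cancel] at this
    rw [norm_smul, Real.norm_eq_abs] at h2
    nlinarith
  have hX0 : 0 < ‖X‖ := lt_of_lt_of_le (by positivity) hXlow
  have hq0 : ‖X‖ ^ 2 ≠ 0 := by positivity
  have d1 := ((Γ.hasDerivAt_param ht.1).sub_const (Γ.param e)).norm_sq
  have d2 := d1.rpow_const (p := 1 / 4) (Or.inl hq0)
  have hgdiff : DifferentiableAt ℝ g t :=
    (hgdt.differentiableWithinAt (by simp)).differentiableAt hnhds
  have d3 := d2.mul hgdiff.hasDerivAt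
  have hdw : deriv w t = _ := hev.deriv_eq.trans d3.deriv
  rw [hdw]
  have hpow1 : (‖X‖ ^ 2) ^ (1 / 4 - 1 : ℝ) = ‖X‖ ^ (-3 / 2 : ℝ) := by
    rw [← Real.rpow_natCast, ← Real.rpow_mul (norm_nonneg _)]; norm_num
  have hpow2 : (‖X‖ ^ 2) ^ (1 / 4 : ℝ) = √‖X‖ := by
    rw [Real.sqrt_eq_rpow, ← Real.rpow_natCast, ← Real.rpow_mul (norm_nonneg _)]; norm_num
  have hb1 : |2 * inner ℝ X (Γ.velocity t) * (1 / 4) * ‖X‖ ^ (-3 / 2 : ℝ)|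
      ≤ V / 2 * (‖v‖ / 2) ^ (-1 / 2 : ℝ) * |t - e| ^ (-1 / 2 : ℝ) := by
    have h1 : |inner ℝ X (Γ.velocity t)| ≤ ‖X‖ * V :=
      (abs_real_inner_le_norm _ _).trans (by gcongr; exact hV t (Ioo_subset_Icc_self ht.1))
    have h2 : ‖X‖ * ‖X‖ ^ (-3 / 2 : ℝ) = ‖X‖ ^ (-1 / 2 : ℝ) := by
      rw [mul_comm, ← Real.rpow_add_one hX0.ne']; norm_num
    have h3 : ‖X‖ ^ (-1 / 2 : ℝ) ≤ (‖v‖ / 2) ^ (-1 / 2 : ℝ) * |t - e| ^ (-1 / 2 : ℝ) := by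
      rw [← Real.mul_rpow (by positivity) hte0.le]
      exact Real.rpow_le_rpow_of_nonpos (by positivity) hXlow (by norm_num)
    rw [abs_mul, abs_mul, abs_mul, abs_of_pos (Real.rpow_pos_of_pos hX0 _),
      abs_of_pos (by norm_num : (0 : ℝ) < 2), abs_of_pos (by norm_num : (0 : ℝ) < 1 / 4)]
    calc 2 * |inner ℝ X (Γ.velocity t)| * (1 / 4) * ‖X‖ ^ (-3 / 2 : ℝ)
        ≤ 2 * (‖X‖ * V) * (1 / 4) * ‖X‖ ^ (-3 / 2 : ℝ) := by gcongr
      _ = V / 2 * (‖X‖ * ‖X‖ ^ (-3 / 2 : ℝ)) := by ring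
      _ ≤ V / 2 * ((‖v‖ / 2) ^ (-1 / 2 : ℝ) * |t - e| ^ (-1 / 2 : ℝ)) := by
          rw [h2]; gcongr
      _ = _ := by ring
  have hb2 : |deriv g t| ≤ G' := by
    rw [fderivWithin_of_mem_nhds hnhds, ← norm_deriv_eq_norm_fderiv] at hgbt
    exact hgbt.le
  have hb3 : |g t| ≤ G := hgct.le
  have hb4 : 1 ≤ 2 ^ (1 / 2 : ℝ) * |t - e| ^ (-1 / 2 : ℝ) := by
    have h1 : |t - e| ≤ 2 := by
      rw [abs_le]
      constructor <;> linarith [hem.1, hem.2, ht.1.1, ht.1.2]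
    calc (1 : ℝ) = |t - e| ^ (1 / 2 : ℝ) * |t - e| ^ (-1 / 2 : ℝ) := by
          rw [← Real.rpow_add hte0]; norm_num
      _ ≤ _ := by gcongr
  have hb5 : √‖X‖ ≤ √R := Real.sqrt_le_sqrt (hR t (Ioo_subset_Icc_self ht.1))
  rw [hpow1, hpow2]
  calc |2 * inner ℝ X (Γ.velocity t) * (1 / 4) * ‖X‖ ^ (-3 / 2 : ℝ) * g t + √‖X‖ * deriv g t|
      ≤ |2 * inner ℝ X (Γ.velocity t) * (1 / 4) * ‖X‖ ^ (-3 / 2 : ℝ)| * |g t|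
        + √‖X‖ * |deriv g t| := by
        refine (abs_add_le _ _).trans ?_
        rw [abs_mul, abs_mul (√‖X‖), abs_of_nonneg (Real.sqrt_nonneg _)]
    _ ≤ (V / 2 * (‖v‖ / 2) ^ (-1 / 2 : ℝ) * |t - e| ^ (-1 / 2 : ℝ)) * G
        + (√R * G') * (2 ^ (1 / 2 : ℝ) * |t - e| ^ (-1 / 2 : ℝ)) := by
        refine add_le_add (by gcongr) ?_
        exact (mul_le_mul hb5 hb2 (abs_nonneg _) (Real.sqrt_nonneg _)).trans
          (le_mul_of_one_le_right (by positivity) hb4)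
    _ = _ := by ring

/-- A function that is continuous in the open interval and `O(|t - e|^(-1/2))` at its endpoints
is integrable. -/
lemma intervalIntegrable_of_endpoint_bound {f : ℝ → ℝ} (hf : ContinuousOn f (Ioo (-1) 1))
    (hb : ∀ e ∈ ({-1, 1} : Set ℝ), ∃ C : ℝ, 0 ≤ C ∧
      ∀ᶠ t in 𝓝[Ioo (-1) 1] e, |f t| ≤ C * |t - e| ^ (-1 / 2 : ℝ)) :
    IntervalIntegrable f volume (-1) 1 := by
  obtain ⟨C₁, hC₁, h₁⟩ := hb (-1) (by simp)
  obtain ⟨C₂, hC₂, h₂⟩ := hb 1 (by simp)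
  obtain ⟨δ₁, hδ₁, h₁⟩ := Metric.mem_nhdsWithin_iff.1 h₁
  obtain ⟨δ₂, hδ₂, h₂⟩ := Metric.mem_nhdsWithin_iff.1 h₂
  obtain ⟨C₃, h₃⟩ :=
    (isCompact_Icc (a := -1 + δ₁ / 2) (b := 1 - δ₂ / 2)).exists_bound_of_continuousOn
    (hf.mono fun t ht => ⟨by linarith [ht.1], by linarith [ht.2]⟩)
  have habs (e : ℝ) :
      IntervalIntegrable (fun t => |t - e| ^ (-1 / 2 : ℝ)) volume (-3 + e) (3 + e) :=
    (intervalIntegrable_abs_rpow 3).comp_sub_right e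
  have i1 : IntervalIntegrable (fun t => C₁ * |t - -1| ^ (-1 / 2 : ℝ)) volume (-1) 1 :=
    ((habs (-1)).mono_set (by
      rw [uIcc_of_le (by norm_num), uIcc_of_le (by norm_num)]
      exact Icc_subset_Icc (by norm_num) (by norm_num))).const_mul _
  have i2 : IntervalIntegrable (fun t => C₂ * |t - 1| ^ (-1 / 2 : ℝ)) volume (-1) 1 :=
    ((habs 1).mono_set (by
      rw [uIcc_of_le (by norm_num), uIcc_of_le (by norm_num)]
      exact Icc_subset_Icc (by norm_num) (by norm_num))).const_mul _
  have i3 : IntervalIntegrable (fun _ : ℝ => max C₃ 0) volume (-1) 1 := intervalIntegrable_const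
  have hr : volume.restrict (uIoc (-1 : ℝ) 1) = volume.restrict (Ioo (-1) 1) := by
    rw [uIoc_of_le (by norm_num)]
    exact (Measure.restrict_congr_set Ioo_ae_eq_Ioc).symm
  refine ((i1.add i2).add i3).mono_fun ?_ ?_
  · rw [hr]; exact hf.aestronglyMeasurable measurableSet_Ioo
  · rw [hr]
    refine (ae_restrict_iff' measurableSet_Ioo).2 (ae_of_all _ fun t ht => ?_)
    have p1 : 0 ≤ C₁ * |t - -1| ^ (-1 / 2 : ℝ) := by positivity
    have p2 : 0 ≤ C₂ * |t - 1| ^ (-1 / 2 : ℝ) := by positivity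
    have p3 : 0 ≤ max C₃ 0 := le_max_right _ _
    beta_reduce
    rw [Real.norm_eq_abs, Real.norm_eq_abs]
    refine le_trans ?_ (le_abs_self _)
    by_cases ht1 : t < -1 + δ₁ / 2
    · have := h₁
        ⟨by rw [Metric.mem_ball, Real.dist_eq, abs_lt]; constructor <;> linarith [ht.1], ht⟩
      have h4 : |f t| ≤ C₁ * |t - -1| ^ (-1 / 2 : ℝ) := this
      linarith
    · by_cases ht2 : 1 - δ₂ / 2 < t
      · have := h₂ ⟨by rw [Metric.mem_ball, Real.dist_eq, abs_lt]; constructor <;> linarith [ht.2],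
          ht⟩
        have h4 : |f t| ≤ C₂ * |t - 1| ^ (-1 / 2 : ℝ) := this
        linarith
      · have h4 := h₃ t ⟨not_lt.1 ht1, not_lt.1 ht2⟩
        rw [Real.norm_eq_abs] at h4
        linarith [le_max_left C₃ 0]

/-- A density that vanishes at the edge, is twice continuously differentiable in the interior and
has an integrable derivative. The derivative may be unbounded at the edge, as for `√(1 - t²)`. -/
structure EdgeDensity (θ : ℝ → ℂ) : Prop where
  continuousOn : ContinuousOn θ (Icc (-1) 1)
  left : θ (-1) = 0
  right : θ 1 = 0
  contDiffOn : ContDiffOn ℝ 2 θ (Ioo (-1) 1)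
  integrable_deriv : IntervalIntegrable (deriv θ) volume (-1) 1

lemma EdgeDensity.contDiffOn_deriv {θ : ℝ → ℂ} (h : EdgeDensity θ) :
    ContDiffOn ℝ 1 (deriv θ) (Ioo (-1) 1) :=
  h.contDiffOn.deriv_of_isOpen isOpen_Ioo (by norm_num)

lemma EdgeDensity.differentiableAt {θ : ℝ → ℂ} (h : EdgeDensity θ) {t : ℝ}
    (ht : t ∈ Ioo (-1 : ℝ) 1) : DifferentiableAt ℝ θ t :=
  (h.contDiffOn.contDiffAt (isOpen_Ioo.mem_nhds ht)).differentiableAt (by norm_num)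

lemma edgeDensity_weighted {u : ℝ → CVec} (hw : Γ.IsEdgeWeight w)
    (hu : ContDiffOn ℝ 2 u (Icc (-1) 1)) (j : Fin 2) : EdgeDensity fun t => weighted w u t j := by
  have huj : ContDiffOn ℝ 2 (fun t => u t j) (Icc (-1) 1) := contDiffOn_pi.1 hu j
  have hfun : (fun t => weighted w u t j) = fun t => (w t : ℂ) * u t j := by
    funext t; simp [weighted]
  have hud : UniqueDiffOn ℝ (Icc (-1 : ℝ) 1) := uniqueDiffOn_Icc (by norm_num)
  have huI : uIcc (-1 : ℝ) 1 = Icc (-1) 1 := uIcc_of_le (by norm_num)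
  have hwc : ContinuousOn (fun t => (w t : ℂ)) (Icc (-1) 1) :=
    Complex.continuous_ofReal.comp_continuousOn hw.continuousOn
  have hw2 : ContDiffOn ℝ 2 (fun t => (w t : ℂ)) (Ioo (-1) 1) :=
    Complex.ofRealCLM.contDiff.comp_contDiffOn (hw.smooth.of_le (WithTop.coe_le_coe.2 le_top))
  rw [hfun]
  refine ⟨hwc.mul huj.continuousOn, ?_, ?_, hw2.mul (huj.mono Ioo_subset_Icc_self), ?_⟩
  · rw [hw.apply_endpoint (by simp)]; simp
  · rw [hw.apply_endpoint (by simp)]; simp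
  · have hdw : IntervalIntegrable (deriv w) volume (-1) 1 :=
      intervalIntegrable_of_endpoint_bound
        ((hw.smooth.deriv_of_isOpen (m := 0) isOpen_Ioo (by simp)).continuousOn)
        fun e he => hw.deriv_bound he
    have hdw' : IntervalIntegrable (fun t => ((deriv w t : ℝ) : ℂ)) volume (-1) 1 :=
      ⟨hdw.1.ofReal, hdw.2.ofReal⟩
    have i1 : IntervalIntegrable (fun t => ((deriv w t : ℝ) : ℂ) * u t j) volume (-1) 1 :=
      hdw'.mul_continuousOn (by rw [huI]; exact huj.continuousOn)
    have i2 : IntervalIntegrable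
        (fun t => (w t : ℂ) * derivWithin (fun t => u t j) (Icc (-1) 1) t) volume (-1) 1 := by
      refine ContinuousOn.intervalIntegrable ?_
      rw [huI]
      exact hwc.mul ((huj.derivWithin hud (m := 1) (by norm_num)).continuousOn)
    refine (i1.add i2).congr_ae ?_
    rw [uIoc_of_le (by norm_num), ← Measure.restrict_congr_set Ioo_ae_eq_Ioc]
    refine (ae_restrict_iff' measurableSet_Ioo).2 (ae_of_all _ fun t ht => ?_)
    have hn : Icc (-1 : ℝ) 1 ∈ 𝓝 t := Icc_mem_nhds ht.1 ht.2
    have d1 : HasDerivAt (fun t => (w t : ℂ)) ((deriv w t : ℝ) : ℂ) t :=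
      (((hw.smooth.contDiffAt (isOpen_Ioo.mem_nhds ht)).differentiableAt
        (by simp)).hasDerivAt).ofReal_comp
    have d2 : HasDerivAt (fun t => u t j) (derivWithin (fun t => u t j) (Icc (-1) 1) t) t :=
      ((huj.differentiableOn (by norm_num)) t
        (Ioo_subset_Icc_self ht)).hasDerivWithinAt.hasDerivAt hn
    exact (d1.mul d2).deriv.symm

end Weight

/-! ### The double-layer potential off the arc -/

section Kernels

variable (m : ElasticMedium) {v : Plane}

lemma tensorKernel_symm (hv : v ≠ 0) (i j : Fin 2) :
    tensorKernel m i j v = tensorKernel m j i v := by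
  rw [tensorKernel, tensorKernel, (smoothOff_diffKernel m).pd_comm hv i j]
  simp only [eq_comm]

lemma pd_tensorKernel (hv : v ≠ 0) (a i j : Fin 2) :
    pd a (tensorKernel m i j) v
      = ((1 / m.mu : ℝ) : ℂ) * (if i = j then 1 else 0) * pd a (helmholtzKernel m.kS) v
        + ((1 / m.rhoOmegaSq : ℝ) : ℂ) * pd a (pd i (pd j (diffKernel m))) v := by
  have h1 := (smoothOff_helmholtzKernel m.kS_pos).differentiableAt hv
  have h2 := (((smoothOff_diffKernel m).pd j).pd i).differentiableAt hv
  have : tensorKernel m i j = fun v => ((1 / m.mu : ℝ) : ℂ) * (if i = j then 1 else 0)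
      * helmholtzKernel m.kS v
    + ((1 / m.rhoOmegaSq : ℝ) : ℂ) * pd i (pd j (diffKernel m)) v := rfl
  rw [this, pd_add (h1.const_mul _) (h2.const_mul _), pd_const_mul _ h1, pd_const_mul _ h2]

lemma pd_diffKernel (hv : v ≠ 0) (i : Fin 2) :
    pd i (diffKernel m) v = pd i (helmholtzKernel m.kS) v - pd i (helmholtzKernel m.kP) v :=
  pd_sub ((smoothOff_helmholtzKernel m.kS_pos).differentiableAt hv)
    ((smoothOff_helmholtzKernel m.kP_pos).differentiableAt hv)

lemma pd_pd_diffKernel (hv : v ≠ 0) (i j : Fin 2) :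
    pd i (pd j (diffKernel m)) v
      = pd i (pd j (helmholtzKernel m.kS)) v - pd i (pd j (helmholtzKernel m.kP)) v := by
  rw [pd_congr_off (fun w hw => pd_diffKernel m hw j) hv,
    pd_sub (((smoothOff_helmholtzKernel m.kS_pos).pd j).differentiableAt hv)
      (((smoothOff_helmholtzKernel m.kP_pos).pd j).differentiableAt hv)]

lemma laplacian_diffKernel (hv : v ≠ 0) :
    pd 0 (pd 0 (diffKernel m)) v + pd 1 (pd 1 (diffKernel m)) v
      = -(m.kS : ℂ) ^ 2 * helmholtzKernel m.kS v + (m.kP : ℂ) ^ 2 * helmholtzKernel m.kP v := by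
  rw [pd_pd_diffKernel m hv, pd_pd_diffKernel m hv]
  linear_combination laplacian_helmholtzKernel m.kS_pos hv - laplacian_helmholtzKernel m.kP_pos hv

/-- The divergence of a column of the fundamental tensor. -/
lemma div_tensorKernel (hv : v ≠ 0) (j : Fin 2) :
    pd 0 (tensorKernel m 0 j) v + pd 1 (tensorKernel m 1 j) v
      = ((1 / (m.lam + 2 * m.mu) : ℝ) : ℂ) * pd j (helmholtzKernel m.kP) v := by
  have hG := smoothOff_diffKernel m
  have hs := (smoothOff_helmholtzKernel m.kS_pos).differentiableAt hv
  have hp := (smoothOff_helmholtzKernel m.kP_pos).differentiableAt hv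
  have hc (a : Fin 2) : pd a (pd a (pd j (diffKernel m))) v
      = pd j (pd a (pd a (diffKernel m))) v := by
    rw [pd_congr_off (fun w hw => hG.pd_comm hw a j) hv, (hG.pd a).pd_comm hv]
  have hL : pd j (pd 0 (pd 0 (diffKernel m))) v + pd j (pd 1 (pd 1 (diffKernel m))) v
      = -(m.kS : ℂ) ^ 2 * pd j (helmholtzKernel m.kS) v
        + (m.kP : ℂ) ^ 2 * pd j (helmholtzKernel m.kP) v := by
    rw [← pd_add (((hG.pd 0).pd 0).differentiableAt hv) (((hG.pd 1).pd 1).differentiableAt hv),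
      pd_congr_off (fun w hw => laplacian_diffKernel m hw) hv,
      pd_add (hs.const_mul _) (hp.const_mul _), pd_const_mul _ hs, pd_const_mul _ hp]
  have e1 : ((1 / m.rhoOmegaSq : ℝ) : ℂ) * (m.kS : ℂ) ^ 2 = ((1 / m.mu : ℝ) : ℂ) := by
    have h := m.rhoOmegaSq_pos.ne'
    have h' := m.mu_pos.ne'
    have : 1 / m.rhoOmegaSq * m.kS ^ 2 = 1 / m.mu := by
      field_simp; linarith [m.mu_mul_kS_sq]
    exact_mod_cast this
  have e2 : ((1 / m.rhoOmegaSq : ℝ) : ℂ) * (m.kP : ℂ) ^ 2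
      = ((1 / (m.lam + 2 * m.mu) : ℝ) : ℂ) := by
    have h := m.rhoOmegaSq_pos.ne'
    have h' := m.lam_add_two_mu_pos.ne'
    have : 1 / m.rhoOmegaSq * m.kP ^ 2 = 1 / (m.lam + 2 * m.mu) := by
      field_simp; linarith [m.mul_kP_sq]
    exact_mod_cast this
  rw [pd_tensorKernel m hv, pd_tensorKernel m hv, hc, hc, ← e1, ← e2]
  fin_cases j
  · simp only [Fin.zero_eta, if_true, one_ne_zero, if_false] at hL ⊢
    linear_combination ((1 / m.rhoOmegaSq : ℝ) : ℂ) * hL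
  · simp only [Fin.mk_one, if_true, zero_ne_one, if_false] at hL ⊢
    linear_combination ((1 / m.rhoOmegaSq : ℝ) : ℂ) * hL

/-- The sign in the rotation by a right angle: `(A v)_i = -sgn i · v_(1-i)`. -/
noncomputable def sgn (i : Fin 2) : ℂ := if i = 0 then 1 else -1

/-- The curl of a column of the fundamental tensor. -/
lemma curl_tensorKernel (hv : v ≠ 0) (j : Fin 2) :
    pd 0 (tensorKernel m 1 j) v - pd 1 (tensorKernel m 0 j) v
      = -sgn j * ((1 / m.mu : ℝ) : ℂ) * pd (1 - j) (helmholtzKernel m.kS) v := by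
  rw [pd_tensorKernel m hv, pd_tensorKernel m hv, ((smoothOff_diffKernel m).pd j).pd_comm hv 0 1]
  fin_cases j
  · simp [sgn]
  · simp [sgn]

end Kernels

section DoubleLayer

variable {Γ : OpenArc}

/-- Componentwise evaluation of an integral along the arc as a combination of potentials. -/
lemma OpenArc.integral_eq_sum_layer {ι : Type*} [Fintype ι] {f : ℝ → CVec} {z : Plane}
    {c : Fin 2 → ι → ℂ} {K : Fin 2 → ι → Plane → ℂ} {θ : Fin 2 → ι → ℝ → ℂ}
    (hint : ∀ i k, Γ.LayerIntegrable (K i k) (θ i k) z)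
    (hf : ∀ τ ∈ Ioo (-1 : ℝ) 1, ∀ i, (Γ.speed τ : ℂ) * f τ i
      = ∑ k, c i k * (K i k (z - Γ.param τ) * θ i k τ)) :
    Γ.IsIntegrable f ∧ ∀ i, Γ.integral f i = ∑ k, c i k * Γ.layer (K i k) (θ i k) z := by
  have hsum (i : Fin 2) : IntervalIntegrable
      (fun τ => ∑ k, c i k * (K i k (z - Γ.param τ) * θ i k τ)) volume (-1) 1 := by
    have := IntervalIntegrable.sum Finset.univ
      (f := fun k τ => c i k * (K i k (z - Γ.param τ) * θ i k τ))
      (μ := volume) (a := -1) (b := 1) fun k _ => (hint i k).const_mul (c i k)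
    refine this.congr fun τ _ => ?_
    simp
  have hae (i : Fin 2) : (fun τ => ∑ k, c i k * (K i k (z - Γ.param τ) * θ i k τ))
      =ᵐ[volume.restrict (uIoc (-1) 1)] fun τ => (Γ.speed τ • f τ) i := by
    rw [uIoc_neg_one_one, ← Measure.restrict_congr_set Ioo_ae_eq_Ioc]
    refine (ae_restrict_iff' measurableSet_Ioo).2 (ae_of_all _ fun τ hτ => ?_)
    beta_reduce
    rw [← hf τ hτ i]
    simp
  have hi (i : Fin 2) : IntervalIntegrable (fun τ => (Γ.speed τ • f τ) i) volume (-1) 1 :=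
    (hsum i).congr_ae (hae i)
  refine ⟨⟨Integrable.of_eval fun i => (hi i).1, Integrable.of_eval fun i => (hi i).2⟩,
    fun i => ?_⟩
  rw [OpenArc.integral, intervalIntegral.integral_of_le (by norm_num),
    eval_integral fun i => (hi i).1]
  have h1 := intervalIntegral.integral_congr_ae_restrict (hae i)
  rw [intervalIntegral.integral_of_le (by norm_num) (f := fun τ => (Γ.speed τ • f τ) i)] at h1
  rw [← h1, intervalIntegral.integral_finsetSum fun k _ => (hint i k).const_mul (c i k)]
  refine Finset.sum_congr rfl fun k _ => ?_
  rw [intervalIntegral.integral_const_mul, OpenArc.layer]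

variable (Γ)

/-- The density `x'_a ψ_j`. -/
noncomputable def OpenArc.velDensity (ψ : ℝ → CVec) (a j : Fin 2) (τ : ℝ) : ℂ :=
  (Γ.velocity τ a : ℂ) * ψ τ j

/-- The density `|x'| ν · ψ`. -/
noncomputable def OpenArc.normalDensity (ψ : ℝ → CVec) (τ : ℝ) : ℂ :=
  Γ.velDensity ψ 1 0 τ - Γ.velDensity ψ 0 1 τ

/-- The density `x' · ψ`. -/
noncomputable def OpenArc.tangentDensity (ψ : ℝ → CVec) (τ : ℝ) : ℂ :=
  Γ.velDensity ψ 0 0 τ + Γ.velDensity ψ 1 1 τ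

variable {Γ}

lemma OpenArc.normalC_eq (Γ : OpenArc) (t : ℝ) (a : Fin 2) :
    Γ.normalC t a = sgn a * (Γ.velocity t (1 - a) : ℂ) / (Γ.speed t : ℂ) := by
  fin_cases a
  · simp [OpenArc.normalC, OpenArc.normal, sgn]
  · simp [OpenArc.normalC, OpenArc.normal, sgn, neg_div]

variable {ψ : ℝ → CVec}

lemma continuousOn_velDensity (hψ : ∀ j, EdgeDensity fun τ => ψ τ j) (a j : Fin 2) :
    ContinuousOn (Γ.velDensity ψ a j) (Icc (-1) 1) :=
  ((contDiff_coord a).continuous.comp_continuousOn Γ.continuousOn_velocity).mul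
    (hψ j).continuousOn

lemma contDiffOn_velDensity (hψ : ∀ j, EdgeDensity fun τ => ψ τ j) (a j : Fin 2) :
    ContDiffOn ℝ 1 (Γ.velDensity ψ a j) (Ioo (-1) 1) :=
  (((contDiff_coord a).comp_contDiffOn
    (Γ.contDiffOn_velocity.mono Ioo_subset_Icc_self)).of_le (by simp)).mul
    ((hψ j).contDiffOn.of_le (by norm_num))

end DoubleLayer

section DoubleLayer

variable {Γ : OpenArc} {ψ : ℝ → CVec}

lemma contDiffOn_normalDensity (hψ : ∀ j, EdgeDensity fun τ => ψ τ j) :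
    ContDiffOn ℝ 1 (Γ.normalDensity ψ) (Ioo (-1) 1) :=
  (contDiffOn_velDensity hψ 1 0).sub (contDiffOn_velDensity hψ 0 1)

lemma intervalIntegrable_velDensity (hψ : ∀ j, EdgeDensity fun τ => ψ τ j) (a j : Fin 2) :
    IntervalIntegrable (Γ.velDensity ψ a j) volume (-1) 1 :=
  ContinuousOn.intervalIntegrable (by
    rw [uIcc_of_le (by norm_num)]; exact continuousOn_velDensity hψ a j)

lemma intervalIntegrable_normalDensity (hψ : ∀ j, EdgeDensity fun τ => ψ τ j) :
    IntervalIntegrable (Γ.normalDensity ψ) volume (-1) 1 :=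
  (intervalIntegrable_velDensity hψ 1 0).sub (intervalIntegrable_velDensity hψ 0 1)

lemma intervalIntegrable_tangentDensity (hψ : ∀ j, EdgeDensity fun τ => ψ τ j) :
    IntervalIntegrable (Γ.tangentDensity ψ) volume (-1) 1 :=
  (intervalIntegrable_velDensity hψ 0 0).add (intervalIntegrable_velDensity hψ 1 1)

variable (m : ElasticMedium)

/-- The kernels of the double-layer potential after the splitting of the traction into a
tangential derivative, a divergence and a curl. -/
noncomputable def dlKernel (i : Fin 2) : Fin 6 → Plane → ℂ :=
  ![pd 0 (tensorKernel m i 0), pd 1 (tensorKernel m i 0), pd 0 (tensorKernel m i 1),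
    pd 1 (tensorKernel m i 1), pd i (helmholtzKernel m.kP), pd (1 - i) (helmholtzKernel m.kS)]

/-- The densities that belong to `dlKernel`. -/
noncomputable def dlDensity (Γ : OpenArc) (ψ : ℝ → CVec) : Fin 6 → ℝ → ℂ :=
  ![Γ.velDensity ψ 0 1, Γ.velDensity ψ 1 1, Γ.velDensity ψ 0 0, Γ.velDensity ψ 1 0,
    Γ.normalDensity ψ, Γ.tangentDensity ψ]

/-- The coefficients that belong to `dlKernel`; `M` stands for `μ + μ̃`. -/
noncomputable def dlCoeff (M : ℂ) (i : Fin 2) : Fin 6 → ℂ := ![-M, -M, M, M, -1, sgn i]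

lemma smoothOff_dlKernel (i : Fin 2) (k : Fin 6) : SmoothOff (dlKernel m i k) := by
  have hS := smoothOff_helmholtzKernel m.kS_pos
  have hP := smoothOff_helmholtzKernel m.kP_pos
  fin_cases k
  · exact (smoothOff_tensorKernel m i 0).pd 0
  · exact (smoothOff_tensorKernel m i 0).pd 1
  · exact (smoothOff_tensorKernel m i 1).pd 0
  · exact (smoothOff_tensorKernel m i 1).pd 1
  · exact hP.pd i
  · exact hS.pd (1 - i)

lemma intervalIntegrable_dlDensity (hψ : ∀ j, EdgeDensity fun τ => ψ τ j) (k : Fin 6) :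
    IntervalIntegrable (dlDensity Γ ψ k) volume (-1) 1 := by
  fin_cases k
  · exact intervalIntegrable_velDensity hψ 0 1
  · exact intervalIntegrable_velDensity hψ 1 1
  · exact intervalIntegrable_velDensity hψ 0 0
  · exact intervalIntegrable_velDensity hψ 1 0
  · exact intervalIntegrable_normalDensity hψ
  · exact intervalIntegrable_tangentDensity hψ

variable {lamT muT : ℝ}

lemma modTraction_tensorE (ν : Plane) (z y : Plane) (i j : Fin 2) :
    (modTraction m lamT muT).onColumns ν (fun y => tensorE m z y) y i j
      = -(((m.mu + muT : ℝ) : ℂ) * (ν 0 * pd 0 (tensorKernel m i j) (z - y)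
          + ν 1 * pd 1 (tensorKernel m i j) (z - y))
        + (lamT : ℂ) * (ν i * (pd 0 (tensorKernel m 0 j) (z - y)
          + pd 1 (tensorKernel m 1 j) (z - y)))
        + (muT : ℂ) * (sgn i * ν (1 - i) * (pd 0 (tensorKernel m 1 j) (z - y)
          - pd 1 (tensorKernel m 0 j) (z - y)))) := by
  simp only [TractionOp.onColumns, Matrix.of_apply, modTraction, normalDeriv, normalDiv, normalCurl,
    curl, tensorE_eq, pd_comp_const_sub, Pi.add_apply, Pi.smul_apply, smul_eq_mul,
    Fin.sum_univ_two]
  fin_cases i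
  · simp [sgn]; ring
  · simp [sgn]; ring

lemma doubleLayerIntegrand_eq (hT : lamT + muT = m.lam + m.mu) {z : Plane}
    (hz : z ∉ Γ.carrier) {τ : ℝ} (hτ : τ ∈ Icc (-1 : ℝ) 1) (i : Fin 2) :
    (Γ.speed τ : ℂ) * doubleLayerIntegrand m Γ (modTraction m lamT muT) ψ z τ i
      = ∑ k, dlCoeff ((m.mu + muT : ℝ) : ℂ) i k
        * (dlKernel m i k (z - Γ.param τ) * dlDensity Γ ψ k τ) := by
  have hv : z - Γ.param τ ≠ 0 := by
    rw [sub_ne_zero]; rintro rfl; exact hz ⟨τ, hτ, rfl⟩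
  have hs : (Γ.speed τ : ℂ) ≠ 0 := by exact_mod_cast (Γ.speed_pos hτ).ne'
  have hsym (a : Fin 2) : pd a (tensorKernel m 1 0) (z - Γ.param τ)
      = pd a (tensorKernel m 0 1) (z - Γ.param τ) :=
    pd_congr_off (fun w hw => tensorKernel_symm m hw 1 0) hv a
  have k1 (j : Fin 2) := div_tensorKernel m hv j
  have k2 (j : Fin 2) := curl_tensorKernel m hv j
  have n0 : (Γ.normal τ 0 : ℂ) = (Γ.velocity τ 1 : ℂ) / Γ.speed τ := by simp [OpenArc.normal]
  have n1 : (Γ.normal τ 1 : ℂ) = -(Γ.velocity τ 0 : ℂ) / Γ.speed τ := by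
    simp [OpenArc.normal, neg_div]
  have hl : (m.lam : ℂ) = lamT + muT - m.mu := by
    have : m.lam = lamT + muT - m.mu := by linarith
    rw [this]; push_cast; ring
  have hlm : ((lamT : ℂ) + muT + m.mu) ≠ 0 := by
    have h := m.lam_add_two_mu_pos
    have : lamT + muT + m.mu ≠ 0 := by linarith
    exact_mod_cast this
  have hmu : (m.mu : ℂ) ≠ 0 := by exact_mod_cast m.mu_pos.ne'
  have e1 : ((1 / (m.lam + 2 * m.mu) : ℝ) : ℂ) = 1 / ((lamT : ℂ) + muT + m.mu) := by
    push_cast; rw [hl]; ring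
  have e2 : ((1 / m.mu : ℝ) : ℂ) = 1 / (m.mu : ℂ) := by push_cast; rfl
  simp only [doubleLayerIntegrand, Matrix.mulVec, dotProduct, Matrix.transpose_apply,
    Fin.sum_univ_two, modTraction_tensorE, k1, k2, e1, e2]
  fin_cases i
  · have c1 := k1 0
    have c2 := k2 0
    rw [e1] at c1
    rw [e2] at c2
    simp only [Fin.zero_eta, Fin.sum_univ_six, dlCoeff, dlKernel, dlDensity, sgn, n0, n1,
      hsym, OpenArc.normalDensity, OpenArc.tangentDensity, OpenArc.velDensity,
      Matrix.cons_val, sub_zero, sub_self, if_true, one_ne_zero, if_false] at c1 c2 ⊢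
    rw [eq_sub_of_add_eq' c1, eq_add_of_sub_eq c2]
    push_cast
    field_simp
    ring
  · have c1 := k1 1
    have c2 := k2 1
    rw [e1] at c1
    rw [e2] at c2
    simp only [Fin.mk_one, Fin.sum_univ_six, dlCoeff, dlKernel, dlDensity, sgn, n0, n1,
      hsym, OpenArc.normalDensity, OpenArc.tangentDensity, OpenArc.velDensity,
      Matrix.cons_val, sub_zero, sub_self, if_true, one_ne_zero, if_false] at c1 c2 ⊢
    rw [eq_sub_of_add_eq' c1, eq_add_of_sub_eq c2]
    push_cast
    field_simp
    ring

end DoubleLayer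

section Traction

variable {Γ : OpenArc} {ψ : ℝ → CVec} {lamT muT : ℝ} (m : ElasticMedium) {z : Plane}

/-- The componentwise derivative of the density with respect to the parameter. -/
noncomputable def dDensity (ψ : ℝ → CVec) (j : Fin 2) : ℝ → ℂ := deriv fun τ => ψ τ j

/-- The double-layer potential after integration by parts; `M` stands for `μ + μ̃`. -/
noncomputable def regularPotential (m : ElasticMedium) (Γ : OpenArc) (M : ℂ) (ψ : ℝ → CVec)
    (i : Fin 2) (z : Plane) : ℂ :=
  M * (Γ.layer (tensorKernel m i 1) (dDensity ψ 0) z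
      - Γ.layer (tensorKernel m i 0) (dDensity ψ 1) z)
    - Γ.layer (pd i (helmholtzKernel m.kP)) (Γ.normalDensity ψ) z
    + sgn i * Γ.layer (pd (1 - i) (helmholtzKernel m.kS)) (Γ.tangentDensity ψ) z

lemma layer_dDensity (hψ : ∀ j, EdgeDensity fun τ => ψ τ j) {K : Plane → ℂ} (hK : SmoothOff K)
    (hz : z ∉ Γ.carrier) (j : Fin 2) :
    Γ.layer K (dDensity ψ j) z = Γ.layer (pd 0 K) (Γ.velDensity ψ 0 j) z
      + Γ.layer (pd 1 K) (Γ.velDensity ψ 1 j) z :=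
  layer_deriv_density hK hz (hψ j).continuousOn (fun _ hτ => (hψ j).differentiableAt hτ)
    (hψ j).integrable_deriv (hψ j).left (hψ j).right

lemma doubleLayer_integrable (hψ : ∀ j, EdgeDensity fun τ => ψ τ j)
    (hT : lamT + muT = m.lam + m.mu) (hz : z ∉ Γ.carrier) :
    Γ.IsIntegrable (doubleLayerIntegrand m Γ (modTraction m lamT muT) ψ z) ∧
      ∀ i, doubleLayer m Γ (modTraction m lamT muT) ψ z i
        = regularPotential m Γ ((m.mu + muT : ℝ) : ℂ) ψ i z := by
  have h := OpenArc.integral_eq_sum_layer (Γ := Γ)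
    (f := doubleLayerIntegrand m Γ (modTraction m lamT muT) ψ z) (z := z)
    (c := fun i => dlCoeff ((m.mu + muT : ℝ) : ℂ) i) (K := fun i => dlKernel m i)
    (θ := fun _ => dlDensity Γ ψ)
    (fun i k => layerIntegrable_of_awayFrom (smoothOff_dlKernel m i k)
      (intervalIntegrable_dlDensity hψ k) (OpenArc.awayFrom_of_notMem hz _))
    (fun τ hτ i => doubleLayerIntegrand_eq m hT hz (Ioo_subset_Icc_self hτ) i)
  refine ⟨h.1, fun i => ?_⟩
  rw [doubleLayer, h.2 i, regularPotential, layer_dDensity hψ (smoothOff_tensorKernel m i 0) hz,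
    layer_dDensity hψ (smoothOff_tensorKernel m i 1) hz]
  simp only [Fin.sum_univ_six, dlCoeff, dlKernel, dlDensity, Matrix.cons_val]
  ring

/-- The first derivatives of the potential, with the derivatives moved to the kernels. -/
noncomputable def regularPotentialPd (m : ElasticMedium) (Γ : OpenArc) (M : ℂ) (ψ : ℝ → CVec)
    (a i : Fin 2) (z : Plane) : ℂ :=
  M * (Γ.layer (pd a (tensorKernel m i 1)) (dDensity ψ 0) z
      - Γ.layer (pd a (tensorKernel m i 0)) (dDensity ψ 1) z)
    - Γ.layer (pd a (pd i (helmholtzKernel m.kP))) (Γ.normalDensity ψ) z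
    + sgn i * Γ.layer (pd a (pd (1 - i) (helmholtzKernel m.kS))) (Γ.tangentDensity ψ) z

lemma regularPotential_pd (hψ : ∀ j, EdgeDensity fun τ => ψ τ j) (M : ℂ) (hz : z ∉ Γ.carrier)
    (i : Fin 2) : DifferentiableAt ℝ (regularPotential m Γ M ψ i) z ∧
      ∀ a, pd a (regularPotential m Γ M ψ i) z = regularPotentialPd m Γ M ψ a i z := by
  have hS := smoothOff_helmholtzKernel m.kS_pos
  have hP := smoothOff_helmholtzKernel m.kP_pos
  obtain ⟨d1, e1⟩ := layer_hasFDerivAt (smoothOff_tensorKernel m i 1) (hψ 0).integrable_deriv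
    (OpenArc.awayFrom_of_notMem hz _)
  obtain ⟨d2, e2⟩ := layer_hasFDerivAt (smoothOff_tensorKernel m i 0) (hψ 1).integrable_deriv
    (OpenArc.awayFrom_of_notMem hz _)
  obtain ⟨d3, e3⟩ := layer_hasFDerivAt (hP.pd i) (intervalIntegrable_normalDensity (Γ := Γ) hψ)
    (OpenArc.awayFrom_of_notMem hz _)
  obtain ⟨d4, e4⟩ := layer_hasFDerivAt (hS.pd (1 - i))
    (intervalIntegrable_tangentDensity (Γ := Γ) hψ) (OpenArc.awayFrom_of_notMem hz _)
  have d12 := (d1.fun_sub d2).const_mul M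
  refine ⟨(d12.sub d3).add (d4.const_mul (sgn i)), fun a => ?_⟩
  have hfun : regularPotential m Γ M ψ i = fun z =>
    M * (Γ.layer (tensorKernel m i 1) (dDensity ψ 0) z
        - Γ.layer (tensorKernel m i 0) (dDensity ψ 1) z)
      - Γ.layer (pd i (helmholtzKernel m.kP)) (Γ.normalDensity ψ) z
      + sgn i * Γ.layer (pd (1 - i) (helmholtzKernel m.kS)) (Γ.tangentDensity ψ) z := rfl
  have p1 := pd_add (i := a) (d12.fun_sub d3) (d4.const_mul (sgn i))
  have p2 := pd_sub (i := a) d12 d3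
  have p3 := pd_const_mul (i := a) M (d1.fun_sub d2)
  have p4 := pd_sub (i := a) d1 d2
  have p5 := pd_const_mul (i := a) (sgn i) d4
  rw [hfun]
  refine p1.trans ?_
  rw [p5, e4 a]
  refine congrArg (· + _) ?_
  refine p2.trans ?_
  rw [e3 a]
  refine congrArg (· - _) ?_
  refine p3.trans ?_
  refine congrArg (M * ·) ?_
  refine p4.trans ?_
  rw [e1 a, e2 a]
  rfl

lemma eventually_notMem_carrier_nhds (hz : z ∉ Γ.carrier) : ∀ᶠ y in 𝓝 z, y ∉ Γ.carrier :=
  Γ.isCompact_carrier.isClosed.isOpen_compl.mem_nhds hz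

lemma doubleLayer_pd (hψ : ∀ j, EdgeDensity fun τ => ψ τ j) (hT : lamT + muT = m.lam + m.mu)
    (hz : z ∉ Γ.carrier) :
    DifferentiableAt ℝ (doubleLayer m Γ (modTraction m lamT muT) ψ) z ∧
      ∀ a i, pd a (fun y => doubleLayer m Γ (modTraction m lamT muT) ψ y i) z
        = regularPotentialPd m Γ ((m.mu + muT : ℝ) : ℂ) ψ a i z := by
  have hev (i : Fin 2) : (fun y => doubleLayer m Γ (modTraction m lamT muT) ψ y i)
      =ᶠ[𝓝 z] regularPotential m Γ ((m.mu + muT : ℝ) : ℂ) ψ i := by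
    filter_upwards [eventually_notMem_carrier_nhds hz] with y hy
    exact (doubleLayer_integrable m hψ hT hy).2 i
  refine ⟨differentiableAt_pi.2 fun i => ?_, fun a i => ?_⟩
  · exact (regularPotential_pd m hψ _ hz i).1.congr_of_eventuallyEq (hev i)
  · rw [pd, (hev i).fderiv_eq]
    exact (regularPotential_pd m hψ _ hz i).2 a

/-- Linear relations between potentials with a common density, inherited from the kernels. -/
lemma layer_relations {θ : ℝ → ℂ} (hθ : IntervalIntegrable θ volume (-1) 1) (hz : z ∉ Γ.carrier) :
    (∀ j, Γ.layer (pd 0 (tensorKernel m 0 j)) θ z + Γ.layer (pd 1 (tensorKernel m 1 j)) θ z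
      = ((1 / (m.lam + 2 * m.mu) : ℝ) : ℂ) * Γ.layer (pd j (helmholtzKernel m.kP)) θ z) ∧
    (∀ j, Γ.layer (pd 0 (tensorKernel m 1 j)) θ z - Γ.layer (pd 1 (tensorKernel m 0 j)) θ z
      = -sgn j * ((1 / m.mu : ℝ) : ℂ) * Γ.layer (pd (1 - j) (helmholtzKernel m.kS)) θ z) ∧
    (∀ a, Γ.layer (pd a (tensorKernel m 1 0)) θ z = Γ.layer (pd a (tensorKernel m 0 1)) θ z) ∧
    (∀ a, Γ.layer (pd a (diffKernel m)) θ z = Γ.layer (pd a (helmholtzKernel m.kS)) θ z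
      - Γ.layer (pd a (helmholtzKernel m.kP)) θ z) ∧
    (∀ a b, Γ.layer (pd a (pd b (diffKernel m))) θ z
      = Γ.layer (pd a (pd b (helmholtzKernel m.kS))) θ z
        - Γ.layer (pd a (pd b (helmholtzKernel m.kP))) θ z) ∧
    (∀ k > 0, Γ.layer (pd 0 (pd 0 (helmholtzKernel k))) θ z
      + Γ.layer (pd 1 (pd 1 (helmholtzKernel k))) θ z
      = -(k : ℂ) ^ 2 * Γ.layer (helmholtzKernel k) θ z) ∧
    (∀ k > 0, Γ.layer (pd 1 (pd 0 (helmholtzKernel k))) θ z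
      = Γ.layer (pd 0 (pd 1 (helmholtzKernel k))) θ z) := by
  have hS := smoothOff_helmholtzKernel m.kS_pos
  have hP := smoothOff_helmholtzKernel m.kP_pos
  have hE := smoothOff_tensorKernel m
  have hL {K : Plane → ℂ} (hK : SmoothOff K) : Γ.LayerIntegrable K θ z :=
    layerIntegrable_of_awayFrom hK hθ (OpenArc.awayFrom_of_notMem hz _)
  have hsub {K L : Plane → ℂ} (hK : SmoothOff K) (hL' : SmoothOff L) :
      Γ.layer (fun v => K v - L v) θ z = Γ.layer K θ z - Γ.layer L θ z := by
    have h1 := layer_add_kernel (hL hK) (hL (hL'.const_mul (-1)))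
    rw [layer_const_mul_kernel] at h1
    rw [sub_eq_add_neg, ← neg_one_mul, ← h1]
    congr 1; funext v; ring
  refine ⟨fun j => ?_, fun j => ?_, fun a => ?_, fun a => ?_, fun a b => ?_, fun k hk => ?_,
    fun k hk => ?_⟩
  · rw [← layer_add_kernel (hL ((hE 0 j).pd 0)) (hL ((hE 1 j).pd 1)), ← layer_const_mul_kernel]
    exact layer_congr_kernel (fun v hv => div_tensorKernel m hv j) hz
  · rw [← hsub ((hE 1 j).pd 0) ((hE 0 j).pd 1), ← layer_const_mul_kernel]
    exact layer_congr_kernel (fun v hv => curl_tensorKernel m hv j) hz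
  · exact layer_congr_kernel
      (fun v hv => pd_congr_off (fun w hw => tensorKernel_symm m hw 1 0) hv a) hz
  · rw [← hsub (hS.pd a) (hP.pd a)]
    exact layer_congr_kernel (fun v hv => pd_diffKernel m hv a) hz
  · rw [← hsub ((hS.pd b).pd a) ((hP.pd b).pd a)]
    exact layer_congr_kernel (fun v hv => pd_pd_diffKernel m hv a b) hz
  · have hk' := smoothOff_helmholtzKernel hk
    rw [← layer_add_kernel (hL ((hk'.pd 0).pd 0)) (hL ((hk'.pd 1).pd 1)), ← layer_const_mul_kernel]
    exact layer_congr_kernel (fun v hv => laplacian_helmholtzKernel hk hv) hz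
  · exact layer_congr_kernel
      (fun v hv => (smoothOff_helmholtzKernel hk).pd_comm hv 1 0) hz

lemma layer_normalDensity (hψ : ∀ j, EdgeDensity fun τ => ψ τ j) {K : Plane → ℂ}
    (hK : SmoothOff K) (hz : z ∉ Γ.carrier) :
    Γ.layer K (Γ.normalDensity ψ) z
      = Γ.layer K (Γ.velDensity ψ 1 0) z - Γ.layer K (Γ.velDensity ψ 0 1) z := by
  have hL (a j : Fin 2) : Γ.LayerIntegrable K (Γ.velDensity ψ a j) z :=
    layerIntegrable_of_awayFrom hK (intervalIntegrable_velDensity hψ a j)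
      (OpenArc.awayFrom_of_notMem hz _)
  rw [OpenArc.layer, OpenArc.layer, OpenArc.layer,
    ← intervalIntegral.integral_sub (hL 1 0) (hL 0 1)]
  exact intervalIntegral.integral_congr fun τ _ => mul_sub _ _ _

lemma layer_tangentDensity (hψ : ∀ j, EdgeDensity fun τ => ψ τ j) {K : Plane → ℂ}
    (hK : SmoothOff K) (hz : z ∉ Γ.carrier) :
    Γ.layer K (Γ.tangentDensity ψ) z
      = Γ.layer K (Γ.velDensity ψ 0 0) z + Γ.layer K (Γ.velDensity ψ 1 1) z := by
  have hL (a j : Fin 2) : Γ.LayerIntegrable K (Γ.velDensity ψ a j) z :=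
    layerIntegrable_of_awayFrom hK (intervalIntegrable_velDensity hψ a j)
      (OpenArc.awayFrom_of_notMem hz _)
  exact layer_add_density (hL 0 0) (hL 1 1)

end Traction

/-! ### The regularized form of the traction off the arc -/

section Identity

variable (m : ElasticMedium) (Γ : OpenArc) (ψ : ℝ → CVec) (muT t : ℝ)

/-- Coefficients of the undifferentiated part of the regularized expression. The index `(κ, a, j)`
stands for the kernel `γ_{k_s}` (`κ = 0`) or `γ_{k_p}` (`κ = 1`) and for the density
`|x'| ν_a ψ_j`, which equals `sgn a · x'_(1-a) ψ_j`. -/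
noncomputable def coeff1 (i : Fin 2) (p : Fin 2 × Fin 2 × Fin 2) : ℂ :=
  sgn p.2.1 * (if p.1 = 0 then
    (m.rhoOmegaSq : ℂ) * (Γ.normalC t i * (if p.2.1 = p.2.2 then 1 else 0)
        - Γ.normalC t p.2.1 * (if i = p.2.2 then 1 else 0))
      - ((muT * m.kS ^ 2 : ℝ) : ℂ) * ((if p.2.1 = i then 1 else 0) * Γ.normalC t p.2.2
        - Γ.normalC t i * (if p.2.1 = p.2.2 then 1 else 0))
    else -((m.rhoOmegaSq : ℂ) * Γ.normalC t i * (if p.2.1 = p.2.2 then 1 else 0)))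

/-- The kernels that belong to `coeff1`. -/
noncomputable def kernel1 (p : Fin 2 × Fin 2 × Fin 2) : Plane → ℂ :=
  if p.1 = 0 then helmholtzKernel m.kS else helmholtzKernel m.kP

/-- The undifferentiated potential of the regularized expression with the kernels
`γ_{k_s}` and `γ_{k_p}`. -/
noncomputable def potential1 (i : Fin 2) (z : Plane) : ℂ :=
  ∑ p, coeff1 m Γ muT t i p * Γ.layer (kernel1 m p) (Γ.velDensity ψ (1 - p.2.1) p.2.2) z

/-- The potential with the kernel `A E A`. -/
noncomputable def potential2 (i : Fin 2) (z : Plane) : ℂ :=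
  ∑ l, -(sgn i * sgn l) * Γ.layer (tensorKernel m (1 - i) (1 - l)) (dDensity ψ l) z

/-- The potential with the kernel `γ_{k_s}` and the differentiated density. -/
noncomputable def potential3 (i : Fin 2) (z : Plane) : ℂ :=
  Γ.layer (helmholtzKernel m.kS) (dDensity ψ i) z

/-- The potential with the kernel `ν_x ∇ᵀ[γ_{k_s} - γ_{k_p}] A`. -/
noncomputable def potential4 (i : Fin 2) (z : Plane) : ℂ :=
  ∑ k, Γ.normalC t i * sgn k * Γ.layer (pd (1 - k) (diffKernel m)) (dDensity ψ k) z

/-- The potential with the kernel `A ∇_y[γ_{k_s} - γ_{k_p}] ν_yᵀ`. -/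
noncomputable def potential5 (i : Fin 2) (z : Plane) : ℂ :=
  sgn i * Γ.layer (pd (1 - i) (diffKernel m)) (Γ.normalDensity ψ) z

/-- The derivative of a potential in the direction of the velocity, with the derivative moved to
the kernel. -/
noncomputable def layerAlong (K : Plane → ℂ) (θ : ℝ → ℂ) (z : Plane) : ℂ :=
  (Γ.velocity t 0 : ℂ) * Γ.layer (pd 0 K) θ z + (Γ.velocity t 1 : ℂ) * Γ.layer (pd 1 K) θ z

/-- The derivative of `potential2` in the direction of the velocity. -/
noncomputable def potential2Along (i : Fin 2) (z : Plane) : ℂ :=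
  ∑ l, -(sgn i * sgn l) * layerAlong Γ t (tensorKernel m (1 - i) (1 - l)) (dDensity ψ l) z

/-- The derivative of `potential3` in the direction of the velocity. -/
noncomputable def potential3Along (i : Fin 2) (z : Plane) : ℂ :=
  layerAlong Γ t (helmholtzKernel m.kS) (dDensity ψ i) z

/-- The derivative of `potential5` in the direction of the velocity. -/
noncomputable def potential5Along (i : Fin 2) (z : Plane) : ℂ :=
  sgn i * layerAlong Γ t (pd (1 - i) (diffKernel m)) (Γ.normalDensity ψ) z

variable {m Γ ψ muT t} {lamT : ℝ} {z : Plane}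

/-- Off the arc the traction of the potential equals the regularized expression, with the
derivatives along the arc replaced by derivatives in the fixed direction of the velocity. -/
lemma traction_doubleLayer (hψ : ∀ j, EdgeDensity fun τ => ψ τ j)
    (hT : lamT + muT = m.lam + m.mu) (hz : z ∉ Γ.carrier) (ht : t ∈ Icc (-1 : ℝ) 1) (i : Fin 2) :
    modTraction m lamT muT (Γ.normal t) (doubleLayer m Γ (modTraction m lamT muT) ψ) z i
      = -potential1 m Γ ψ muT t i z
        + ((m.mu + muT : ℝ) : ℂ) ^ 2 * ((Γ.speed t : ℂ)⁻¹ * potential2Along m Γ ψ t i z)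
        + 2 * ((m.mu + muT : ℝ) : ℂ) * ((Γ.speed t : ℂ)⁻¹ * potential3Along m Γ ψ t i z)
        - ((m.mu + muT : ℝ) : ℂ) * potential4 m Γ ψ t i z
        - ((m.mu + muT : ℝ) : ℂ) * ((Γ.speed t : ℂ)⁻¹ * potential5Along m Γ ψ t i z) := by
  have hd := (doubleLayer_pd m hψ hT hz).2
  have hS := smoothOff_helmholtzKernel m.kS_pos
  have hP := smoothOff_helmholtzKernel m.kP_pos
  have hs : (Γ.speed t : ℂ) ≠ 0 := by exact_mod_cast (Γ.speed_pos ht).ne'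
  have n0 : (Γ.normal t 0 : ℂ) = (Γ.velocity t 1 : ℂ) / Γ.speed t := by simp [OpenArc.normal]
  have n1 : (Γ.normal t 1 : ℂ) = -(Γ.velocity t 0 : ℂ) / Γ.speed t := by
    simp [OpenArc.normal, neg_div]
  have nc0 : Γ.normalC t 0 = (Γ.velocity t 1 : ℂ) / Γ.speed t := n0
  have nc1 : Γ.normalC t 1 = -(Γ.velocity t 0 : ℂ) / Γ.speed t := n1
  have hmu : (m.mu : ℂ) ≠ 0 := by exact_mod_cast m.mu_pos.ne'
  -- `λ` is eliminated in favour of `B = λ + 2μ`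
  set B : ℂ := ((m.lam + 2 * m.mu : ℝ) : ℂ) with hB
  have hB0 : B ≠ 0 := by rw [hB]; exact_mod_cast m.lam_add_two_mu_pos.ne'
  have hlT : (lamT : ℂ) = B - m.mu - muT := by
    have : lamT = (m.lam + 2 * m.mu) - m.mu - muT := by linarith
    rw [hB, this]; push_cast; ring
  have eB : ((1 / (m.lam + 2 * m.mu) : ℝ) : ℂ) = 1 / B := by rw [hB]; push_cast; rfl
  have eM : ((1 / m.mu : ℝ) : ℂ) = 1 / (m.mu : ℂ) := by push_cast; rfl
  have ekS : (m.kS : ℂ) ^ 2 = (m.rhoOmegaSq : ℂ) / m.mu := by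
    rw [eq_div_iff hmu, ← m.mu_mul_kS_sq]; push_cast; ring
  have ekP : (m.kP : ℂ) ^ 2 = (m.rhoOmegaSq : ℂ) / B := by
    rw [eq_div_iff hB0, ← m.mul_kP_sq, hB]; push_cast; ring
  -- relations between the potentials with the density `dψ_j`
  have hr (l : Fin 2) := layer_relations m (Γ := Γ) (θ := dDensity ψ l) (hψ l).integrable_deriv hz
  have r1 (a l : Fin 2) : Γ.layer (pd a (tensorKernel m 1 0)) (dDensity ψ l) z
      = Γ.layer (pd a (tensorKernel m 0 1)) (dDensity ψ l) z := (hr l).2.2.1 a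
  have r2 (l : Fin 2) : Γ.layer (pd 1 (tensorKernel m 0 0)) (dDensity ψ l) z
      = Γ.layer (pd 0 (tensorKernel m 0 1)) (dDensity ψ l) z
        + 1 / (m.mu : ℂ) * Γ.layer (pd 1 (helmholtzKernel m.kS)) (dDensity ψ l) z := by
    have h := (hr l).2.1 0
    simp only [sgn, if_true, eM, sub_zero, r1] at h
    linear_combination -h
  have r3 (l : Fin 2) : Γ.layer (pd 1 (tensorKernel m 1 1)) (dDensity ψ l) z
      = 1 / B * Γ.layer (pd 1 (helmholtzKernel m.kP)) (dDensity ψ l) z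
        - Γ.layer (pd 0 (tensorKernel m 0 1)) (dDensity ψ l) z := by
    have h := (hr l).1 1
    rw [eB] at h
    linear_combination h
  have r4 (l : Fin 2) : Γ.layer (pd 1 (tensorKernel m 0 1)) (dDensity ψ l) z
      = 1 / B * Γ.layer (pd 0 (helmholtzKernel m.kP)) (dDensity ψ l) z
        - Γ.layer (pd 0 (tensorKernel m 0 0)) (dDensity ψ l) z := by
    have h := (hr l).1 0
    rw [eB, r1] at h
    linear_combination h
  have r5 (l : Fin 2) : Γ.layer (pd 0 (tensorKernel m 1 1)) (dDensity ψ l) z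
      = 1 / B * Γ.layer (pd 0 (helmholtzKernel m.kP)) (dDensity ψ l) z
        + 1 / (m.mu : ℂ) * Γ.layer (pd 0 (helmholtzKernel m.kS)) (dDensity ψ l) z
        - Γ.layer (pd 0 (tensorKernel m 0 0)) (dDensity ψ l) z := by
    have h := (hr l).2.1 1
    simp only [sgn, one_ne_zero, if_false, eM, sub_self, r4] at h
    linear_combination h
  have r6 (a l : Fin 2) : Γ.layer (pd a (diffKernel m)) (dDensity ψ l) z
      = Γ.layer (pd a (helmholtzKernel m.kS)) (dDensity ψ l) z
        - Γ.layer (pd a (helmholtzKernel m.kP)) (dDensity ψ l) z := (hr l).2.2.2.1 a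
  -- relations between the potentials with the density `|x'| ν · ψ`
  have hn := layer_relations m (Γ := Γ) (intervalIntegrable_normalDensity (Γ := Γ) hψ) hz
  have a1 (a b : Fin 2) : Γ.layer (pd a (pd b (diffKernel m))) (Γ.normalDensity ψ) z
      = Γ.layer (pd a (pd b (helmholtzKernel m.kS))) (Γ.normalDensity ψ) z
        - Γ.layer (pd a (pd b (helmholtzKernel m.kP))) (Γ.normalDensity ψ) z :=
    hn.2.2.2.2.1 a b
  have a2 : Γ.layer (pd 1 (pd 1 (helmholtzKernel m.kP))) (Γ.normalDensity ψ) z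
      = -((m.rhoOmegaSq : ℂ) / B) * (Γ.layer (helmholtzKernel m.kP) (Γ.velDensity ψ 1 0) z
          - Γ.layer (helmholtzKernel m.kP) (Γ.velDensity ψ 0 1) z)
        - Γ.layer (pd 0 (pd 0 (helmholtzKernel m.kP))) (Γ.normalDensity ψ) z := by
    have h := hn.2.2.2.2.2.1 m.kP m.kP_pos
    rw [ekP, layer_normalDensity hψ hP hz] at h
    linear_combination h
  have a3 := hn.2.2.2.2.2.2 m.kP m.kP_pos
  have a4 (a b : Fin 2) := layer_normalDensity (Γ := Γ) hψ ((hS.pd b).pd a) hz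
  have a5 (a b : Fin 2) := layer_tangentDensity (Γ := Γ) hψ ((hS.pd b).pd a) hz
  -- relations between the potentials with the densities `x'_c ψ_j`
  have hv (c j : Fin 2) := layer_relations m (Γ := Γ)
    (intervalIntegrable_velDensity (Γ := Γ) hψ c j) hz
  have v1 (c j : Fin 2) : Γ.layer (pd 1 (pd 1 (helmholtzKernel m.kS))) (Γ.velDensity ψ c j) z
      = -((m.rhoOmegaSq : ℂ) / m.mu) * Γ.layer (helmholtzKernel m.kS) (Γ.velDensity ψ c j) z
        - Γ.layer (pd 0 (pd 0 (helmholtzKernel m.kS))) (Γ.velDensity ψ c j) z := by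
    have h := (hv c j).2.2.2.2.2.1 m.kS m.kS_pos
    rw [ekS] at h
    linear_combination h
  have v2 (c j : Fin 2) := (hv c j).2.2.2.2.2.2 m.kS m.kS_pos
  have ibp (a j : Fin 2) := layer_dDensity (Γ := Γ) hψ (hS.pd a) hz j
  clear hr hn hv
  have ev : ((muT * m.kS ^ 2 : ℝ) : ℂ) = muT * ((m.rhoOmegaSq : ℂ) / m.mu) := by
    rw [← ekS]; push_cast; rfl
  fin_cases i
  · simp only [Fin.zero_eta, modTraction, normalDeriv, normalDiv, normalCurl, curl, hd,
      Pi.add_apply, Pi.smul_apply, smul_eq_mul, Fin.sum_univ_two, Fintype.sum_prod_type,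
      regularPotentialPd, potential1, potential2Along, potential3Along, potential4,
      potential5Along, layerAlong, coeff1, kernel1, sgn, n0, n1, nc0, nc1, ev,
      Matrix.cons_val, sub_zero, sub_self, if_true, one_ne_zero, zero_ne_one, if_false]
    simp only [r1, r2, r3, r4, r5, r6, a1, a2, a3, a4, a5, hlT]
    simp only [ibp, v1, v2]
    push_cast
    field_simp
    ring
  · simp only [Fin.mk_one, modTraction, normalDeriv, normalDiv, normalCurl, curl, hd,
      Pi.add_apply, Pi.smul_apply, smul_eq_mul, Fin.sum_univ_two, Fintype.sum_prod_type,
      regularPotentialPd, potential1, potential2Along, potential3Along, potential4,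
      potential5Along, layerAlong, coeff1, kernel1, sgn, n0, n1, nc0, nc1, ev,
      Matrix.cons_val, sub_zero, sub_self, if_true, one_ne_zero, zero_ne_one, if_false]
    simp only [r1, r2, r3, r4, r5, r6, a1, a2, a3, a4, a5, hlT]
    simp only [ibp, v1, v2]
    push_cast
    field_simp
    ring

end Identity

/-! ### The regularized expression on the arc -/

section OnArc

variable {Γ : OpenArc} {ψ : ℝ → CVec} (m : ElasticMedium) {t : ℝ}

lemma weaklySingular_helmholtzKernel {k : ℝ} (hk : 0 < k) : WeaklySingular (helmholtzKernel k) :=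
  ⟨smoothOff_helmholtzKernel hk, kernelOrder_helmholtzKernel hk⟩

lemma weaklySingular_tensorKernel (i j : Fin 2) : WeaklySingular (tensorKernel m i j) :=
  ⟨smoothOff_tensorKernel m i j, kernelOrder_tensorKernel m i j⟩

lemma weaklySingular_pd_diffKernel (i : Fin 2) : WeaklySingular (pd i (diffKernel m)) :=
  ⟨(smoothOff_diffKernel m).pd i, kernelOrder_pd_diffKernel m i⟩

lemma weaklySingular_kernel1 (p : Fin 2 × Fin 2 × Fin 2) : WeaklySingular (kernel1 m p) := by
  rw [kernel1]
  split_ifs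
  · exact weaklySingular_helmholtzKernel m.kS_pos
  · exact weaklySingular_helmholtzKernel m.kP_pos

lemma speed_mul_tangentialDeriv (hψ : ∀ j, EdgeDensity fun τ => ψ τ j) {τ : ℝ}
    (hτ : τ ∈ Ioo (-1 : ℝ) 1) (j : Fin 2) :
    (Γ.speed τ : ℂ) * Γ.tangentialDeriv ψ τ j = dDensity ψ j τ := by
  have hs : (Γ.speed τ : ℂ) ≠ 0 := by
    exact_mod_cast (Γ.speed_pos (Ioo_subset_Icc_self hτ)).ne'
  have hd : deriv ψ τ j = dDensity ψ j τ := by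
    rw [deriv_pi fun j => (hψ j).differentiableAt hτ]; rfl
  simp only [OpenArc.tangentialDeriv, Pi.smul_apply, Complex.real_smul, Complex.ofReal_inv, hd]
  field_simp

lemma speed_mul_normalC {τ : ℝ} (hτ : τ ∈ Ioo (-1 : ℝ) 1) :
    (Γ.speed τ : ℂ) * Γ.normalC τ 0 = Γ.velocity τ 1 ∧
      (Γ.speed τ : ℂ) * Γ.normalC τ 1 = -(Γ.velocity τ 0 : ℂ) := by
  have hs : (Γ.speed τ : ℂ) ≠ 0 := by
    exact_mod_cast (Γ.speed_pos (Ioo_subset_Icc_self hτ)).ne'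
  rw [OpenArc.normalC_eq, OpenArc.normalC_eq]
  constructor
  · simp only [sgn, if_true, sub_zero]; field_simp
  · simp only [sgn, one_ne_zero, if_false, sub_self]; field_simp

lemma integral_integrand1 (hψ : ∀ j, EdgeDensity fun τ => ψ τ j) (muT : ℝ)
    (ht : t ∈ Ioo (-1 : ℝ) 1) : Γ.IsIntegrable (integrand1 m Γ muT ψ t) ∧
      ∀ i, Γ.integral (integrand1 m Γ muT ψ t) i = potential1 m Γ ψ muT t i (Γ.param t) := by
  refine OpenArc.integral_eq_sum_layer (c := fun i => coeff1 m Γ muT t i)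
    (K := fun _ => kernel1 m) (θ := fun _ p => Γ.velDensity ψ (1 - p.2.1) p.2.2)
    (fun i p => (layer_tendsto (weaklySingular_kernel1 m p) ht
      (intervalIntegrable_velDensity hψ _ _) (contDiffOn_velDensity hψ _ _)).1) fun τ hτ i => ?_
  obtain ⟨h0, h1⟩ := speed_mul_normalC (Γ := Γ) hτ
  fin_cases i
  · simp [integrand1, coeff1, kernel1, Fintype.sum_prod_type, dotProduct,
      Matrix.vecMulVec_apply, gammaS_eq, gammaP_eq, sgn, OpenArc.velDensity, ← h0,
      neg_eq_iff_eq_neg.1 h1.symm]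
    ring
  · simp [integrand1, coeff1, kernel1, Fintype.sum_prod_type, dotProduct,
      Matrix.vecMulVec_apply, gammaS_eq, gammaP_eq, sgn, OpenArc.velDensity, ← h0,
      neg_eq_iff_eq_neg.1 h1.symm]
    ring

lemma integral_integrand2 (hψ : ∀ j, EdgeDensity fun τ => ψ τ j) (ht : t ∈ Ioo (-1 : ℝ) 1) :
    Γ.IsIntegrable (integrand2 m Γ ψ t) ∧
      ∀ i, Γ.integral (integrand2 m Γ ψ t) i = potential2 m Γ ψ i (Γ.param t) := by
  refine OpenArc.integral_eq_sum_layer (c := fun i l => -(sgn i * sgn l))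
    (K := fun i l => tensorKernel m (1 - i) (1 - l)) (θ := fun _ l => dDensity ψ l)
    (fun i l => (layer_tendsto (weaklySingular_tensorKernel m _ _) ht
      (hψ l).integrable_deriv (hψ l).contDiffOn_deriv).1) fun τ hτ i => ?_
  have h := speed_mul_tangentialDeriv (Γ := Γ) hψ hτ
  simp only [← h]
  fin_cases i
  · simp [integrand2, matA, Matrix.mulVec, Matrix.vecMul, dotProduct, Matrix.mul_apply,
      tensorE_eq, sgn]
    ring
  · simp [integrand2, matA, Matrix.mulVec, Matrix.vecMul, dotProduct, Matrix.mul_apply,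
      tensorE_eq, sgn]
    ring

lemma integral_integrand3 (hψ : ∀ j, EdgeDensity fun τ => ψ τ j) (ht : t ∈ Ioo (-1 : ℝ) 1) :
    Γ.IsIntegrable (integrand3 m Γ ψ t) ∧
      ∀ i, Γ.integral (integrand3 m Γ ψ t) i = potential3 m Γ ψ i (Γ.param t) := by
  have := OpenArc.integral_eq_sum_layer (Γ := Γ) (f := integrand3 m Γ ψ t)
    (c := fun _ (_ : Unit) => 1)
    (K := fun _ _ => helmholtzKernel m.kS) (θ := fun i _ => dDensity ψ i)
    (fun i l => (layer_tendsto (weaklySingular_helmholtzKernel m.kS_pos) ht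
      (hψ i).integrable_deriv (hψ i).contDiffOn_deriv).1) fun τ hτ i => by
        simp only [← speed_mul_tangentialDeriv (Γ := Γ) hψ hτ, integrand3, gammaS_eq,
          Pi.smul_apply, smul_eq_mul, Finset.univ_unique, Finset.sum_singleton]
        ring
  simpa [potential3] using this

lemma integral_integrand4 (hψ : ∀ j, EdgeDensity fun τ => ψ τ j) (ht : t ∈ Ioo (-1 : ℝ) 1) :
    Γ.IsIntegrable (integrand4 m Γ ψ t) ∧
      ∀ i, Γ.integral (integrand4 m Γ ψ t) i = potential4 m Γ ψ t i (Γ.param t) := by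
  refine OpenArc.integral_eq_sum_layer (c := fun i k => Γ.normalC t i * sgn k)
    (K := fun _ k => pd (1 - k) (diffKernel m)) (θ := fun _ k => dDensity ψ k)
    (fun i k => (layer_tendsto (weaklySingular_pd_diffKernel m _) ht
      (hψ k).integrable_deriv (hψ k).contDiffOn_deriv).1) fun τ hτ i => ?_
  simp only [← speed_mul_tangentialDeriv (Γ := Γ) hψ hτ]
  simp [integrand4, matA, Matrix.mulVec, dotProduct, Matrix.mul_apply, Matrix.vecMulVec_apply,
    gradXDiff_eq, sgn]
  ring

lemma integral_integrand5 (hψ : ∀ j, EdgeDensity fun τ => ψ τ j) (ht : t ∈ Ioo (-1 : ℝ) 1) :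
    Γ.IsIntegrable (integrand5 m Γ ψ t) ∧
      ∀ i, Γ.integral (integrand5 m Γ ψ t) i = potential5 m Γ ψ i (Γ.param t) := by
  have := OpenArc.integral_eq_sum_layer (Γ := Γ) (f := integrand5 m Γ ψ t)
    (c := fun i (_ : Unit) => sgn i)
    (K := fun i _ => pd (1 - i) (diffKernel m)) (θ := fun _ _ => Γ.normalDensity ψ)
    (fun i l => (layer_tendsto (weaklySingular_pd_diffKernel m _) ht
      (intervalIntegrable_normalDensity hψ) (contDiffOn_normalDensity hψ)).1) fun τ hτ i => by
        obtain ⟨h0, h1⟩ := speed_mul_normalC (Γ := Γ) hτ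
        fin_cases i
        · simp [integrand5, matA, Matrix.mulVec, dotProduct, Matrix.mul_apply,
            Matrix.vecMulVec_apply, gradYDiff_eq, sgn, OpenArc.normalDensity, OpenArc.velDensity,
            ← h0, neg_eq_iff_eq_neg.1 h1.symm]
          ring
        · simp [integrand5, matA, Matrix.mulVec, dotProduct, Matrix.mul_apply,
            Matrix.vecMulVec_apply, gradYDiff_eq, sgn, OpenArc.normalDensity, OpenArc.velDensity,
            ← h0, neg_eq_iff_eq_neg.1 h1.symm]
          ring
  simpa [potential5] using this

/-- A field along the arc that agrees componentwise with differentiable functions has their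
tangential derivatives. -/
lemma tangentialDeriv_of_eqOn {F : ℝ → CVec} {G : Fin 2 → ℝ → ℂ} (ht : t ∈ Ioo (-1 : ℝ) 1)
    (h : ∀ s ∈ Ioo (-1 : ℝ) 1, ∀ i, F s i = G i s) (hG : ∀ i, DifferentiableAt ℝ (G i) t) :
    DifferentiableAt ℝ F t ∧
      ∀ i, Γ.tangentialDeriv F t i = (Γ.speed t : ℂ)⁻¹ * deriv (G i) t := by
  have hev (i : Fin 2) : (fun s => F s i) =ᶠ[𝓝 t] G i := by
    filter_upwards [Ioo_mem_nhds ht.1 ht.2] with s hs using h s hs i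
  have hF (i : Fin 2) : DifferentiableAt ℝ (fun s => F s i) t :=
    (hG i).congr_of_eventuallyEq (hev i)
  refine ⟨differentiableAt_pi.2 hF, fun i => ?_⟩
  rw [OpenArc.tangentialDeriv, deriv_pi hF, Pi.smul_apply, (hev i).deriv_eq, Complex.real_smul,
    Complex.ofReal_inv]

lemma potential2_deriv (hψ : ∀ j, EdgeDensity fun τ => ψ τ j) (ht : t ∈ Ioo (-1 : ℝ) 1)
    (i : Fin 2) : DifferentiableAt ℝ (fun s => potential2 m Γ ψ i (Γ.param s)) t ∧
      Tendsto (fun ε => potential2Along m Γ ψ t i (Γ.param t + ε • Γ.normal t)) (𝓝[≠] (0 : ℝ))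
        (𝓝 (deriv (fun s => potential2 m Γ ψ i (Γ.param s)) t)) := by
  have h (l : Fin 2) := layer_deriv_tendsto (Γ := Γ)
    (weaklySingular_tensorKernel m (1 - i) (1 - l)) ht (hψ l).integrable_deriv
    (hψ l).contDiffOn_deriv
  have hs := HasDerivAt.fun_sum (u := Finset.univ) fun l _ =>
    (h l).1.hasDerivAt.const_mul (-(sgn i * sgn l))
  refine ⟨hs.differentiableAt, ?_⟩
  have he : deriv (fun s => potential2 m Γ ψ i (Γ.param s)) t = _ := hs.deriv
  rw [he]
  exact tendsto_finsetSum _ fun l _ => (h l).2.const_mul _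

lemma potential3_deriv (hψ : ∀ j, EdgeDensity fun τ => ψ τ j) (ht : t ∈ Ioo (-1 : ℝ) 1)
    (i : Fin 2) : DifferentiableAt ℝ (fun s => potential3 m Γ ψ i (Γ.param s)) t ∧
      Tendsto (fun ε => potential3Along m Γ ψ t i (Γ.param t + ε • Γ.normal t)) (𝓝[≠] (0 : ℝ))
        (𝓝 (deriv (fun s => potential3 m Γ ψ i (Γ.param s)) t)) :=
  layer_deriv_tendsto (weaklySingular_helmholtzKernel m.kS_pos) ht (hψ i).integrable_deriv
    (hψ i).contDiffOn_deriv

lemma potential5_deriv (hψ : ∀ j, EdgeDensity fun τ => ψ τ j) (ht : t ∈ Ioo (-1 : ℝ) 1)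
    (i : Fin 2) : DifferentiableAt ℝ (fun s => potential5 m Γ ψ i (Γ.param s)) t ∧
      Tendsto (fun ε => potential5Along m Γ ψ t i (Γ.param t + ε • Γ.normal t)) (𝓝[≠] (0 : ℝ))
        (𝓝 (deriv (fun s => potential5 m Γ ψ i (Γ.param s)) t)) := by
  have h := layer_deriv_tendsto (Γ := Γ) (weaklySingular_pd_diffKernel m (1 - i)) ht
    (intervalIntegrable_normalDensity (Γ := Γ) hψ) (contDiffOn_normalDensity hψ)
  have hs := h.1.hasDerivAt.const_mul (sgn i)
  refine ⟨hs.differentiableAt, ?_⟩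
  have he : deriv (fun s => potential5 m Γ ψ i (Γ.param s)) t = _ := hs.deriv
  rw [he]
  exact h.2.const_mul _

lemma potential1_tendsto (hψ : ∀ j, EdgeDensity fun τ => ψ τ j) (muT : ℝ)
    (ht : t ∈ Ioo (-1 : ℝ) 1) (i : Fin 2) :
    Tendsto (fun ε => potential1 m Γ ψ muT t i (Γ.param t + ε • Γ.normal t)) (𝓝[≠] (0 : ℝ))
      (𝓝 (potential1 m Γ ψ muT t i (Γ.param t))) :=
  tendsto_finsetSum _ fun p _ => (layer_tendsto (weaklySingular_kernel1 m p) ht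
    (intervalIntegrable_velDensity hψ _ _) (contDiffOn_velDensity hψ _ _)).2.const_mul _

lemma potential4_tendsto (hψ : ∀ j, EdgeDensity fun τ => ψ τ j) (ht : t ∈ Ioo (-1 : ℝ) 1)
    (i : Fin 2) :
    Tendsto (fun ε => potential4 m Γ ψ t i (Γ.param t + ε • Γ.normal t)) (𝓝[≠] (0 : ℝ))
      (𝓝 (potential4 m Γ ψ t i (Γ.param t))) :=
  tendsto_finsetSum _ fun k _ => (layer_tendsto (weaklySingular_pd_diffKernel m (1 - k)) ht
    (hψ k).integrable_deriv (hψ k).contDiffOn_deriv).2.const_mul _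

end OnArc

/-! ### The limit of the traction -/

section Limit

variable {Γ : OpenArc} {ψ : ℝ → CVec} (m : ElasticMedium) {t lamT muT : ℝ}

lemma tangentialDeriv_integrand2 (hψ : ∀ j, EdgeDensity fun τ => ψ τ j)
    (ht : t ∈ Ioo (-1 : ℝ) 1) :
    DifferentiableAt ℝ (fun s => Γ.integral (integrand2 m Γ ψ s)) t ∧
      ∀ i, Γ.tangentialDeriv (fun s => Γ.integral (integrand2 m Γ ψ s)) t i
        = (Γ.speed t : ℂ)⁻¹ * deriv (fun s => potential2 m Γ ψ i (Γ.param s)) t :=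
  tangentialDeriv_of_eqOn ht (fun _ hs => (integral_integrand2 m hψ hs).2)
    fun i => (potential2_deriv m hψ ht i).1

lemma tangentialDeriv_integrand3 (hψ : ∀ j, EdgeDensity fun τ => ψ τ j)
    (ht : t ∈ Ioo (-1 : ℝ) 1) :
    DifferentiableAt ℝ (fun s => Γ.integral (integrand3 m Γ ψ s)) t ∧
      ∀ i, Γ.tangentialDeriv (fun s => Γ.integral (integrand3 m Γ ψ s)) t i
        = (Γ.speed t : ℂ)⁻¹ * deriv (fun s => potential3 m Γ ψ i (Γ.param s)) t :=
  tangentialDeriv_of_eqOn ht (fun _ hs => (integral_integrand3 m hψ hs).2)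
    fun i => (potential3_deriv m hψ ht i).1

lemma tangentialDeriv_integrand5 (hψ : ∀ j, EdgeDensity fun τ => ψ τ j)
    (ht : t ∈ Ioo (-1 : ℝ) 1) :
    DifferentiableAt ℝ (fun s => Γ.integral (integrand5 m Γ ψ s)) t ∧
      ∀ i, Γ.tangentialDeriv (fun s => Γ.integral (integrand5 m Γ ψ s)) t i
        = (Γ.speed t : ℂ)⁻¹ * deriv (fun s => potential5 m Γ ψ i (Γ.param s)) t :=
  tangentialDeriv_of_eqOn ht (fun _ hs => (integral_integrand5 m hψ hs).2)
    fun i => (potential5_deriv m hψ ht i).1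

lemma regularizedExists_of_edgeDensity (hψ : ∀ j, EdgeDensity fun τ => ψ τ j) (muT : ℝ)
    (ht : t ∈ Ioo (-1 : ℝ) 1) : RegularizedExists m Γ muT ψ t :=
  ⟨fun _ hs => differentiableAt_pi.2 fun j => (hψ j).differentiableAt hs,
    fun _ hs => ⟨(integral_integrand1 m hψ muT hs).1, (integral_integrand2 m hψ hs).1,
      (integral_integrand3 m hψ hs).1, (integral_integrand4 m hψ hs).1,
      (integral_integrand5 m hψ hs).1⟩,
    (tangentialDeriv_integrand2 m hψ ht).1, (tangentialDeriv_integrand3 m hψ ht).1,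
    (tangentialDeriv_integrand5 m hψ ht).1⟩

/-- The traction off the arc converges, from both sides, to the regularized expression. -/
lemma offArcTraction_tendsto (hψ : ∀ j, EdgeDensity fun τ => ψ τ j)
    (hT : lamT + muT = m.lam + m.mu) (ht : t ∈ Ioo (-1 : ℝ) 1) :
    Tendsto (offArcTraction m Γ (modTraction m lamT muT) ψ t) (𝓝[≠] 0)
      (𝓝 (regularized m Γ muT ψ t)) := by
  refine tendsto_pi_nhds.2 fun i => ?_
  have e2 := (tangentialDeriv_integrand2 (Γ := Γ) m hψ ht).2 i
  have e3 := (tangentialDeriv_integrand3 (Γ := Γ) m hψ ht).2 i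
  have e5 := (tangentialDeriv_integrand5 (Γ := Γ) m hψ ht).2 i
  have hlim := ((((potential1_tendsto (Γ := Γ) m hψ muT ht i).neg.add
    (((potential2_deriv (Γ := Γ) m hψ ht i).2.const_mul (Γ.speed t : ℂ)⁻¹).const_mul
      (((m.mu + muT : ℝ) : ℂ) ^ 2))).add
    (((potential3_deriv (Γ := Γ) m hψ ht i).2.const_mul (Γ.speed t : ℂ)⁻¹).const_mul
      (2 * ((m.mu + muT : ℝ) : ℂ)))).sub
    ((potential4_tendsto (Γ := Γ) m hψ ht i).const_mul ((m.mu + muT : ℝ) : ℂ))).sub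
    (((potential5_deriv (Γ := Γ) m hψ ht i).2.const_mul (Γ.speed t : ℂ)⁻¹).const_mul
      ((m.mu + muT : ℝ) : ℂ))
  have hval : regularized m Γ muT ψ t i
      = -potential1 m Γ ψ muT t i (Γ.param t)
        + ((m.mu + muT : ℝ) : ℂ) ^ 2
          * ((Γ.speed t : ℂ)⁻¹ * deriv (fun s => potential2 m Γ ψ i (Γ.param s)) t)
        + 2 * ((m.mu + muT : ℝ) : ℂ)
          * ((Γ.speed t : ℂ)⁻¹ * deriv (fun s => potential3 m Γ ψ i (Γ.param s)) t)
        - ((m.mu + muT : ℝ) : ℂ) * potential4 m Γ ψ t i (Γ.param t)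
        - ((m.mu + muT : ℝ) : ℂ)
          * ((Γ.speed t : ℂ)⁻¹ * deriv (fun s => potential5 m Γ ψ i (Γ.param s)) t) := by
    simp only [regularized, Pi.add_apply, Pi.sub_apply, Pi.neg_apply, Pi.smul_apply,
      Complex.real_smul, e2, e3, e5, (integral_integrand1 (Γ := Γ) m hψ muT ht).2,
      (integral_integrand4 (Γ := Γ) m hψ ht).2]
    push_cast
    rfl
  rw [hval]
  refine hlim.congr' ?_
  filter_upwards [Γ.eventually_notMem_carrier ht] with ε hε
  exact (traction_doubleLayer hψ hT hε (Ioo_subset_Icc_self ht) i).symm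

lemma hypersingular_eq_regularized (hψ : ∀ j, EdgeDensity fun τ => ψ τ j)
    (hT : lamT + muT = m.lam + m.mu) (ht : t ∈ Ioo (-1 : ℝ) 1) :
    HypersingularExists m Γ (modTraction m lamT muT) ψ t ∧ RegularizedExists m Γ muT ψ t ∧
      hypersingular m Γ (modTraction m lamT muT) ψ t = regularized m Γ muT ψ t :=
  ⟨⟨fun _ hz => ⟨(doubleLayer_integrable m hψ hT hz).1, (doubleLayer_pd m hψ hT hz).1⟩,
      _, offArcTraction_tendsto m hψ hT ht⟩,
    regularizedExists_of_edgeDensity m hψ muT ht, (offArcTraction_tendsto m hψ hT ht).limUnder_eq⟩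

lemma traction_eq_modTraction : traction m = modTraction m m.lam m.mu := by
  funext ν v x
  rw [traction, modTraction, two_mul]

end Limit

end ElasticArc

theorem mainTheorem2 (m : ElasticMedium) (lamT muT : ℝ) (hT : lamT + muT = m.lam + m.mu)
    (Γ : OpenArc) (w : ℝ → ℝ) (hw : Γ.IsEdgeWeight w)
    (u : ℝ → CVec) (hu : ContDiffOn ℝ 2 u (Set.Icc (-1) 1))
    (t : ℝ) (ht : t ∈ Set.Ioo (-1 : ℝ) 1) :
    (HypersingularExists m Γ (modTraction m lamT muT) (weighted w u) t ∧
      RegularizedExists m Γ muT (weighted w u) t ∧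
      weightedHypersingular m Γ (modTraction m lamT muT) w u t =
        regularized m Γ muT (weighted w u) t) ∧
    (HypersingularExists m Γ (traction m) (weighted w u) t ∧
      RegularizedExists m Γ m.mu (weighted w u) t ∧
      weightedHypersingular m Γ (traction m) w u t =
        regularized m Γ m.mu (weighted w u) t) := by
  have hψ := fun j => edgeDensity_weighted hw hu j
  refine ⟨hypersingular_eq_regularized m hψ hT ht, ?_⟩
  rw [traction_eq_modTraction]
  exact hypersingular_eq_regularized m hψ rfl ht
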